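/- Let $\Bbbk$ be a field of characteristic $0$ and let $A=A^0\oplus A^1$ be an associative superalgebra over $\Bbbk$, not necessarily supercommutative and not necessarily unital. All signs below are written for homogeneous arguments, $|a|\in\{0,1\}$ denotes parity, and everything is extended multilinearly. For a permutation $\sigma$ the Koszul sign $\epsilon(\sigma)$ is $(-1)^{\alpha}$, where $\alpha$ is the number of pairs $i<j$ with $\sigma(i)>\sigma(j)$ and $|a_{\sigma(i)}||a_{\sigma(j)}|=1$. Let $D_n(A)$ be the super vector space of multilinear maps $f\colon A^{n+1}\to A$ that are supersymmetric, i.e. $f(\ldots,a_i,a_{i+1},\ldots)=(-1)^{|a_i||a_{i+1}|}f(\ldots,a_{i+1},a_i,\ldots)$, and let $D(A)=\prod_{n\ge0}D_n(A)$. For $f\in D_n(A)$, $g\in D_m(A)$ put $$f\barwedge g(a_0,\ldots,a_{n+m})=\sum_{\sigma}\epsilon(\sigma)\,f\big(g(a_{\sigma(0)},\ldots,a_{\sigma(m)}),a_{\sigma(m+1)},\ldots,a_{\sigma(n+m)}\big),$$ the sum being over the permutations with $\sigma(0)<\cdots<\sigma(m)$ and $\sigma(m+1)<\cdots<\sigma(m+n)$.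 The Nijenhuis--Richardson bracket is $[f,g]=f\barwedge g-(-1)^{|f||g|}g\barwedge f\in D_{n+m}(A)$, extended to $D(A)$ by $[\sum_i f_i,\sum_j g_j]=\sum_n\sum_{i=0}^n[f_i,g_{n-i}]$. Define $$\mu_n(a_0,\ldots,a_n)=\frac1{(n+1)!}\sum_{\sigma\in\Sigma_{n+1}}\epsilon(\sigma)\,a_{\sigma(0)}a_{\sigma(1)}\cdots a_{\sigma(n)},\qquad \rho_n=[\mu_n,-]\colon D(A)\to D(A).$$ Let $K_n\in\mathbb Q$ be given by $K_1=1$ and $K_n=\frac{-2}{(n+2)(n-1)}\sum_{i=1}^{n-1}S(n+1,i)K_i$ for $n\ge2$, where $S$ denotes the Stirling numbers of the second kind. For every linear operator $f\colon A\to A$ define $\Phi^i_f\in D_{i-1}(A)$, $i\ge1$, by $$\sum_{i=1}^\infty\Phi^i_f=\exp\Big(-\sum_{n\ge1}K_n\rho_n\Big)f .$$ (Both infinite sums are finite in each $D_N(A)$.) Then: 1. $\mu_n$ is an even element of $D_n(A)$ for every $n\ge0$, it equals the multiplication $a_0a_1\cdots a_n$ if $A$ is supercommutative, and for all $n,m\ge0$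 $$[\mu_n,\mu_m]=(n-m)\frac{(n+m+1)!}{(n+1)!\,(m+1)!}\,\mu_{n+m}.$$ 2. $D(A)$ is closed under the bracket, every $\rho_n$ is an even derivation of $D(A)$, and $\exp\big(-\sum_{n\ge1}K_n\rho_n\big)\colon D(A)\to D(A)$ is an isomorphism of Lie superalgebras, i.e. linear, bijective, parity-preserving and compatible with the bracket. 3. $\Phi^{n+1}_{\mathrm{Id}}=(-1)^n\mu_n$ for every $n\ge0$. 4. For all linear operators $f,g\colon A\to A$, with supercommutator $[f,g]$, and every $n\ge1$, $$\Phi^n_{[f,g]}=\sum_{i=1}^n\big[\Phi^i_f,\Phi^{n+1-i}_g\big].$$ 5. For every linear operator $f\colon A\to A$ one has $\Phi^1_f=f$ and, for every $n\ge1$, $$\Phi^{n+1}_f=\frac1n\sum_{h=1}^n(-1)^h\big[\mu_h,\Phi^{n-h+1}_f\big].$$ -/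

import Mathlib

open scoped BigOperators

namespace SuperNR

noncomputable section

/-! ### Koszul numbers -/

/-- The Koszul numbers: `K 1 = 1` and
`K n = -2 / ((n + 2) (n - 1)) * ∑_{i = 1}^{n - 1} S(n + 1, i) K i` for `n ≥ 2`, with `S` the Stirling
numbers of the second kind. The value at `0` is not used. -/
def koszulNumber : ℕ → ℚ
  | 0 => 0
  | 1 => 1
  | n + 2 => -2 / (((n : ℚ) + 4) * ((n : ℚ) + 1)) *
      ∑ i : Fin (n + 1), (Nat.stirlingSecond (n + 3) (i + 1) : ℚ) * koszulNumber (i + 1)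
  termination_by n => n
  decreasing_by omega

/-! ### Signs and parities -/

/-- The sign `(-1)^(a b)` for parities `a b`. -/
def paritySign (a b : ZMod 2) : ℤ := (-1) ^ (a.val * b.val)

/-- The Koszul sign: `v_0 v_1 ⋯ = ε(σ) v_{σ 0} v_{σ 1} ⋯` in a supercommutative algebra, if `v_i` has
parity `d i`. Every inversion `i < j`, `σ j < σ i` contributes the sign of interchanging `v_{σ i}` and
`v_{σ j}`. -/
def koszulSign {n : ℕ} (σ : Equiv.Perm (Fin n)) (d : Fin n → ZMod 2) : ℤ :=
  ∏ p : Fin n × Fin n with p.1 < p.2 ∧ σ p.2 < σ p.1, paritySign (d (σ p.1)) (d (σ p.2))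

/-- The shuffles of type `(k, N - k)`: permutations of `0, …, N - 1` which are increasing on the
first `k` indices and on the remaining ones. -/
def shuffles (k N : ℕ) : Finset (Equiv.Perm (Fin N)) :=
  {σ | (∀ i j : Fin N, i < j → (j : ℕ) < k → σ i < σ j) ∧
    (∀ i j : Fin N, i < j → k ≤ (i : ℕ) → σ i < σ j)}

variable {𝕜 V : Type*} [Field 𝕜] [AddCommGroup V] [Module 𝕜 V]

variable (𝕜 V) in
/-- Multilinear maps in `n + 1` variables. -/
abbrev Mult (n : ℕ) : Type _ := MultilinearMap 𝕜 (fun _ : Fin (n + 1) => V) V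

variable (𝕜 V) in
/-- Sequences `(f_0, f_1, …)` with `f_n` multilinear in `n + 1` variables, written as formal
sums `f_0 + f_1 + ⋯`. -/
abbrev MultSeq : Type _ := ∀ n : ℕ, Mult 𝕜 V n

/-- A linear operator, viewed as a multilinear map in one variable. -/
def ofLinear (f : V →ₗ[𝕜] V) : Mult 𝕜 V 0 := MultilinearMap.ofSubsingleton 𝕜 V V (0 : Fin 1) f

section Graded

variable (𝒱 : ZMod 2 → Submodule 𝕜 V)

/-- Supersymmetric multilinear maps: exchanging two adjacent homogeneous arguments multiplies the
value by the sign `(-1)^(|v_i| |v_{i+1}|)`. -/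
def symMult (n : ℕ) : Submodule 𝕜 (Mult 𝕜 V n) where
  carrier := {f | ∀ (d : Fin (n + 1) → ZMod 2) (v : Fin (n + 1) → V), (∀ i, v i ∈ 𝒱 (d i)) →
    ∀ i : Fin n, f v =
      paritySign (d i.castSucc) (d i.succ) • f (v ∘ Equiv.swap i.castSucc i.succ)}
  add_mem' := by
    intro f g hf hg d v hv i
    rw [add_apply, add_apply, smul_add, ← hf d v hv i, ← hg d v hv i]
  zero_mem' := by
    intro d v _ i
    simp
  smul_mem' := by
    intro c f hf d v hv i
    rw [smul_apply, smul_apply, smul_comm, ← hf d v hv i]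

/-- The space `D(V) = ∏_n D_n(V)` of sequences of supersymmetric multilinear maps. -/
def symSeq : Submodule 𝕜 (MultSeq 𝕜 V) := Submodule.pi Set.univ (fun n => symMult 𝒱 n)

/-- A multilinear map has parity `p` if it sends homogeneous elements of parities `d i` to an
element of parity `p + ∑ d i`. -/
def HasParity {n : ℕ} (p : ZMod 2) (f : Mult 𝕜 V n) : Prop :=
  ∀ (d : Fin (n + 1) → ZMod 2) (v : Fin (n + 1) → V), (∀ i, v i ∈ 𝒱 (d i)) →
    f v ∈ 𝒱 (p + ∑ i, d i)

/-- A sequence of multilinear maps has parity `p` if all its members have. -/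
def HasParitySeq (p : ZMod 2) (ω : MultSeq 𝕜 V) : Prop := ∀ n, HasParity 𝒱 p (ω n)

variable [DirectSum.Decomposition 𝒱]

/-- The projection of `V` onto its part of parity `d`. -/
def parityProj (d : ZMod 2) : V →ₗ[𝕜] V :=
  (𝒱 d).subtype ∘ₗ DirectSum.component 𝕜 (ZMod 2) (fun i => 𝒱 i) d ∘ₗ
    (DirectSum.decomposeLinearEquiv 𝒱).toLinearMap

theorem parityProj_apply (d : ZMod 2) (v : V) :
    parityProj 𝒱 d v = (DirectSum.decompose 𝒱 v d : V) := rfl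

theorem parityProj_of_mem {d : ZMod 2} {v : V} (hv : v ∈ 𝒱 d) : parityProj 𝒱 d v = v := by
  rw [parityProj_apply]
  exact DirectSum.decompose_of_mem_same 𝒱 hv

theorem parityProj_of_mem_ne {d e : ZMod 2} {v : V} (hv : v ∈ 𝒱 d) (h : d ≠ e) :
    parityProj 𝒱 e v = 0 := by
  rw [parityProj_apply]
  exact DirectSum.decompose_of_mem_ne 𝒱 hv h

/-- The component of parity `p` of a multilinear map. -/
def parityPart {n : ℕ} (p : ZMod 2) (f : Mult 𝕜 V n) : Mult 𝕜 V n :=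
  ∑ d : Fin (n + 1) → ZMod 2,
    (parityProj 𝒱 (p + ∑ i, d i)).compMultilinearMap
      (f.compLinearMap (fun i => parityProj 𝒱 (d i)))

/-- The component of parity `p` of a linear operator. -/
def linearParityPart (p : ZMod 2) (f : V →ₗ[𝕜] V) : V →ₗ[𝕜] V :=
  ∑ d : ZMod 2, parityProj 𝒱 (p + d) ∘ₗ f ∘ₗ parityProj 𝒱 d

/-- The supercommutator of linear operators: `f g - (-1)^(|f| |g|) g f` for homogeneous `f`, `g`,
extended bilinearly. -/
def superCommutator (f g : V →ₗ[𝕜] V) : V →ₗ[𝕜] V :=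
  ∑ p : ZMod 2, ∑ q : ZMod 2,
    (linearParityPart 𝒱 p f ∘ₗ linearParityPart 𝒱 q g -
      paritySign p q • (linearParityPart 𝒱 q g ∘ₗ linearParityPart 𝒱 p f))

/-- The multilinear map which on homogeneous `v_0, v_1, …` is
`ε(σ) f(v_{σ 0}, v_{σ 1}, …)`; see `koszulPerm_apply`. -/
def koszulPerm {n : ℕ} (σ : Equiv.Perm (Fin (n + 1))) (f : Mult 𝕜 V n) : Mult 𝕜 V n :=
  ∑ d : Fin (n + 1) → ZMod 2,
    koszulSign σ d • (f.domDomCongr σ).compLinearMap (fun i => parityProj 𝒱 (d i))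

theorem koszulPerm_apply {n : ℕ} (σ : Equiv.Perm (Fin (n + 1))) (f : Mult 𝕜 V n)
    (d : Fin (n + 1) → ZMod 2) (v : Fin (n + 1) → V) (hv : ∀ i, v i ∈ 𝒱 (d i)) :
    koszulPerm 𝒱 σ f v = koszulSign σ d • f (fun i => v (σ i)) := by
  unfold koszulPerm
  rw [sum_apply, Finset.sum_eq_single d]
  · simp only [smul_apply, MultilinearMap.compLinearMap_apply,
      MultilinearMap.domDomCongr_apply]
    congr 2
    funext i
    exact parityProj_of_mem 𝒱 (hv _)
  · intro e _ he
    obtain ⟨i, hi⟩ : ∃ i, e i ≠ d i := by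
      by_contra! h
      exact he (funext h)
    rw [smul_apply, MultilinearMap.compLinearMap_apply,
      MultilinearMap.map_coord_zero _ i, smul_zero]
    exact parityProj_of_mem_ne 𝒱 (hv i) (Ne.symm hi)
  · intro h
    exact absurd (Finset.mem_univ d) h

/-- The map `(v_0, …, v_N) ↦ f(g(v_0, …, v_m), v_{m+1}, …, v_N)`, where `n + m = N`; see
`insertFirst_apply`. -/
def insertFirst {n m N : ℕ} (h : n + m = N) (f : Mult 𝕜 V n) (g : Mult 𝕜 V m) : Mult 𝕜 V N :=
  (MultilinearMap.uncurrySum (N := fun _ : Fin (m + 1) ⊕ Fin n => V)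
    (f.curryLeft.compMultilinearMap g)).domDomCongr
      (finSumFinEquiv.trans (finCongr (by omega)))

theorem insertFirst_apply {n m N : ℕ} (h : n + m = N) (f : Mult 𝕜 V n) (g : Mult 𝕜 V m)
    (v : Fin (N + 1) → V) :
    insertFirst h f g v =
      f (Fin.cons (g (fun i : Fin (m + 1) => v ⟨i, by omega⟩))
        (fun j : Fin n => v ⟨m + 1 + j, by omega⟩)) := rfl

/-- The product `f ⊼ g`, for `f` in `n + 1` variables and `g` in `m + 1` variables:
`(v_0, …, v_N) ↦ ∑ ε(σ) f(g(v_{σ 0}, …, v_{σ m}), v_{σ(m+1)}, …, v_{σ N})`, the sum being over the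
shuffles of type `(m + 1, n)`; here `N = n + m`. -/
def nrProd {n m N : ℕ} (h : n + m = N) (f : Mult 𝕜 V n) (g : Mult 𝕜 V m) : Mult 𝕜 V N :=
  ∑ σ ∈ shuffles (m + 1) (N + 1), koszulPerm 𝒱 σ (insertFirst h f g)

/-- The Nijenhuis–Richardson bracket: `f ⊼ g - (-1)^(|f| |g|) g ⊼ f` for homogeneous `f`, `g`,
extended bilinearly. -/
def nrBracket {n m N : ℕ} (h : n + m = N) (f : Mult 𝕜 V n) (g : Mult 𝕜 V m) : Mult 𝕜 V N :=
  ∑ p : ZMod 2, ∑ q : ZMod 2,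
    (nrProd 𝒱 h (parityPart 𝒱 p f) (parityPart 𝒱 q g) -
      paritySign p q •
        nrProd 𝒱 ((Nat.add_comm m n).trans h) (parityPart 𝒱 q g) (parityPart 𝒱 p f))

/-- The Nijenhuis–Richardson bracket of formal sums: `[f, g]_N = ∑_{i=0}^N [f_i, g_{N-i}]`. -/
def seqBracket (f g : MultSeq 𝕜 V) : MultSeq 𝕜 V := fun N =>
  ∑ i : Fin (N + 1), nrBracket 𝒱 (show (i : ℕ) + (N - i) = N by omega) (f i) (g (N - i))

/-! Linearity of the bracket in the second argument. -/

theorem parityPart_add {n : ℕ} (p : ZMod 2) (f g : Mult 𝕜 V n) :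
    parityPart 𝒱 p (f + g) = parityPart 𝒱 p f + parityPart 𝒱 p g := by
  unfold parityPart
  rw [← Finset.sum_add_distrib]
  refine Finset.sum_congr rfl fun d _ => ?_
  ext v
  simp

theorem parityPart_smul {n : ℕ} (p : ZMod 2) (c : 𝕜) (f : Mult 𝕜 V n) :
    parityPart 𝒱 p (c • f) = c • parityPart 𝒱 p f := by
  unfold parityPart
  rw [Finset.smul_sum]
  refine Finset.sum_congr rfl fun d _ => ?_
  ext v
  simp

theorem koszulPerm_add {n : ℕ} (σ : Equiv.Perm (Fin (n + 1))) (f g : Mult 𝕜 V n) :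
    koszulPerm 𝒱 σ (f + g) = koszulPerm 𝒱 σ f + koszulPerm 𝒱 σ g := by
  unfold koszulPerm
  rw [← Finset.sum_add_distrib]
  refine Finset.sum_congr rfl fun d _ => ?_
  ext v
  simp

theorem koszulPerm_smul {n : ℕ} (σ : Equiv.Perm (Fin (n + 1))) (c : 𝕜) (f : Mult 𝕜 V n) :
    koszulPerm 𝒱 σ (c • f) = c • koszulPerm 𝒱 σ f := by
  unfold koszulPerm
  rw [Finset.smul_sum]
  refine Finset.sum_congr rfl fun d _ => ?_
  ext v
  simp [smul_comm c]

theorem nrProd_add_left {n m N : ℕ} (h : n + m = N) (f f' : Mult 𝕜 V n) (g : Mult 𝕜 V m) :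
    nrProd 𝒱 h (f + f') g = nrProd 𝒱 h f g + nrProd 𝒱 h f' g := by
  have : insertFirst h (f + f') g = insertFirst h f g + insertFirst h f' g := by
    ext v
    simp [insertFirst_apply]
  simp only [nrProd, this, koszulPerm_add, Finset.sum_add_distrib]

theorem nrProd_smul_left {n m N : ℕ} (h : n + m = N) (c : 𝕜) (f : Mult 𝕜 V n) (g : Mult 𝕜 V m) :
    nrProd 𝒱 h (c • f) g = c • nrProd 𝒱 h f g := by
  have : insertFirst h (c • f) g = c • insertFirst h f g := by
    ext v
    simp [insertFirst_apply]
  simp only [nrProd, this, koszulPerm_smul, Finset.smul_sum]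

theorem nrProd_add_right {n m N : ℕ} (h : n + m = N) (f : Mult 𝕜 V n) (g g' : Mult 𝕜 V m) :
    nrProd 𝒱 h f (g + g') = nrProd 𝒱 h f g + nrProd 𝒱 h f g' := by
  have : insertFirst h f (g + g') = insertFirst h f g + insertFirst h f g' := by
    ext v
    simp only [insertFirst_apply, add_apply, MultilinearMap.cons_add]
  simp only [nrProd, this, koszulPerm_add, Finset.sum_add_distrib]

theorem nrProd_smul_right {n m N : ℕ} (h : n + m = N) (c : 𝕜) (f : Mult 𝕜 V n) (g : Mult 𝕜 V m) :
    nrProd 𝒱 h f (c • g) = c • nrProd 𝒱 h f g := by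
  have : insertFirst h f (c • g) = c • insertFirst h f g := by
    ext v
    simp only [insertFirst_apply, smul_apply, MultilinearMap.cons_smul]
  simp only [nrProd, this, koszulPerm_smul, Finset.smul_sum]

theorem nrBracket_add_right {n m N : ℕ} (h : n + m = N) (f : Mult 𝕜 V n) (g g' : Mult 𝕜 V m) :
    nrBracket 𝒱 h f (g + g') = nrBracket 𝒱 h f g + nrBracket 𝒱 h f g' := by
  simp only [nrBracket, ← Finset.sum_add_distrib]
  refine Finset.sum_congr rfl fun p _ => Finset.sum_congr rfl fun q _ => ?_
  rw [parityPart_add, nrProd_add_right, nrProd_add_left, smul_add]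
  abel

theorem nrBracket_smul_right {n m N : ℕ} (h : n + m = N) (c : 𝕜) (f : Mult 𝕜 V n)
    (g : Mult 𝕜 V m) :
    nrBracket 𝒱 h f (c • g) = c • nrBracket 𝒱 h f g := by
  simp only [nrBracket, Finset.smul_sum]
  refine Finset.sum_congr rfl fun p _ => Finset.sum_congr rfl fun q _ => ?_
  rw [parityPart_smul, nrProd_smul_right, nrProd_smul_left, smul_sub, smul_comm c]

theorem nrBracket_zero_left {n m N : ℕ} (h : n + m = N) (g : Mult 𝕜 V m) :
    nrBracket 𝒱 h (0 : Mult 𝕜 V n) g = 0 := by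
  have h0 : ∀ p, parityPart 𝒱 p (0 : Mult 𝕜 V n) = 0 := fun p => by
    simpa using parityPart_smul 𝒱 p 0 (0 : Mult 𝕜 V n)
  unfold nrBracket
  refine Finset.sum_eq_zero fun p _ => Finset.sum_eq_zero fun q _ => ?_
  have h1 := nrProd_smul_left 𝒱 h 0 (0 : Mult 𝕜 V n) (parityPart 𝒱 q g)
  have h2 := nrProd_smul_right 𝒱 ((Nat.add_comm m n).trans h) 0 (parityPart 𝒱 q g)
    (0 : Mult 𝕜 V n)
  rw [zero_smul, zero_smul] at h1 h2
  rw [h0, h1, h2, smul_zero, sub_zero]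

/-- The adjoint operator `[α, -]` of a formal sum `α`. -/
def seqAd (α : MultSeq 𝕜 V) : MultSeq 𝕜 V →ₗ[𝕜] MultSeq 𝕜 V where
  toFun := seqBracket 𝒱 α
  map_add' ω ω' := by
    funext N
    simp only [seqBracket, Pi.add_apply, nrBracket_add_right, Finset.sum_add_distrib]
  map_smul' c ω := by
    funext N
    simp only [seqBracket, Pi.smul_apply, nrBracket_smul_right, Finset.smul_sum, RingHom.id_apply]

end Graded

/-! ### Superalgebras -/

section Algebra

variable {A : Type*} [NonUnitalRing A] [Module 𝕜 A] [IsScalarTower 𝕜 A A] [SMulCommClass 𝕜 A A]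

variable (𝕜 A) in
/-- The multiplication `(a_0, …, a_n) ↦ a_0 a_1 ⋯ a_n`. -/
def mulMap : ∀ n : ℕ, Mult 𝕜 A n
  | 0 => ofLinear LinearMap.id
  | n + 1 => LinearMap.uncurryLeft (M := fun _ : Fin (n + 1 + 1) => A)
      { toFun := fun a => (LinearMap.mulLeft 𝕜 a).compMultilinearMap (mulMap n)
        map_add' := fun a b => by
          ext v
          simp [add_mul]
        map_smul' := fun c a => by
          ext v
          simp [smul_mul_assoc] }

theorem mulMap_zero_apply (v : Fin 1 → A) : mulMap 𝕜 A 0 v = v 0 := rfl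

theorem mulMap_succ_apply (n : ℕ) (v : Fin (n + 2) → A) :
    mulMap 𝕜 A (n + 1) v = v 0 * mulMap 𝕜 A n (Fin.tail v) := rfl

variable (𝒜 : ZMod 2 → Submodule 𝕜 A) [DirectSum.Decomposition 𝒜]

/-- The symmetrized multiplication
`μ_n(a_0, …, a_n) = (1 / (n+1)!) ∑_σ ε(σ) a_{σ 0} a_{σ 1} ⋯ a_{σ n}`. -/
def mu (n : ℕ) : Mult 𝕜 A n :=
  ((Nat.factorial (n + 1) : 𝕜)⁻¹) •
    ∑ σ : Equiv.Perm (Fin (n + 1)), koszulPerm 𝒜 σ (mulMap 𝕜 A n)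

/-- The adjoint operator `ρ_n = [μ_n, -]` on formal sums. -/
def rho (n : ℕ) : MultSeq 𝕜 A →ₗ[𝕜] MultSeq 𝕜 A := seqAd 𝒜 (Pi.single n (mu 𝒜 n))

theorem rho_apply_of_lt {n N : ℕ} (h : N < n) (ω : MultSeq 𝕜 A) : rho 𝒜 n ω N = 0 := by
  change seqBracket 𝒜 (Pi.single n (mu 𝒜 n)) ω N = 0
  unfold seqBracket
  refine Finset.sum_eq_zero fun i _ => ?_
  have hi : (i : ℕ) ≠ n := by omega
  rw [Pi.single_eq_of_ne hi, nrBracket_zero_left]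

theorem rho_apply_congr {n N : ℕ} (hn : 1 ≤ n) {ω : MultSeq 𝕜 A}
    (h : ∀ M < N, ω M = 0) : rho 𝒜 n ω N = 0 := by
  change seqBracket 𝒜 (Pi.single n (mu 𝒜 n)) ω N = 0
  unfold seqBracket
  refine Finset.sum_eq_zero fun i _ => ?_
  by_cases hi : (i : ℕ) = n
  · rw [h (N - i) (by omega)]
    simpa using nrBracket_smul_right 𝒜 (show (i : ℕ) + (N - i) = N by omega) (0 : 𝕜)
      ((Pi.single n (mu 𝒜 n) : MultSeq 𝕜 A) i) 0
  · rw [Pi.single_eq_of_ne hi, nrBracket_zero_left]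

/-- The operator `-∑_{n ≥ 1} K_n ρ_n`. In degree `N` the terms with `n > N` vanish, by
`rho_apply_of_lt`. -/
def koszulGenerator : MultSeq 𝕜 A →ₗ[𝕜] MultSeq 𝕜 A :=
  LinearMap.pi fun N =>
    -∑ n ∈ Finset.Icc 1 N, (koszulNumber n : 𝕜) • (LinearMap.proj N ∘ₗ rho 𝒜 n)

theorem koszulGenerator_pow_apply_of_lt (k : ℕ) :
    ∀ {N : ℕ}, N < k → ∀ ω : MultSeq 𝕜 A, (koszulGenerator 𝒜 ^ k) ω N = 0 := by
  induction k with
  | zero => intro N h; omega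
  | succ k ih =>
    intro N h ω
    rw [pow_succ', Module.End.mul_apply]
    simp only [koszulGenerator, LinearMap.pi_apply, LinearMap.neg_apply, LinearMap.sum_apply,
      LinearMap.smul_apply, LinearMap.comp_apply, LinearMap.proj_apply, neg_eq_zero]
    refine Finset.sum_eq_zero fun n hn => ?_
    rw [rho_apply_congr 𝒜 (Finset.mem_Icc.mp hn).1, smul_zero]
    intro M hM
    exact ih (by omega) ω

/-- The exponential `exp(-∑_{n ≥ 1} K_n ρ_n) = ∑_k (1 / k!) (-∑_{n ≥ 1} K_n ρ_n)^k`. In degree `N`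
the terms with `k > N` vanish, by `koszulGenerator_pow_apply_of_lt`. -/
def koszulExp : MultSeq 𝕜 A →ₗ[𝕜] MultSeq 𝕜 A :=
  LinearMap.pi fun N =>
    ∑ k ∈ Finset.range (N + 1),
      ((Nat.factorial k : 𝕜)⁻¹) • (LinearMap.proj N ∘ₗ (koszulGenerator 𝒜 ^ k))

/-- The higher antibrackets `Φ^1_f, Φ^2_f, …` of a linear operator, defined by
`∑_i Φ^i_f = exp(-∑_{n ≥ 1} K_n ρ_n) f`. The bracket `Φ^{n+1}_f` in `n + 1` variables is
`antibracket 𝒜 f n`. -/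
def antibracket (f : A →ₗ[𝕜] A) : MultSeq 𝕜 A := koszulExp 𝒜 (Pi.single 0 (ofLinear f))

end Algebra

end

end SuperNR

/-! Signs. Let `Λ` be the Grassmann algebra on countably many generators. On the even part of `A ⊗
Λ` all Koszul signs disappear: a supersymmetric `f` extends to an honestly symmetric map `env f η`,
and `f ⊼ g` becomes a plain sum over shuffles. Grassmann elements of prescribed parities can have
nonzero product, so nothing is lost (`eq_of_env_eq`). In characteristic 0, polarization then reduces
an identity between supersymmetric maps to equal arguments `x, …, x` (`eq_of_env_diag_eq`). There
the associator of `⊼` is a multinomial multiple of `f(g(x, …), k(x, …), x, …)`, hence symmetric in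
`g` and `k` (`nrProd_preLie`); this gives the Jacobi identity. Likewise `μ_n(x, …, x) = x^(n+1)`
gives `μ_n ⊼ μ_m = C(n+m+1, m+1) μ_{n+m}` (`nrProd_mu`), and antisymmetrizing gives the bracket
relations.

Vector fields. These relations say that `t^(n+1) ∂ ↦ -(n+1)! μ_n` respects brackets of formal vector
fields vanishing at 0. With `k = ∑ K_n t^(n+1) / (n+1)!` it carries `ad (k ∂)` to `-∑ K_n ρ_n`
(`seriesToSeq_fieldAd`). The recurrence for `K_n` amounts to `k ∘ (e^t - 1) = k · (e^t - 1)'`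
(`koszulSeries_subst`). The flow `φ = exp(k ∂) t` satisfies the same equation, whose solutions are
determined by their coefficients up to `t²` (`eq_of_subst_eq_mul_derivative`), so `φ = e^t - 1`.
Hence `exp(ad k ∂)(t ∂) = (1 - e^(-t)) ∂`. As `Id = μ_0` is minus the image of `t ∂`, the
antibrackets of `Id` are read off from the coefficients of `1 - e^(-t)`.

Conclusion. The exponential of a derivation respects brackets, which gives the generalized Jacobi
identities. Applied to `[Id, f] = 0`, together with `[Id, g] = -n g` for `g ∈ D_n(A)`, this gives
the recursion. Convergence is handled throughout by separated filtrations. -/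

namespace SuperNR

/-! ### Exponentials of operators that raise a separated filtration. -/

section FilteredExp

open Finset

variable {𝕜 M M₁ M₂ M₃ : Type*} [Field 𝕜] [AddCommGroup M] [Module 𝕜 M] [AddCommGroup M₁]
  [Module 𝕜 M₁] [AddCommGroup M₂] [Module 𝕜 M₂] [AddCommGroup M₃] [Module 𝕜 M₃]

/-- A separated decreasing filtration of a module. -/
structure IsSepFiltration (F : ℕ → Submodule 𝕜 M) : Prop where
  anti : Antitone F
  zero : F 0 = ⊤
  sep : ∀ x, (∀ K, x ∈ F K) → x = 0

/-- The operator `D` raises the filtration degree. -/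
def Raises (F : ℕ → Submodule 𝕜 M) (D : M →ₗ[𝕜] M) : Prop := ∀ K, ∀ x ∈ F K, D x ∈ F (K + 1)

/-- The operator `E` is the exponential of `D`, the series converging for the filtration `F`. -/
def IsFilteredExp (F : ℕ → Submodule 𝕜 M) (D E : M →ₗ[𝕜] M) : Prop :=
  ∀ K x, E x - ∑ k ∈ range K, (Nat.factorial k : 𝕜)⁻¹ • (D ^ k) x ∈ F K

theorem Raises.pow {F : ℕ → Submodule 𝕜 M} {D : M →ₗ[𝕜] M} (h : Raises F D) (k : ℕ) :
    ∀ K, ∀ x ∈ F K, (D ^ k) x ∈ F (K + k) := by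
  induction k with
  | zero => intro K x hx; simpa using hx
  | succ k ih =>
    intro K x hx
    rw [pow_succ', Module.End.mul_apply]
    exact h _ _ (ih K x hx)

theorem Raises.pow_mem {F : ℕ → Submodule 𝕜 M} {D : M →ₗ[𝕜] M} (hF : IsSepFiltration F)
    (h : Raises F D) (k : ℕ) (x : M) : (D ^ k) x ∈ F k := by
  simpa using h.pow k 0 x (by rw [hF.zero]; trivial)

theorem IsSepFiltration.eq_of_sub_mem {F : ℕ → Submodule 𝕜 M} (hF : IsSepFiltration F) {x y : M}
    (h : ∀ K, x - y ∈ F K) : x = y := sub_eq_zero.mp (hF.sep _ h)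

/-- Both sides agree with the same truncated series modulo every `F K`. Separatedness then suffices;
completeness plays no role because `E` is given. -/
theorem IsFilteredExp.comm {F : ℕ → Submodule 𝕜 M} {D E : M →ₗ[𝕜] M} (hF : IsSepFiltration F)
    (hD : Raises F D) (hE : IsFilteredExp F D E) (x : M) : E (D x) = D (E x) := by
  refine hF.eq_of_sub_mem fun K => ?_
  have h1 := hE K (D x)
  have h2 := hF.anti (Nat.le_succ K) (hD K _ (hE K x))
  have h3 := sub_mem h1 h2
  have h4 : D (∑ k ∈ range K, (Nat.factorial k : 𝕜)⁻¹ • (D ^ k) x) =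
      ∑ k ∈ range K, (Nat.factorial k : 𝕜)⁻¹ • (D ^ k) (D x) := by
    rw [map_sum]
    refine sum_congr rfl fun k _ => ?_
    rw [map_smul, ← Module.End.mul_apply, ← Module.End.mul_apply, ← pow_succ', ← pow_succ]
  rw [map_sub, h4] at h3
  simpa using h3

theorem IsFilteredExp.mem {F : ℕ → Submodule 𝕜 M} {D E : M →ₗ[𝕜] M} (hF : IsSepFiltration F)
    (hD : Raises F D) (hE : IsFilteredExp F D E) {K : ℕ} {x : M} (hx : x ∈ F K) : E x ∈ F K := by
  have h1 := hE K x
  have h2 : ∑ k ∈ range K, (Nat.factorial k : 𝕜)⁻¹ • (D ^ k) x ∈ F K :=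
    sum_mem fun k _ => Submodule.smul_mem _ _ (hF.anti (Nat.le_add_right K k) (hD.pow k K x hx))
  simpa using add_mem h1 h2

/-- An intertwiner of the generators intertwines the exponentials. It may lower the filtration by
one step, as `K` is arbitrary; this is needed for `seriesToSeq`, which moves `t^(n+1)` to index `n`.
-/
theorem IsFilteredExp.map_eq {F : ℕ → Submodule 𝕜 M} {F₁ : ℕ → Submodule 𝕜 M₁}
    {D E : M →ₗ[𝕜] M} {D₁ E₁ : M₁ →ₗ[𝕜] M₁} (hF₁ : IsSepFiltration F₁)
    (hE : IsFilteredExp F D E) (hE₁ : IsFilteredExp F₁ D₁ E₁) (θ : M →ₗ[𝕜] M₁)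
    (hθ : ∀ K, ∀ x ∈ F (K + 1), θ x ∈ F₁ K) {x : M}
    (hx : ∀ k, θ ((D ^ k) x) = (D₁ ^ k) (θ x)) : θ (E x) = E₁ (θ x) := by
  refine hF₁.eq_of_sub_mem fun K => ?_
  have h1 := hθ K _ (hE (K + 1) x)
  have h2 := hF₁.anti (Nat.le_succ K) (hE₁ (K + 1) (θ x))
  have h3 := sub_mem h1 h2
  rw [map_sub, map_sum] at h3
  simp only [map_smul, hx] at h3
  simpa using h3

/-- The Leibniz rule is assumed on submodules only, because the bracket satisfies it on
supersymmetric sequences. -/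
theorem leibniz_pow {D₁ : M₁ →ₗ[𝕜] M₁} {D₂ : M₂ →ₗ[𝕜] M₂} {D₃ : M₃ →ₗ[𝕜] M₃}
    (B : M₁ →ₗ[𝕜] M₂ →ₗ[𝕜] M₃) (S₁ : Submodule 𝕜 M₁) (S₂ : Submodule 𝕜 M₂)
    (hS₁ : ∀ x ∈ S₁, D₁ x ∈ S₁) (hS₂ : ∀ x ∈ S₂, D₂ x ∈ S₂)
    (h : ∀ x ∈ S₁, ∀ y ∈ S₂, D₃ (B x y) = B (D₁ x) y + B x (D₂ y)) (j : ℕ) {x : M₁} {y : M₂}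
    (hx : x ∈ S₁) (hy : y ∈ S₂) :
    (D₃ ^ j) (B x y) =
      ∑ p ∈ antidiagonal j, (Nat.choose j p.1 : 𝕜) • B ((D₁ ^ p.1) x) ((D₂ ^ p.2) y) := by
  have h1 : ∀ k, (D₁ ^ k) x ∈ S₁ := fun k => by
    induction k with
    | zero => simpa using hx
    | succ k ih => rw [pow_succ', Module.End.mul_apply]; exact hS₁ _ ih
  have h2 : ∀ k, (D₂ ^ k) y ∈ S₂ := fun k => by
    induction k with
    | zero => simpa using hy
    | succ k ih => rw [pow_succ', Module.End.mul_apply]; exact hS₂ _ ih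
  induction j with
  | zero => simp
  | succ j ih =>
    have h3 := Finset.sum_antidiagonal_choose_succ_nsmul (M := M₃)
      (fun k l => B ((D₁ ^ k) x) ((D₂ ^ l) y)) j
    simp only [Nat.cast_smul_eq_nsmul] at ih ⊢
    rw [h3, pow_succ', Module.End.mul_apply, ih, map_sum, add_comm, ← sum_add_distrib]
    refine sum_congr rfl fun p hp => ?_
    rw [map_nsmul, h _ (h1 _) _ (h2 _), smul_add, ← Module.End.mul_apply, ← Module.End.mul_apply,
      ← pow_succ', ← pow_succ',
      Nat.choose_symm_of_eq_add (HasAntidiagonal.mem_antidiagonal.mp hp).symm]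

variable [CharZero 𝕜]

/-- The square `k, l < K` and the triangle `k + l < K` differ by terms of total degree at least `K`,
and on the triangle `C(j, k) / j! = 1 / (k! l!)`. -/
theorem sum_exp_mul_sub_mem {F : ℕ → Submodule 𝕜 M} (hF : Antitone F) (t : ℕ → ℕ → M)
    (ht : ∀ k l, t k l ∈ F (k + l)) (K : ℕ) :
    ∑ k ∈ range K, ∑ l ∈ range K, (Nat.factorial k : 𝕜)⁻¹ • (Nat.factorial l : 𝕜)⁻¹ • t k l -
      ∑ j ∈ range K, (Nat.factorial j : 𝕜)⁻¹ •
        ∑ p ∈ antidiagonal j, (Nat.choose j p.1 : 𝕜) • t p.1 p.2 ∈ F K := by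
  set f : ℕ × ℕ → M := fun p => (Nat.factorial p.1 : 𝕜)⁻¹ • (Nat.factorial p.2 : 𝕜)⁻¹ • t p.1 p.2
  have h1 : ∑ j ∈ range K, (Nat.factorial j : 𝕜)⁻¹ •
      ∑ p ∈ antidiagonal j, (Nat.choose j p.1 : 𝕜) • t p.1 p.2 =
      ∑ p ∈ range K ×ˢ range K with p.1 + p.2 < K, f p := by
    rw [← sum_fiberwise_of_maps_to (t := range K) (g := fun p : ℕ × ℕ => p.1 + p.2)]
    · refine sum_congr rfl fun j hj => ?_
      rw [smul_sum]
      refine sum_congr ?_ fun p hp => ?_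
      · ext ⟨a, b⟩
        simp only [HasAntidiagonal.mem_antidiagonal, mem_filter, mem_product, mem_range] at hj ⊢
        omega
      · have hp' : p.1 + p.2 = j := by
          simp only [mem_filter] at hp
          exact hp.2
        subst hp'
        simp only [f, smul_smul]
        congr 1
        have h := Nat.add_choose_mul_factorial_mul_factorial p.1 p.2
        have h' : ((p.1 + p.2).choose p.1 : 𝕜) * (p.1.factorial : 𝕜) * (p.2.factorial : 𝕜) =
            ((p.1 + p.2).factorial : 𝕜) := by
          rw [Nat.choose_symm_add]
          exact_mod_cast h
        have h0 : ∀ n, (Nat.factorial n : 𝕜) ≠ 0 := fun n =>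
          Nat.cast_ne_zero.mpr (Nat.factorial_ne_zero n)
        have h1 := h0 p.1
        have h2 := h0 p.2
        have h3 := h0 (p.1 + p.2)
        field_simp
        rw [← h']
    · intro p hp
      simp only [mem_filter] at hp
      simpa using hp.2
  have h2 : ∑ k ∈ range K, ∑ l ∈ range K,
      (Nat.factorial k : 𝕜)⁻¹ • (Nat.factorial l : 𝕜)⁻¹ • t k l = ∑ p ∈ range K ×ˢ range K, f p :=
    (sum_product (range K) (range K) f).symm
  rw [h1, h2, ← sum_filter_add_sum_filter_not (range K ×ˢ range K) (fun p => p.1 + p.2 < K) f,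
    add_sub_cancel_left]
  refine sum_mem fun p hp => Submodule.smul_mem _ _ (Submodule.smul_mem _ _ ?_)
  simp only [mem_filter, not_lt] at hp
  exact hF hp.2 (ht _ _)

/-- The exponential of a derivation is multiplicative. Three different modules are allowed, so that
this covers products of series, the action of vector fields on functions, and brackets of sequences.
-/
theorem IsFilteredExp.map_bilin {F₁ : ℕ → Submodule 𝕜 M₁} {F₂ : ℕ → Submodule 𝕜 M₂}
    {F₃ : ℕ → Submodule 𝕜 M₃} {D₁ E₁ : M₁ →ₗ[𝕜] M₁} {D₂ E₂ : M₂ →ₗ[𝕜] M₂} {D₃ E₃ : M₃ →ₗ[𝕜] M₃}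
    (hF₁ : IsSepFiltration F₁) (hF₂ : IsSepFiltration F₂) (hF₃ : IsSepFiltration F₃)
    (hD₁ : Raises F₁ D₁) (hD₂ : Raises F₂ D₂)
    (hE₁ : IsFilteredExp F₁ D₁ E₁) (hE₂ : IsFilteredExp F₂ D₂ E₂) (hE₃ : IsFilteredExp F₃ D₃ E₃)
    (B : M₁ →ₗ[𝕜] M₂ →ₗ[𝕜] M₃)
    (hB : ∀ K L, ∀ x ∈ F₁ K, ∀ y ∈ F₂ L, B x y ∈ F₃ (K + L)) {x : M₁} {y : M₂}
    (hxy : ∀ j, (D₃ ^ j) (B x y) =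
      ∑ p ∈ antidiagonal j, (Nat.choose j p.1 : 𝕜) • B ((D₁ ^ p.1) x) ((D₂ ^ p.2) y)) :
    E₃ (B x y) = B (E₁ x) (E₂ y) := by
  refine hF₃.eq_of_sub_mem fun K => ?_
  set S₁ := ∑ k ∈ range K, (Nat.factorial k : 𝕜)⁻¹ • (D₁ ^ k) x
  set S₂ := ∑ k ∈ range K, (Nat.factorial k : 𝕜)⁻¹ • (D₂ ^ k) y
  have h1 := sum_exp_mul_sub_mem (𝕜 := 𝕜) hF₃.anti
    (fun k l => B ((D₁ ^ k) x) ((D₂ ^ l) y))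
    (fun k l => hB k l _ (hD₁.pow_mem hF₁ k x) _ (hD₂.pow_mem hF₂ l y)) K
  have h2 : B (E₁ x - S₁) (E₂ y) ∈ F₃ K :=
    hB K 0 _ (hE₁ K x) (E₂ y) (by rw [hF₂.zero]; trivial)
  have h3 : B S₁ (E₂ y - S₂) ∈ F₃ K :=
    Nat.zero_add K ▸ hB 0 K S₁ (by rw [hF₁.zero]; trivial) _ (hE₂ K y)
  have h4 := hE₃ K (B x y)
  simp only [hxy] at h4
  have h5 : B S₁ S₂ = ∑ k ∈ range K, ∑ l ∈ range K,
      (Nat.factorial k : 𝕜)⁻¹ • (Nat.factorial l : 𝕜)⁻¹ • B ((D₁ ^ k) x) ((D₂ ^ l) y) := by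
    simp only [S₁, S₂, map_sum, map_smul, LinearMap.sum_apply, LinearMap.smul_apply]
    simp only [smul_sum]
    rw [sum_comm]
    exact sum_congr rfl fun k _ => sum_congr rfl fun l _ => smul_comm _ _ _
  rw [← h5] at h1
  have h6 := sub_mem h4 (add_mem (add_mem h1 h2) h3)
  convert h6 using 1
  simp only [map_sub, LinearMap.sub_apply]
  abel

theorem IsFilteredExp.neg_comp {F : ℕ → Submodule 𝕜 M} {D E E' : M →ₗ[𝕜] M}
    (hF : IsSepFiltration F) (hD : Raises F D) (hE : IsFilteredExp F D E)
    (hE' : IsFilteredExp F (-D) E') (x : M) : E (E' x) = x := by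
  have hpow : ∀ k, (-D) ^ k = (-1 : 𝕜) ^ k • D ^ k := fun k => by
    rw [← neg_one_smul 𝕜 D, smul_pow]
  refine hF.eq_of_sub_mem fun K => ?_
  have h1 := sum_exp_mul_sub_mem (𝕜 := 𝕜) hF.anti (fun k l => (D ^ k) (((-D) ^ l) x)) (by
    intro k l
    rw [hpow, LinearMap.smul_apply, map_smul, ← Module.End.mul_apply, ← pow_add]
    exact Submodule.smul_mem _ _ (hD.pow_mem hF _ x)) K
  set S' := ∑ k ∈ range K, (Nat.factorial k : 𝕜)⁻¹ • ((-D) ^ k) x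
  have h2 := hE.mem hF hD (hE' K x)
  have h3 := hE K S'
  have h4 : ∑ k ∈ range K, (Nat.factorial k : 𝕜)⁻¹ • (D ^ k) S' =
    ∑ k ∈ range K, ∑ l ∈ range K,
      (Nat.factorial k : 𝕜)⁻¹ • (Nat.factorial l : 𝕜)⁻¹ • (D ^ k) (((-D) ^ l) x) := by
    simp only [S', map_sum, map_smul, smul_sum]
  -- The binomial theorem for `(1 - 1)^j`: only the term of degree 0 survives.
  have h5 : ∀ j, ∑ p ∈ antidiagonal j, (Nat.choose j p.1 : 𝕜) • (D ^ p.1) (((-D) ^ p.2) x) =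
      if j = 0 then x else 0 := by
    intro j
    have : ∀ p ∈ antidiagonal j, (Nat.choose j p.1 : 𝕜) • (D ^ p.1) (((-D) ^ p.2) x) =
        ((1 : 𝕜) ^ p.1 * (-1) ^ p.2 * (Nat.choose j p.1 : 𝕜)) • (D ^ j) x := by
      intro p hp
      rw [hpow, LinearMap.smul_apply, map_smul, ← Module.End.mul_apply, ← pow_add,
        HasAntidiagonal.mem_antidiagonal.mp hp, smul_smul]
      congr 1
      ring
    rw [sum_congr rfl this, ← sum_smul, Nat.sum_antidiagonal_eq_sum_range_succ
      (fun a b => (1 : 𝕜) ^ a * (-1) ^ b * (Nat.choose j a : 𝕜)), ← add_pow]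
    rcases j with _ | j <;> simp
  rw [h4] at h3
  simp only [h5] at h1
  have h6 : x - ∑ j ∈ range K, (Nat.factorial j : 𝕜)⁻¹ • (if j = 0 then x else 0) ∈ F K := by
    rcases K with _ | K
    · rw [hF.zero]; trivial
    · rw [sum_eq_single 0] <;> simp +contextual
  have h7 := add_mem h2 (sub_mem (add_mem h3 h1) h6)
  convert h7 using 1
  rw [map_sub]
  abel

end FilteredExp

/-! ### The functional equation of the generating series of the Koszul numbers. -/

section KoszulSeries

open Finset PowerSeries

/-- As `S(n+1, n) = n(n+1)/2` and `1 - n(n+1)/2 = -(n+2)(n-1)/2`, the definition of `K_n` is this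
relation solved for `K_n`. The term `i = n + 1` is not part of the sum. -/
theorem sum_stirlingSecond_mul_koszulNumber (n : ℕ) (hn : 1 ≤ n) :
    ∑ i ∈ range (n + 1), (Nat.stirlingSecond (n + 1) i : ℚ) * koszulNumber i = koszulNumber n := by
  obtain _ | _ | m := n
  · omega
  · simp [sum_range_succ, koszulNumber, Nat.stirlingSecond]
  · have h0 : koszulNumber (m + 2) = -2 / (((m : ℚ) + 4) * ((m : ℚ) + 1)) *
        ∑ i ∈ range (m + 1), (Nat.stirlingSecond (m + 3) (i + 1) : ℚ) * koszulNumber (i + 1) := by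
      rw [koszulNumber, Finset.sum_range]
    have h1 : (Nat.stirlingSecond (m + 3) (m + 2) : ℚ) = ((m : ℚ) + 3) * ((m : ℚ) + 2) / 2 := by
      rw [Nat.stirlingSecond_succ_self_left, Nat.cast_choose_two]
      push_cast
      ring
    rw [sum_range_succ', sum_range_succ]
    simp only [koszulNumber.eq_1, mul_zero, add_zero]
    rw [show m + 1 + 1 + 1 = m + 3 from rfl, show m + 1 + 1 = m + 2 from rfl, h1]
    have h2 : ((m : ℚ) + 4) ≠ 0 := by positivity
    have h3 : ((m : ℚ) + 1) ≠ 0 := by positivity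
    field_simp at h0
    linear_combination (1 / 2 : ℚ) * h0

variable (𝕜 : Type*) [Field 𝕜]

/-- The series `∑ K_n t^(n+1) / (n+1)!`. -/
noncomputable def koszulSeries : 𝕜⟦X⟧ :=
  PowerSeries.mk fun m => (koszulNumber (m - 1) : 𝕜) / (Nat.factorial m : 𝕜)

variable {𝕜}

theorem coeff_koszulSeries (n : ℕ) :
    coeff n (koszulSeries 𝕜) = (koszulNumber (n - 1) : 𝕜) / (Nat.factorial n : 𝕜) := by
  simp [koszulSeries]

theorem coeff_pow_eq_zero_of_lt {φ : 𝕜⟦X⟧} (h : constantCoeff φ = 0) {n d : ℕ} (hnd : n < d) :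
    coeff n (φ ^ d) = 0 :=
  X_pow_dvd_iff.mp (pow_dvd_pow_of_dvd (X_dvd_iff.mpr h) d) n hnd

theorem coeff_subst_eq_sum {φ : 𝕜⟦X⟧} (h : constantCoeff φ = 0) (f : 𝕜⟦X⟧) (n : ℕ) :
    coeff n (f.subst φ) = ∑ d ∈ range (n + 1), coeff d f * coeff n (φ ^ d) := by
  rw [coeff_subst' (HasSubst.of_constantCoeff_zero' h)]
  simp only [smul_eq_mul]
  refine finsum_eq_sum_of_support_subset _ fun d hd => ?_
  rw [Function.mem_support] at hd
  by_contra hn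
  simp only [coe_range, Set.mem_Iio, not_lt] at hn
  exact hd (by rw [coeff_pow_eq_zero_of_lt h (by omega), mul_zero])

variable [CharZero 𝕜]

variable (𝕜) in
/-- The series `e^t - 1`. -/
noncomputable def expSubOne : 𝕜⟦X⟧ := PowerSeries.exp 𝕜 - 1

theorem factorial_cast_ne_zero (n : ℕ) : (Nat.factorial n : 𝕜) ≠ 0 :=
  Nat.cast_ne_zero.mpr (Nat.factorial_ne_zero n)

theorem constantCoeff_expSubOne : constantCoeff (expSubOne 𝕜) = 0 := by
  simp [expSubOne]

theorem derivative_expSubOne : d⁄dX 𝕜 (expSubOne 𝕜) = expSubOne 𝕜 + 1 := by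
  ext n
  simp only [expSubOne, map_sub, coeff_derivative, coeff_exp, sub_add_cancel]
  rw [coeff_one, if_neg (by omega), zero_mul, sub_zero, Nat.factorial_succ]
  have : (Nat.factorial n : 𝕜) ≠ 0 := factorial_cast_ne_zero n
  have : (n : 𝕜) + 1 ≠ 0 := by exact_mod_cast Nat.succ_ne_zero n
  simp
  field_simp

/-- Differentiating `(e^t - 1)^(m+1)` gives `(m+1) ((e^t - 1)^(m+1) + (e^t - 1)^m)`, which is the
Stirling recurrence on coefficients. -/
theorem coeff_expSubOne_pow (n m : ℕ) :
    coeff n (expSubOne 𝕜 ^ m) * (Nat.factorial n : 𝕜) =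
      (Nat.factorial m : 𝕜) * (Nat.stirlingSecond n m : 𝕜) := by
  induction n generalizing m with
  | zero =>
    cases m with
    | zero => simp
    | succ m => simp [constantCoeff_expSubOne]
  | succ n ih =>
    cases m with
    | zero => simp [coeff_one]
    | succ m =>
      have h := congrArg (coeff n) (Derivation.leibniz_pow (d⁄dX 𝕜) (expSubOne 𝕜) (m + 1))
      rw [coeff_derivative, derivative_expSubOne] at h
      have h' : coeff (n + 1) (expSubOne 𝕜 ^ (m + 1)) * ((n : 𝕜) + 1) = ((m : 𝕜) + 1) *
          (coeff n (expSubOne 𝕜 ^ (m + 1)) + coeff n (expSubOne 𝕜 ^ m)) := by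
        rw [h, Nat.add_sub_cancel, smul_eq_mul, mul_add, mul_one, ← pow_succ, map_nsmul, map_add,
          nsmul_eq_mul]
        push_cast
        ring
      have i1 := ih (m + 1)
      have i2 := ih m
      rw [Nat.stirlingSecond_succ_succ, Nat.factorial_succ n]
      rw [Nat.factorial_succ m] at i1 ⊢
      push_cast at i1 i2 ⊢
      linear_combination (Nat.factorial n : 𝕜) * h' + ((m : 𝕜) + 1) * i1 + ((m : 𝕜) + 1) * i2

theorem coeff_derivative_koszulSeries (n : ℕ) :
    coeff n (d⁄dX 𝕜 (koszulSeries 𝕜)) = (koszulNumber n : 𝕜) / (Nat.factorial n : 𝕜) := by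
  rw [coeff_derivative, coeff_koszulSeries, Nat.add_sub_cancel, Nat.factorial_succ]
  have : (Nat.factorial n : 𝕜) ≠ 0 := factorial_cast_ne_zero n
  have : (n : 𝕜) + 1 ≠ 0 := by exact_mod_cast Nat.succ_ne_zero n
  push_cast
  field_simp

/-- In degree `n` this reads `∑_{d ≤ n} S(n, d) K_d = K_{n-1} + K_n`: the term `d = n` gives `K_n`,
the others give `K_{n-1}` by the recurrence at `n - 1`. -/
theorem derivative_koszulSeries_subst :
    (d⁄dX 𝕜 (koszulSeries 𝕜)).subst (expSubOne 𝕜) = koszulSeries 𝕜 + d⁄dX 𝕜 (koszulSeries 𝕜) := by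
  ext n
  have hn : (Nat.factorial n : 𝕜) ≠ 0 := factorial_cast_ne_zero n
  rw [coeff_subst_eq_sum constantCoeff_expSubOne, map_add, coeff_koszulSeries,
    coeff_derivative_koszulSeries, ← mul_left_inj' hn, sum_mul, add_mul, div_mul_cancel₀ _ hn,
    div_mul_cancel₀ _ hn]
  have h1 : ∀ d ∈ range (n + 1), coeff d (d⁄dX 𝕜 (koszulSeries 𝕜)) * coeff n (expSubOne 𝕜 ^ d) *
      (Nat.factorial n : 𝕜) = (((Nat.stirlingSecond n d : ℚ) * koszulNumber d : ℚ) : 𝕜) := by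
    intro d _
    have hd : (Nat.factorial d : 𝕜) ≠ 0 := factorial_cast_ne_zero d
    rw [mul_assoc, coeff_expSubOne_pow, coeff_derivative_koszulSeries]
    push_cast
    field_simp
  rw [sum_congr rfl h1, ← Rat.cast_sum, ← Rat.cast_add]
  congr 1
  obtain _ | _ | m := n
  · simp [koszulNumber]
  · simp [koszulNumber, sum_range_succ, Nat.stirlingSecond]
  · rw [sum_range_succ, sum_stirlingSecond_mul_koszulNumber (m + 1) (by omega),
      Nat.stirlingSecond_self]
    simp

/-- The constant terms vanish, and both derivatives equal `(k + k') e^t`. -/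
theorem koszulSeries_subst :
    (koszulSeries 𝕜).subst (expSubOne 𝕜) = koszulSeries 𝕜 * d⁄dX 𝕜 (expSubOne 𝕜) := by
  refine derivative.ext ?_ ?_
  · rw [derivative_subst (HasSubst.of_constantCoeff_zero' constantCoeff_expSubOne),
      derivative_koszulSeries_subst, Derivation.leibniz, derivative_expSubOne]
    simp only [map_add, derivative_expSubOne, smul_eq_mul, Derivation.map_one_eq_zero]
    ring
  · rw [← coeff_zero_eq_constantCoeff_apply, coeff_subst_eq_sum constantCoeff_expSubOne,
      ← coeff_zero_eq_constantCoeff_apply, coeff_zero_eq_constantCoeff_apply, map_mul,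
      ← coeff_zero_eq_constantCoeff_apply]
    simp [coeff_koszulSeries, koszulNumber]

/-- If `φ - ψ = ε t^m` with `m ≥ 3`, comparing coefficients of `t^(m+1)` in both equations gives `2
k_2 ε_0 = m k_2 ε_0`, so `ε_0 = 0`. The argument fails exactly at `m = 2`, which is why the
coefficients of `t²` must be matched separately. -/
theorem eq_of_subst_eq_mul_derivative {k φ ψ : 𝕜⟦X⟧} (hk : X ^ 2 ∣ k) (hk2 : coeff 2 k ≠ 0)
    (hφ : k.subst φ = k * d⁄dX 𝕜 φ) (hψ : k.subst ψ = k * d⁄dX 𝕜 ψ)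
    (hφ1 : constantCoeff φ = 0) (hψ1 : constantCoeff ψ = 0)
    (hφ' : coeff 1 φ = 1) (hψ' : coeff 1 ψ = 1) (h2 : coeff 2 φ = coeff 2 ψ) : φ = ψ := by
  have key : ∀ r, X ^ r ∣ φ - ψ := by
    intro r
    induction r with
    | zero => simp
    | succ r ih =>
      rw [X_pow_dvd_iff] at ih ⊢
      intro m hm
      rcases Nat.lt_succ_iff_lt_or_eq.mp hm with hm | rfl
      · exact ih m hm
      obtain _ | _ | _ | s := m
      · simp [hφ1, hψ1]
      · simp [hφ', hψ']
      · simp [h2]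
      obtain ⟨ε, hε⟩ := X_pow_dvd_iff.mpr ih
      obtain ⟨κ, hκ⟩ := hk
      obtain ⟨a, ha⟩ := X_dvd_iff.mpr hφ1
      obtain ⟨b, hb⟩ := X_dvd_iff.mpr hψ1
      have hab : a - b = X ^ (s + 2) * ε := by
        apply mul_left_cancel₀ (X_ne_zero (R := 𝕜))
        rw [mul_sub, ← ha, ← hb, hε]
        ring
      -- Here `m = s + 3`. Only the quadratic term of `k` contributes: for `d ≥ 3` the difference
      -- `φ^d - ψ^d` has order at least `s + 5`.
      have e1 : coeff (s + 4) (k.subst φ) - coeff (s + 4) (k.subst ψ) =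
          coeff 2 k * (2 * constantCoeff ε) := by
        rw [coeff_subst_eq_sum hφ1, coeff_subst_eq_sum hψ1, ← sum_sub_distrib,
          sum_eq_single 2]
        · rw [← mul_sub, ← map_sub]
          congr 1
          have : φ ^ 2 - ψ ^ 2 = X ^ (s + 4) * (ε * (a + b)) := by
            rw [sq_sub_sq, hε, ha, hb]
            ring
          rw [this, coeff_X_pow_mul', if_pos le_rfl, Nat.sub_self,
            coeff_zero_eq_constantCoeff_apply, map_mul, map_add]
          have ha1 : constantCoeff a = 1 := by
            rw [← coeff_zero_eq_constantCoeff_apply, ← hφ', ha]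
            exact (coeff_succ_X_mul 0 a).symm
          have hb1 : constantCoeff b = 1 := by
            rw [← coeff_zero_eq_constantCoeff_apply, ← hψ', hb]
            exact (coeff_succ_X_mul 0 b).symm
          rw [ha1, hb1]
          ring
        · intro d _ hd
          obtain _ | _ | _ | d := d
          · simp
          · rw [hκ, coeff_X_pow_mul']
            simp
          · omega
          · rw [← mul_sub, ← map_sub, ha, hb, mul_pow, mul_pow, ← mul_sub]
            obtain ⟨u, hu⟩ := sub_dvd_pow_sub_pow a b (d + 1 + 1 + 1)
            have : X ^ (d + 1 + 1 + 1) * (a ^ (d + 1 + 1 + 1) - b ^ (d + 1 + 1 + 1)) =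
                X ^ (s + 5) * (X ^ d * ε * u) := by
              rw [hu, hab]
              ring
            rw [this, coeff_X_pow_mul', if_neg (by omega), mul_zero]
        · intro h
          simp at h
      have e2 : coeff (s + 4) (k * d⁄dX 𝕜 φ) - coeff (s + 4) (k * d⁄dX 𝕜 ψ) =
          coeff 2 k * (((s : 𝕜) + 3) * constantCoeff ε) := by
        rw [← map_sub, ← mul_sub, ← map_sub, hε]
        have : k * d⁄dX 𝕜 (X ^ (s + 1 + 1 + 1) * ε) =
            X ^ (s + 4) * (κ * (((s : 𝕜⟦X⟧) + 3) * ε + X * d⁄dX 𝕜 ε)) := by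
          rw [hκ, Derivation.leibniz, Derivation.leibniz_pow, derivative_X]
          simp only [smul_eq_mul, nsmul_eq_mul, Nat.add_sub_cancel]
          push_cast
          ring
        rw [this, coeff_X_pow_mul', if_pos le_rfl, Nat.sub_self,
          coeff_zero_eq_constantCoeff_apply, map_mul, hκ, coeff_X_pow_mul', if_pos le_rfl,
          Nat.sub_self, coeff_zero_eq_constantCoeff_apply]
        have h3 : constantCoeff (3 : 𝕜⟦X⟧) = 3 := map_ofNat _ 3
        simp [h3]
      rw [hφ, hψ, e2] at e1
      have e3 : ((s : 𝕜) + 3) * constantCoeff ε = 2 * constantCoeff ε := mul_left_cancel₀ hk2 e1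
      have e4 : ((s : 𝕜) + 1) * constantCoeff ε = 0 := by linear_combination e3
      have e5 : (s : 𝕜) + 1 ≠ 0 := by exact_mod_cast Nat.succ_ne_zero s
      rw [hε, coeff_X_pow_mul', if_pos le_rfl, Nat.sub_self, coeff_zero_eq_constantCoeff_apply]
      exact (mul_eq_zero.mp e4).resolve_left e5
  ext n
  have := X_pow_dvd_iff.mp (key (n + 1)) n (Nat.lt_succ_self n)
  rwa [map_sub, sub_eq_zero] at this

end KoszulSeries

/-! ### Formal vector fields on the line and the flow of the Koszul series. -/

section VectorFields

open Finset PowerSeries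

variable {𝕜 : Type*} [Field 𝕜]

variable (𝕜) in
/-- The power series divisible by `t^K`. -/
def orderFil (K : ℕ) : Submodule 𝕜 𝕜⟦X⟧ where
  carrier := {p | ∀ n < K, coeff n p = 0}
  add_mem' ha hb n hn := by rw [map_add, ha n hn, hb n hn, add_zero]
  zero_mem' n _ := map_zero _
  smul_mem' c p hp n hn := by rw [map_smul, hp n hn, smul_zero]

theorem mem_orderFil {K : ℕ} {p : 𝕜⟦X⟧} : p ∈ orderFil 𝕜 K ↔ ∀ n < K, coeff n p = 0 := Iff.rfl

theorem isSepFiltration_orderFil : IsSepFiltration (orderFil 𝕜) where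
  anti _ _ h _ hp n hn := hp n (hn.trans_le h)
  zero := eq_top_iff.mpr fun _ _ n hn => absurd hn (Nat.not_lt_zero n)
  sep p hp := by
    ext n
    exact hp (n + 1) n (Nat.lt_succ_self n)

/-- The shift by one absorbs the order lost under differentiation. -/
theorem isSepFiltration_orderFil_pred : IsSepFiltration (fun K => orderFil 𝕜 (K - 1)) where
  anti _ _ h := isSepFiltration_orderFil.anti (Nat.sub_le_sub_right h 1)
  zero := isSepFiltration_orderFil.zero
  sep p hp := isSepFiltration_orderFil.sep p fun K => hp (K + 1)

theorem mul_mem_orderFil {K L : ℕ} {p q : 𝕜⟦X⟧} (hp : p ∈ orderFil 𝕜 K) (hq : q ∈ orderFil 𝕜 L) :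
    p * q ∈ orderFil 𝕜 (K + L) := by
  rw [mem_orderFil, ← X_pow_dvd_iff] at *
  rw [pow_add]
  exact mul_dvd_mul hp hq

theorem derivative_mem_orderFil {K : ℕ} {p : 𝕜⟦X⟧} (hp : p ∈ orderFil 𝕜 K) :
    d⁄dX 𝕜 p ∈ orderFil 𝕜 (K - 1) := fun n hn => by
  rw [coeff_derivative, hp (n + 1) (by omega), zero_mul]

/-- The exponential of an operator which raises the order. -/
noncomputable def seriesExp (D : 𝕜⟦X⟧ →ₗ[𝕜] 𝕜⟦X⟧) : 𝕜⟦X⟧ →ₗ[𝕜] 𝕜⟦X⟧ where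
  toFun p := PowerSeries.mk fun n =>
    ∑ k ∈ range (n + 1), (Nat.factorial k : 𝕜)⁻¹ • coeff n ((D ^ k) p)
  map_add' p q := by
    ext n
    simp [mul_add, sum_add_distrib]
  map_smul' c p := by
    ext n
    simp only [map_smul, coeff_mk, smul_eq_mul, RingHom.id_apply, mul_sum]
    exact sum_congr rfl fun _ _ => mul_left_comm _ _ _

theorem isFilteredExp_seriesExp {D : 𝕜⟦X⟧ →ₗ[𝕜] 𝕜⟦X⟧} (hD : Raises (orderFil 𝕜) D) :
    IsFilteredExp (orderFil 𝕜) D (seriesExp D) := by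
  intro K p n hn
  rw [map_sub, map_sum, sub_eq_zero]
  simp only [seriesExp, LinearMap.coe_mk, AddHom.coe_mk, coeff_mk, map_smul]
  refine sum_subset (range_subset_range.mpr hn) fun k _ hk => ?_
  rw [hD.pow_mem isSepFiltration_orderFil k p n (by simp at hk; omega), smul_zero]

/-- The derivation `k ∂`. -/
noncomputable def fieldDer (k : 𝕜⟦X⟧) : 𝕜⟦X⟧ →ₗ[𝕜] 𝕜⟦X⟧ :=
  LinearMap.mulLeft 𝕜 k ∘ₗ (d⁄dX 𝕜 : 𝕜⟦X⟧ →ₗ[𝕜] 𝕜⟦X⟧)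

theorem fieldDer_apply (k p : 𝕜⟦X⟧) : fieldDer k p = k * d⁄dX 𝕜 p := rfl

/-- The operator `p ∂ ↦ [k ∂, p ∂]` on vector fields. -/
noncomputable def fieldAd (k : 𝕜⟦X⟧) : 𝕜⟦X⟧ →ₗ[𝕜] 𝕜⟦X⟧ :=
  fieldDer k - LinearMap.mulLeft 𝕜 (d⁄dX 𝕜 k)

theorem fieldAd_apply (k p : 𝕜⟦X⟧) : fieldAd k p = k * d⁄dX 𝕜 p - d⁄dX 𝕜 k * p := rfl

theorem raises_fieldDer {k : 𝕜⟦X⟧} (hk : k ∈ orderFil 𝕜 2) : Raises (orderFil 𝕜) (fieldDer k) :=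
  fun K p hp => isSepFiltration_orderFil.anti (show K + 1 ≤ 2 + (K - 1) by omega)
    (mul_mem_orderFil hk (derivative_mem_orderFil hp))

theorem raises_fieldAd {k : 𝕜⟦X⟧} (hk : k ∈ orderFil 𝕜 2) : Raises (orderFil 𝕜) (fieldAd k) :=
  fun K p hp => sub_mem (raises_fieldDer hk K p hp)
    (Nat.add_comm 1 K ▸ mul_mem_orderFil (derivative_mem_orderFil hk) hp)

theorem seriesExp_eq_of_map_eq_zero {D : 𝕜⟦X⟧ →ₗ[𝕜] 𝕜⟦X⟧} {p : 𝕜⟦X⟧} (hp : D p = 0) :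
    seriesExp D p = p := by
  ext n
  simp only [seriesExp, LinearMap.coe_mk, AddHom.coe_mk, coeff_mk]
  rw [sum_eq_single 0]
  · simp
  · intro b _ hb
    obtain ⟨c, rfl⟩ := Nat.exists_eq_succ_of_ne_zero hb
    rw [pow_succ, Module.End.mul_apply, hp, map_zero, map_zero, smul_zero]
  · simp

theorem constantCoeff_seriesExp_X {k : 𝕜⟦X⟧} : constantCoeff (seriesExp (fieldDer k) X) = 0 := by
  rw [← coeff_zero_eq_constantCoeff_apply]
  simp [seriesExp]

theorem koszulSeries_mem : koszulSeries 𝕜 ∈ orderFil 𝕜 2 := by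
  intro n hn
  rw [coeff_koszulSeries]
  have : n - 1 = 0 := by omega
  simp [this, koszulNumber]

variable [CharZero 𝕜]

theorem seriesExp_mul {k : 𝕜⟦X⟧} (hk : k ∈ orderFil 𝕜 2) (p q : 𝕜⟦X⟧) :
    seriesExp (fieldDer k) (p * q) = seriesExp (fieldDer k) p * seriesExp (fieldDer k) q := by
  have hD := raises_fieldDer hk
  have hE := isFilteredExp_seriesExp hD
  have hF := isSepFiltration_orderFil (𝕜 := 𝕜)
  refine IsFilteredExp.map_bilin hF hF hF hD hD hE hE hE (LinearMap.mul 𝕜 𝕜⟦X⟧)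
    (fun K L x hx y hy => mul_mem_orderFil hx hy) fun j =>
      leibniz_pow _ ⊤ ⊤ (fun _ _ => trivial) (fun _ _ => trivial) ?_ j trivial trivial
  intro x _ y _
  simp only [LinearMap.mul_apply', fieldDer_apply, Derivation.leibniz, smul_eq_mul]
  ring

theorem seriesExp_X_pow {k : 𝕜⟦X⟧} (hk : k ∈ orderFil 𝕜 2) (n : ℕ) :
    seriesExp (fieldDer k) (X ^ n) = seriesExp (fieldDer k) X ^ n := by
  induction n with
  | zero =>
    rw [pow_zero, pow_zero]
    exact seriesExp_eq_of_map_eq_zero (by rw [fieldDer_apply]; simp)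
  | succ n ih => rw [pow_succ, seriesExp_mul hk, ih, pow_succ]

/-- The exponential is multiplicative and preserves the order filtration, so its value at `X`
determines it. -/
theorem seriesExp_eq_subst {k : 𝕜⟦X⟧} (hk : k ∈ orderFil 𝕜 2) (p : 𝕜⟦X⟧) :
    seriesExp (fieldDer k) p = p.subst (seriesExp (fieldDer k) X) := by
  have hD := raises_fieldDer hk
  have hE := isFilteredExp_seriesExp hD
  ext n
  have h1 : p - ∑ d ∈ range (n + 1), coeff d p • X ^ d ∈ orderFil 𝕜 (n + 1) := by
    intro m hm
    rw [map_sub, map_sum, sum_eq_single m]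
    · simp
    · intro d _ hd
      rw [map_smul, coeff_X_pow, if_neg (Ne.symm hd), smul_zero]
    · intro h
      exact absurd (mem_range.mpr hm) h
  have h2 := hE.mem isSepFiltration_orderFil hD h1 n (Nat.lt_succ_self n)
  rw [map_sub, map_sum, map_sub, map_sum, sub_eq_zero] at h2
  rw [h2, coeff_subst_eq_sum constantCoeff_seriesExp_X]
  refine sum_congr rfl fun d _ => ?_
  rw [map_smul, map_smul, seriesExp_X_pow hk, smul_eq_mul]

/-- With `D = k ∂` one has `k = D X`; the exponential of `D` commutes with `D` and is the
substitution of its value at `X`. -/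
theorem subst_seriesExp_X {k : 𝕜⟦X⟧} (hk : k ∈ orderFil 𝕜 2) :
    k.subst (seriesExp (fieldDer k) X) = k * d⁄dX 𝕜 (seriesExp (fieldDer k) X) := by
  have hD := raises_fieldDer hk
  have h := (isFilteredExp_seriesExp hD).comm isSepFiltration_orderFil hD X
  rw [fieldDer_apply, fieldDer_apply, derivative_X, mul_one] at h
  rw [← seriesExp_eq_subst hk, h]

/-- Both series solve `k ∘ φ = k φ'` and start with `t + t²/2`. -/
theorem seriesExp_koszulSeries_X :
    seriesExp (fieldDer (koszulSeries 𝕜)) X = expSubOne 𝕜 := by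
  have hk := koszulSeries_mem (𝕜 := 𝕜)
  have h2 : coeff 2 (koszulSeries 𝕜) = 1 / 2 := by
    simp [coeff_koszulSeries, koszulNumber]
  -- Modulo `t³` the flow is `X + k`, since each application of `k ∂` raises the order.
  have hφ : ∀ n < 3, coeff n (seriesExp (fieldDer (koszulSeries 𝕜)) X) =
      coeff n (X + koszulSeries 𝕜) := by
    intro n hn
    have hD2 := (raises_fieldDer hk).pow 2 1 X (by
      intro m hm
      obtain rfl : m = 0 := by omega
      simp)
    have h := isFilteredExp_seriesExp (raises_fieldDer hk) 3 X n hn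
    rw [sum_range_succ, map_sub, map_add, map_smul, hD2 n hn, smul_zero, add_zero,
      sub_eq_zero] at h
    rw [h]
    simp [sum_range_succ, fieldDer_apply]
  have hψ : ∀ n, 1 ≤ n → coeff n (expSubOne 𝕜) = (Nat.factorial n : 𝕜)⁻¹ := by
    intro n hn
    simp only [expSubOne, map_sub, coeff_exp, coeff_one, if_neg (show n ≠ 0 by omega)]
    simp
  refine eq_of_subst_eq_mul_derivative (k := koszulSeries 𝕜) (X_pow_dvd_iff.mpr hk) ?_
    (subst_seriesExp_X hk) koszulSeries_subst constantCoeff_seriesExp_X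
    constantCoeff_expSubOne ?_ ?_ ?_
  · rw [h2]
    norm_num
  · rw [hφ 1 (by norm_num), map_add, hk 1 (by norm_num), coeff_one_X, add_zero]
  · simp [hψ 1 le_rfl]
  · rw [hφ 2 (by norm_num), map_add, h2, hψ 2 (by norm_num), coeff_X, if_neg (by norm_num)]
    norm_num

/-- Let `p ∂ = exp(ad k ∂)(t ∂)`. Applying `exp(k ∂)` to `(t ∂) t = t` gives `p · (e^t - 1)' = e^t -
1`, so `p = 1 - e^(-t)`. -/
theorem seriesExp_fieldAd_koszulSeries_X :
    seriesExp (fieldAd (koszulSeries 𝕜)) X =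
      PowerSeries.mk fun n => if n = 0 then 0 else (-1) ^ (n + 1) / (Nat.factorial n : 𝕜) := by
  have hk := koszulSeries_mem (𝕜 := 𝕜)
  have hD := raises_fieldDer hk
  have hA := raises_fieldAd hk
  have hE := isFilteredExp_seriesExp hD
  have hF := isSepFiltration_orderFil (𝕜 := 𝕜)
  -- The bilinear map is the action `(p, q) ↦ p q'` of the vector field `p ∂` on `q`; `k ∂` acts on
  -- it by derivations.
  have h := IsFilteredExp.map_bilin hF hF isSepFiltration_orderFil_pred hA hD
    (isFilteredExp_seriesExp hA) hE (E₃ := seriesExp (fieldDer (koszulSeries 𝕜)))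
    (D₃ := fieldDer (koszulSeries 𝕜))
    (fun K x => hF.anti (Nat.sub_le K 1) (hE K x))
    ((LinearMap.mul 𝕜 𝕜⟦X⟧).compl₂ (d⁄dX 𝕜 : 𝕜⟦X⟧ →ₗ[𝕜] 𝕜⟦X⟧))
    (fun K L x hx y hy => hF.anti (show K + L - 1 ≤ K + (L - 1) by omega)
      (mul_mem_orderFil hx (derivative_mem_orderFil hy))) (x := X) (y := X) (fun j =>
      leibniz_pow _ ⊤ ⊤ (fun _ _ => trivial) (fun _ _ => trivial) (by
        intro x _ y _
        simp only [LinearMap.compl₂_apply, LinearMap.mul_apply', fieldDer_apply, fieldAd_apply,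
          Derivation.coeFn_coe, Derivation.leibniz, smul_eq_mul]
        ring) j trivial trivial)
  simp only [LinearMap.compl₂_apply, LinearMap.mul_apply', Derivation.coeFn_coe, derivative_X,
    mul_one, seriesExp_koszulSeries_X, derivative_expSubOne] at h
  have h1 : expSubOne 𝕜 + 1 = PowerSeries.exp 𝕜 := by simp [expSubOne]
  have h2 := exp_mul_exp_neg_eq_one (A := 𝕜)
  rw [h1] at h
  have h3 : seriesExp (fieldAd (koszulSeries 𝕜)) X = 1 - evalNegHom (PowerSeries.exp 𝕜) := by
    calc _ = seriesExp (fieldAd (koszulSeries 𝕜)) X *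
          (PowerSeries.exp 𝕜 * evalNegHom (PowerSeries.exp 𝕜)) := by rw [h2, mul_one]
      _ = _ := by
        rw [← mul_assoc, ← h, expSubOne, sub_mul, h2, one_mul]
  rw [h3]
  ext n
  rw [map_sub, coeff_mk, evalNegHom, coeff_rescale, coeff_exp, coeff_one]
  split_ifs with hn
  · simp [hn]
  · rw [pow_succ]
    simp [div_eq_mul_inv]

end VectorFields

/-! ### Koszul signs as a cocycle on permutations. -/

section Signs

open Finset

theorem paritySign_comm (a b : ZMod 2) : paritySign a b = paritySign b a := by
  rw [paritySign, paritySign, mul_comm]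

theorem paritySign_mul_self (a b : ZMod 2) : paritySign a b * paritySign a b = 1 := by
  rw [paritySign, ← mul_pow]
  simp

theorem paritySign_zero_left (a : ZMod 2) : paritySign 0 a = 1 := by simp [paritySign]

theorem paritySign_zero_right (a : ZMod 2) : paritySign a 0 = 1 := by simp [paritySign]

theorem paritySign_one_one : paritySign 1 1 = -1 := by decide

/-- A symmetric function depends on the unordered pair only, and `τ` permutes unordered pairs. -/
theorem prod_lt_comp_perm {n : ℕ} (F : Fin n → Fin n → ℤ) (hF : ∀ i j, F i j = F j i)
    (τ : Equiv.Perm (Fin n)) :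
    ∏ p : Fin n × Fin n with p.1 < p.2, F (τ p.1) (τ p.2) =
      ∏ p : Fin n × Fin n with p.1 < p.2, F p.1 p.2 := by
  have aux : ∀ (τ : Equiv.Perm (Fin n)) (p : Fin n × Fin n), p.1 < p.2 →
      ¬ τ p.1 < τ p.2 → τ p.2 < τ p.1 := fun τ p hp h =>
    lt_of_le_of_ne (not_lt.mp h) fun h' => hp.ne' (τ.injective h')
  refine prod_nbij'
    (fun p => if τ p.1 < τ p.2 then (τ p.1, τ p.2) else (τ p.2, τ p.1))
    (fun p => if τ.symm p.1 < τ.symm p.2 then (τ.symm p.1, τ.symm p.2)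
      else (τ.symm p.2, τ.symm p.1)) ?_ ?_ ?_ ?_ ?_
  · intro p hp
    simp only [mem_filter, mem_univ, true_and] at hp ⊢
    split_ifs with h
    · exact h
    · exact aux τ p hp h
  · intro p hp
    simp only [mem_filter, mem_univ, true_and] at hp ⊢
    split_ifs with h
    · exact h
    · exact aux τ.symm p hp h
  · intro p hp
    simp only [mem_filter, mem_univ, true_and] at hp
    by_cases h : τ p.1 < τ p.2
    · simp [h, hp]
    · simp [h, hp.not_gt]
  · intro p hp
    simp only [mem_filter, mem_univ, true_and] at hp
    by_cases h : τ.symm p.1 < τ.symm p.2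
    · simp [h, hp]
    · simp [h, hp.not_gt]
  · intro p _
    by_cases h : τ p.1 < τ p.2
    · simp [h]
    · simp [h, hF (τ p.1) (τ p.2)]

theorem koszulSign_eq_prod {n : ℕ} (σ : Equiv.Perm (Fin n)) (d : Fin n → ZMod 2) :
    koszulSign σ d = ∏ p : Fin n × Fin n with p.1 < p.2,
      if σ p.2 < σ p.1 then paritySign (d (σ p.1)) (d (σ p.2)) else 1 := by
  rw [koszulSign, ← filter_filter, prod_filter]

theorem koszulSign_one {n : ℕ} (d : Fin n → ZMod 2) : koszulSign 1 d = 1 := by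
  rw [koszulSign_eq_prod]
  refine prod_eq_one fun p hp => ?_
  simp only [mem_filter, mem_univ, true_and] at hp
  rw [if_neg]
  simpa using hp.le

/-- A pair is inverted by `σ * τ` when exactly one of `τ` and `σ` reverses it. If both do, the sign
occurs twice and cancels. -/
theorem koszulSign_mul {n : ℕ} (σ τ : Equiv.Perm (Fin n)) (d : Fin n → ZMod 2) :
    koszulSign (σ * τ) d = koszulSign σ d * koszulSign τ (d ∘ σ) := by
  -- The contribution of an unordered pair to the sign of `σ`, made symmetric so that it can be
  -- reindexed along `τ`.
  let F : Fin n → Fin n → ℤ := fun i j =>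
    if (i < j ∧ σ j < σ i) ∨ (j < i ∧ σ i < σ j) then paritySign (d (σ i)) (d (σ j)) else 1
  have hF : ∀ i j, F i j = F j i := fun i j => by
    simp only [F, paritySign_comm (d (σ i)), or_comm]
  have h1 : koszulSign σ d = ∏ p : Fin n × Fin n with p.1 < p.2, F p.1 p.2 := by
    rw [koszulSign_eq_prod]
    refine prod_congr rfl fun p hp => ?_
    simp only [mem_filter, mem_univ, true_and] at hp
    simp [F, hp, hp.not_gt]
  rw [h1, ← prod_lt_comp_perm F hF τ, koszulSign_eq_prod, koszulSign_eq_prod, ← prod_mul_distrib]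
  refine prod_congr rfl fun p hp => ?_
  simp only [mem_filter, mem_univ, true_and] at hp
  simp only [F, Equiv.Perm.mul_apply, Function.comp_apply]
  rcases lt_trichotomy (τ p.1) (τ p.2) with h | h | h
  · simp only [h, h.not_gt, true_and, false_and, or_false, if_false, mul_one]
    rfl
  · exact absurd (τ.injective h) hp.ne
  · rcases lt_trichotomy (σ (τ p.1)) (σ (τ p.2)) with h' | h' | h'
    · simp [h, h.not_gt, h', h'.not_gt, paritySign_mul_self]
    · exact absurd (τ.injective (σ.injective h')) hp.ne
    · simp [h, h.not_gt, h', h'.not_gt]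

theorem koszulSign_swap {n : ℕ} (i : Fin n) (d : Fin (n + 1) → ZMod 2) :
    koszulSign (Equiv.swap i.castSucc i.succ) d = paritySign (d i.castSucc) (d i.succ) := by
  have h : ({p : Fin (n + 1) × Fin (n + 1) | p.1 < p.2 ∧ Equiv.swap i.castSucc i.succ p.2 <
      Equiv.swap i.castSucc i.succ p.1} : Finset _) = {(i.castSucc, i.succ)} := by
    ext ⟨a, b⟩
    simp only [mem_filter, mem_univ, true_and, mem_singleton, Prod.mk.injEq, Equiv.swap_apply_def,
      Fin.ext_iff, Fin.lt_def]
    split_ifs <;> simp_all <;> omega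
  rw [koszulSign, h, prod_singleton]
  simp [paritySign_comm]

theorem koszulSign_mul_self {n : ℕ} (σ : Equiv.Perm (Fin n)) (d : Fin n → ZMod 2) :
    koszulSign σ d * koszulSign σ d = 1 := by
  rw [koszulSign, ← prod_mul_distrib]
  exact prod_eq_one fun _ _ => paritySign_mul_self _ _

theorem perm_adjacent_induction {n : ℕ} {P : Equiv.Perm (Fin (n + 1)) → Prop} (one : P 1)
    (swap : ∀ i : Fin n, P (Equiv.swap i.castSucc i.succ))
    (mul : ∀ σ τ, P σ → P τ → P (σ * τ)) (σ : Equiv.Perm (Fin (n + 1))) : P σ := by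
  have h : σ ∈ Submonoid.closure
      (Set.range fun i : Fin n => Equiv.swap i.castSucc i.succ) := by
    rw [Equiv.Perm.mclosure_swap_castSucc_succ]
    trivial
  refine Submonoid.closure_induction (motive := fun σ _ => P σ) ?_ one (fun _ _ _ _ => mul _ _) h
  rintro _ ⟨i, rfl⟩
  exact swap i

end Signs

/-! ### Homogeneous arguments and parity components. -/

section Parity

variable {𝕜 V : Type*} [Field 𝕜] [AddCommGroup V] [Module 𝕜 V]

/-- Arguments are moved from `S` to its span one at a time, by induction on the set of moved
positions. -/
theorem MultilinearMap.eq_on_span {ι M N : Type*} [Fintype ι] [AddCommGroup M] [Module 𝕜 M]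
    [AddCommGroup N] [Module 𝕜 N] {f g : MultilinearMap 𝕜 (fun _ : ι => M) N} {S : Set M}
    (h : ∀ w : ι → M, (∀ i, w i ∈ S) → f w = g w) {w : ι → M}
    (hw : ∀ i, w i ∈ Submodule.span 𝕜 S) : f w = g w := by
  classical
  have key : ∀ (s : Finset ι) (w : ι → M), (∀ i ∈ s, w i ∈ Submodule.span 𝕜 S) →
      (∀ i ∉ s, w i ∈ S) → f w = g w := by
    intro s
    induction s using Finset.induction_on with
    | empty => exact fun w _ hw => h w fun i => hw i (Finset.notMem_empty i)
    | insert a s ha ih =>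
      intro w hw hw'
      have h1 : ∀ x ∈ Submodule.span 𝕜 S, f (Function.update w a x) = g (Function.update w a x) := by
        intro x hx
        induction hx using Submodule.span_induction with
        | mem x hx =>
          refine ih _ (fun i hi => ?_) (fun i hi => ?_)
          · rw [Function.update_of_ne (ne_of_mem_of_not_mem hi ha)]
            exact hw i (Finset.mem_insert_of_mem hi)
          · by_cases hia : i = a
            · subst hia
              rwa [Function.update_self]
            · rw [Function.update_of_ne hia]
              exact hw' i (by simp [hia, hi])
        | zero => rw [MultilinearMap.map_update_zero, MultilinearMap.map_update_zero]
        | add x y _ _ hx hy => rw [MultilinearMap.map_update_add, MultilinearMap.map_update_add, hx, hy]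
        | smul c x _ hx => rw [MultilinearMap.map_update_smul, MultilinearMap.map_update_smul, hx]
      simpa using h1 (w a) (hw a (Finset.mem_insert_self a s))
  exact key Finset.univ w (fun i _ => hw i) (fun i hi => absurd (Finset.mem_univ i) hi)

variable (𝒱 : ZMod 2 → Submodule 𝕜 V)

theorem symMult_apply_perm {n : ℕ} {f : Mult 𝕜 V n} (hf : f ∈ symMult 𝒱 n)
    (σ : Equiv.Perm (Fin (n + 1))) : ∀ {d : Fin (n + 1) → ZMod 2} {v : Fin (n + 1) → V},
    (∀ i, v i ∈ 𝒱 (d i)) → f v = koszulSign σ d • f (v ∘ σ) := by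
  induction σ using perm_adjacent_induction with
  | one => intro d v _; simp [koszulSign_one]
  | swap i => intro d v hv; rw [koszulSign_swap]; exact hf d v hv i
  | mul σ τ hσ hτ =>
    intro d v hv
    rw [koszulSign_mul, mul_smul, hσ hv, hτ (d := d ∘ σ) (v := v ∘ σ) (fun i => hv (σ i))]
    rfl

theorem HasParity.smul {n : ℕ} {p : ZMod 2} {f : Mult 𝕜 V n} (hf : HasParity 𝒱 p f) (c : 𝕜) :
    HasParity 𝒱 p (c • f) :=
  fun d v hv => Submodule.smul_mem _ c (hf d v hv)

theorem HasParity.sum {n : ℕ} {p : ZMod 2} {ι : Type*} {s : Finset ι} {f : ι → Mult 𝕜 V n}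
    (hf : ∀ i ∈ s, HasParity 𝒱 p (f i)) : HasParity 𝒱 p (∑ i ∈ s, f i) := fun d v hv => by
  rw [_root_.sum_apply]
  exact sum_mem fun i hi => hf i hi d v hv

theorem hasParity_zero {n : ℕ} (p : ZMod 2) : HasParity 𝒱 p (0 : Mult 𝕜 V n) :=
  fun _ _ _ => zero_mem _

variable [DirectSum.Decomposition 𝒱]

theorem Mult.ext_homogeneous {n : ℕ} {f g : Mult 𝕜 V n}
    (h : ∀ (d : Fin (n + 1) → ZMod 2) (v : Fin (n + 1) → V), (∀ i, v i ∈ 𝒱 (d i)) → f v = g v) :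
    f = g := by
  ext v
  refine MultilinearMap.eq_on_span (S := {x | ∃ d, x ∈ 𝒱 d}) (fun w hw => ?_) (fun i => ?_)
  · choose d hd using hw
    exact h d w hd
  · classical
    rw [← DirectSum.sum_support_decompose 𝒱 (v i)]
    exact sum_mem fun d _ => Submodule.subset_span ⟨d, SetLike.coe_mem _⟩

theorem koszulPerm_eq_self {n : ℕ} {f : Mult 𝕜 V n} (hf : f ∈ symMult 𝒱 n)
    (σ : Equiv.Perm (Fin (n + 1))) : koszulPerm 𝒱 σ f = f := by
  refine Mult.ext_homogeneous 𝒱 fun d v hv => ?_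
  rw [koszulPerm_apply 𝒱 σ f d v hv, symMult_apply_perm 𝒱 hf σ hv]
  rfl

theorem mem_symMult_of_koszulPerm {n : ℕ} {f : Mult 𝕜 V n} (hf : ∀ σ, koszulPerm 𝒱 σ f = f) :
    f ∈ symMult 𝒱 n := by
  intro d v hv i
  rw [← koszulSign_swap]
  conv_lhs => rw [← hf (Equiv.swap i.castSucc i.succ)]
  rw [koszulPerm_apply 𝒱 _ f d v hv]
  rfl

theorem koszulPerm_mul {n : ℕ} (σ τ : Equiv.Perm (Fin (n + 1))) (f : Mult 𝕜 V n) :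
    koszulPerm 𝒱 (σ * τ) f = koszulPerm 𝒱 σ (koszulPerm 𝒱 τ f) := by
  refine Mult.ext_homogeneous 𝒱 fun d v hv => ?_
  rw [koszulPerm_apply 𝒱 _ _ d v hv, koszulPerm_apply 𝒱 _ _ d v hv,
    koszulPerm_apply 𝒱 _ _ (d ∘ σ) (fun i => v (σ i)) (fun i => hv (σ i)), koszulSign_mul, mul_smul]
  rfl

theorem koszulPerm_sum {n : ℕ} {ι : Type*} (s : Finset ι) (σ : Equiv.Perm (Fin (n + 1)))
    (f : ι → Mult 𝕜 V n) : koszulPerm 𝒱 σ (∑ i ∈ s, f i) = ∑ i ∈ s, koszulPerm 𝒱 σ (f i) :=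
  map_sum (AddMonoidHom.mk' (koszulPerm 𝒱 σ) (koszulPerm_add 𝒱 σ)) f s

theorem HasParity.koszulPerm {n : ℕ} {p : ZMod 2} {f : Mult 𝕜 V n} (hf : HasParity 𝒱 p f)
    (σ : Equiv.Perm (Fin (n + 1))) : HasParity 𝒱 p (koszulPerm 𝒱 σ f) := by
  intro d v hv
  rw [koszulPerm_apply 𝒱 σ f d v hv]
  have := hf (d ∘ σ) (fun i => v (σ i)) (fun i => hv (σ i))
  rw [show ∑ i, (d ∘ σ) i = ∑ i, d i from Equiv.sum_comp σ d] at this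
  exact zsmul_mem this _

theorem parityPart_apply {n : ℕ} (p : ZMod 2) (f : Mult 𝕜 V n) {d : Fin (n + 1) → ZMod 2}
    {v : Fin (n + 1) → V} (hv : ∀ i, v i ∈ 𝒱 (d i)) :
    parityPart 𝒱 p f v = parityProj 𝒱 (p + ∑ i, d i) (f v) := by
  rw [parityPart, _root_.sum_apply, Finset.sum_eq_single d]
  · simp only [LinearMap.compMultilinearMap_apply, MultilinearMap.compLinearMap_apply]
    congr 2
    funext i
    exact parityProj_of_mem 𝒱 (hv i)
  · intro e _ he
    obtain ⟨i, hi⟩ : ∃ i, e i ≠ d i := by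
      by_contra! h
      exact he (funext h)
    rw [LinearMap.compMultilinearMap_apply, MultilinearMap.compLinearMap_apply,
      MultilinearMap.map_coord_zero _ i, map_zero]
    exact parityProj_of_mem_ne 𝒱 (hv i) (Ne.symm hi)
  · intro h
    exact absurd (Finset.mem_univ d) h

theorem parityProj_mem (d : ZMod 2) (v : V) : parityProj 𝒱 d v ∈ 𝒱 d := by
  rw [parityProj_apply]
  exact SetLike.coe_mem _

theorem sum_parityProj (p : ZMod 2) (v : V) : ∑ d, parityProj 𝒱 (d + p) v = v := by
  classical
  rw [Fintype.sum_equiv (Equiv.addRight p) (fun d => parityProj 𝒱 (d + p) v)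
    (fun d => parityProj 𝒱 d v) (fun _ => rfl)]
  simp only [parityProj_apply]
  conv_rhs => rw [← DirectSum.sum_support_decompose 𝒱 v]
  refine (Finset.sum_subset (Finset.subset_univ _) fun d _ hd => ?_).symm
  simpa using hd

theorem sum_parityPart {n : ℕ} (f : Mult 𝕜 V n) : ∑ p, parityPart 𝒱 p f = f := by
  refine Mult.ext_homogeneous 𝒱 fun d v hv => ?_
  rw [_root_.sum_apply, Finset.sum_congr rfl fun p _ => parityPart_apply 𝒱 p f hv,
    sum_parityProj]

theorem hasParity_parityPart {n : ℕ} (p : ZMod 2) (f : Mult 𝕜 V n) :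
    HasParity 𝒱 p (parityPart 𝒱 p f) := by
  intro d v hv
  rw [parityPart_apply 𝒱 p f hv]
  exact parityProj_mem 𝒱 _ _

theorem HasParity.parityPart_eq {n : ℕ} {p : ZMod 2} {f : Mult 𝕜 V n} (hf : HasParity 𝒱 p f)
    (q : ZMod 2) : parityPart 𝒱 q f = if q = p then f else 0 := by
  refine Mult.ext_homogeneous 𝒱 fun d v hv => ?_
  rw [parityPart_apply 𝒱 q f hv]
  split_ifs with h
  · subst h
    exact parityProj_of_mem 𝒱 (hf d v hv)
  · exact parityProj_of_mem_ne 𝒱 (hf d v hv) fun h' => h (add_right_cancel h'.symm)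

theorem parityPart_mem_symMult {n : ℕ} (p : ZMod 2) {f : Mult 𝕜 V n} (hf : f ∈ symMult 𝒱 n) :
    parityPart 𝒱 p f ∈ symMult 𝒱 n := by
  intro d v hv i
  rw [parityPart_apply 𝒱 p f hv, parityPart_apply 𝒱 p f (d := d ∘ Equiv.swap i.castSucc i.succ)
    (v := v ∘ Equiv.swap i.castSucc i.succ) (fun j => hv _), hf d v hv i, map_zsmul]
  congr 3
  rw [show ∑ j, (d ∘ Equiv.swap i.castSucc i.succ) j = ∑ j, d j from Equiv.sum_comp _ d]

end Parity

/-! ### Extension of scalars to a supercommutative algebra, which absorbs the signs. -/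

section Envelope

open TensorProduct

variable {𝕜 V W Λ : Type*} [Field 𝕜] [AddCommGroup V] [Module 𝕜 V] [AddCommGroup W] [Module 𝕜 W]
  [Ring Λ] [Algebra 𝕜 Λ]

variable (𝕜 W Λ) in
/-- Left multiplication of the values of a multilinear map by an element of `Λ`. -/
noncomputable def scaleMult (ι : Type*) (N : ι → Type*) [∀ i, AddCommGroup (N i)]
    [∀ i, Module 𝕜 (N i)] :
    Λ →ₗ[𝕜] MultilinearMap 𝕜 N (W ⊗[𝕜] Λ) →ₗ[𝕜] MultilinearMap 𝕜 N (W ⊗[𝕜] Λ) :=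
  LinearMap.mk₂ 𝕜 (fun l F => (LinearMap.lTensor W (LinearMap.mulLeft 𝕜 l)).compMultilinearMap F)
    (fun l l' F => by
      ext w
      have h : LinearMap.mulLeft 𝕜 (l + l') = LinearMap.mulLeft 𝕜 l + LinearMap.mulLeft 𝕜 l' := by
        ext x; simp [add_mul]
      simp [h, LinearMap.lTensor_add])
    (fun c l F => by
      ext w
      have h : LinearMap.mulLeft 𝕜 (c • l) = c • LinearMap.mulLeft 𝕜 l := by
        ext x; simp
      simp [h, LinearMap.lTensor_smul])
    (fun l F F' => by ext w; simp)
    (fun c l F => by ext w; simp)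

theorem scaleMult_apply {ι : Type*} {N : ι → Type*} [∀ i, AddCommGroup (N i)]
    [∀ i, Module 𝕜 (N i)] (l : Λ) (F : MultilinearMap 𝕜 N (W ⊗[𝕜] Λ)) (w : ∀ i, N i) :
    scaleMult 𝕜 W Λ ι N l F w = LinearMap.lTensor W (LinearMap.mulLeft 𝕜 l) (F w) := rfl

variable (𝕜 V W Λ) in
/-- The extension of a multilinear map to tensor products with an algebra; see
`tensorExt_tmul`. -/
noncomputable def tensorExt : ∀ n : ℕ, MultilinearMap 𝕜 (fun _ : Fin n => V) W →ₗ[𝕜]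
    MultilinearMap 𝕜 (fun _ : Fin n => V ⊗[𝕜] Λ) (W ⊗[𝕜] Λ)
  | 0 =>
    { toFun := fun f => MultilinearMap.constOfIsEmpty 𝕜 _ (f 0 ⊗ₜ[𝕜] (1 : Λ))
      map_add' := fun f g => by ext w; simp [add_tmul]
      map_smul' := fun c f => by ext w; simp [smul_tmul'] }
  | n + 1 =>
    (multilinearCurryLeftEquiv 𝕜 (fun _ : Fin (n + 1) => V ⊗[𝕜] Λ)
        (W ⊗[𝕜] Λ)).symm.toLinearMap ∘ₗ
      TensorProduct.uncurry (.id 𝕜) V Λ _ ∘ₗ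
      LinearMap.compRight 𝕜 ((scaleMult 𝕜 W Λ _ _).flip ∘ₗ tensorExt n) ∘ₗ
      (multilinearCurryLeftEquiv 𝕜 (fun _ : Fin (n + 1) => V) W).toLinearMap

theorem tensorExt_tmul {n : ℕ} (f : MultilinearMap 𝕜 (fun _ : Fin n => V) W) (v : Fin n → V)
    (l : Fin n → Λ) :
    tensorExt 𝕜 V W Λ n f (fun i => v i ⊗ₜ l i) = f v ⊗ₜ (List.ofFn l).prod := by
  induction n with
  | zero =>
    rw [Subsingleton.elim v 0]
    rfl
  | succ n ih =>
    rw [List.ofFn_succ, List.prod_cons]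
    change scaleMult 𝕜 W Λ _ _ (l 0) (tensorExt 𝕜 V W Λ n (f.curryLeft (v 0)))
      (fun i => v i.succ ⊗ₜ l i.succ) = _
    rw [scaleMult_apply, ih, LinearMap.lTensor_tmul, LinearMap.mulLeft_apply,
      MultilinearMap.curryLeft_apply]
    congr 2
    exact Fin.cons_self_tail v

/-- The extension of `f` to `V ⊗ Λ`, multiplied by `η`; see `env_tmul`. -/
noncomputable def env {n : ℕ} (f : Mult 𝕜 V n) (η : Λ) : Mult 𝕜 (V ⊗[𝕜] Λ) n :=
  scaleMult 𝕜 V Λ _ _ η (tensorExt 𝕜 V V Λ (n + 1) f)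

theorem env_tmul {n : ℕ} (f : Mult 𝕜 V n) (η : Λ) (v : Fin (n + 1) → V) (l : Fin (n + 1) → Λ) :
    env f η (fun i => v i ⊗ₜ l i) = f v ⊗ₜ (η * (List.ofFn l).prod) := by
  rw [env, scaleMult_apply, tensorExt_tmul, LinearMap.lTensor_tmul, LinearMap.mulLeft_apply]

theorem env_smul {n : ℕ} (c : 𝕜) (f : Mult 𝕜 V n) (η : Λ) : env (c • f) η = c • env f η := by
  rw [env, map_smul, map_smul]
  rfl

theorem env_zsmul {n : ℕ} (c : ℤ) (f : Mult 𝕜 V n) (η : Λ) : env (c • f) η = c • env f η := by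
  rw [env, map_zsmul, map_zsmul]
  rfl

theorem env_sub {n : ℕ} (f g : Mult 𝕜 V n) (η : Λ) : env (f - g) η = env f η - env g η := by
  rw [env, map_sub, map_sub]
  rfl

theorem env_sum {n : ℕ} {ι : Type*} (s : Finset ι) (f : ι → Mult 𝕜 V n) (η : Λ) :
    env (∑ i ∈ s, f i) η = ∑ i ∈ s, env (f i) η := by
  rw [env, map_sum, map_sum]
  rfl

theorem env_zsmul_right {n : ℕ} (c : ℤ) (f : Mult 𝕜 V n) (η : Λ) :
    env f (c • η) = c • env f η := by
  rw [env, map_zsmul]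
  rfl

theorem Mult.ext_tmul {n : ℕ} {N : Type*} [AddCommGroup N] [Module 𝕜 N]
    {F G : MultilinearMap 𝕜 (fun _ : Fin n => V ⊗[𝕜] Λ) N}
    (h : ∀ (v : Fin n → V) (l : Fin n → Λ), F (fun i => v i ⊗ₜ l i) = G (fun i => v i ⊗ₜ l i)) :
    F = G := by
  ext w
  refine MultilinearMap.eq_on_span (S := {x | ∃ (v : V) (l : Λ), v ⊗ₜ l = x}) (fun w hw => ?_)
    (fun i => by rw [TensorProduct.span_tmul_eq_top]; trivial)
  choose v l hvl using hw
  rw [← funext hvl]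
  exact h v l

/-- No sign appears because `g` occupies the first slot: `η (ζ l_0 ⋯ l_m) l_{m+1} ⋯` is already in
the right order. -/
theorem env_insertFirst {n m N : ℕ} (h : n + m = N) (f : Mult 𝕜 V n) (g : Mult 𝕜 V m) (η ζ : Λ) :
    env (insertFirst h f g) (η * ζ) = insertFirst h (env f η) (env g ζ) := by
  refine Mult.ext_tmul fun v l => ?_
  subst h
  rw [env_tmul, insertFirst_apply, insertFirst_apply,
    env_tmul g ζ (fun i : Fin (m + 1) => v ⟨i, by omega⟩) (fun i => l ⟨i, by omega⟩)]
  have h1 : (Fin.cons (g (fun i : Fin (m + 1) => v ⟨i, by omega⟩) ⊗ₜ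
      (ζ * (List.ofFn fun i : Fin (m + 1) => l ⟨i, by omega⟩).prod))
      (fun j : Fin n => v ⟨m + 1 + j, by omega⟩ ⊗ₜ l ⟨m + 1 + j, by omega⟩) :
        Fin (n + 1) → V ⊗[𝕜] Λ) = fun i =>
      (Fin.cons (g (fun i : Fin (m + 1) => v ⟨i, by omega⟩))
        (fun j : Fin n => v ⟨m + 1 + j, by omega⟩) : Fin (n + 1) → V) i ⊗ₜ
      (Fin.cons (ζ * (List.ofFn fun i : Fin (m + 1) => l ⟨i, by omega⟩).prod)
        (fun j : Fin n => l ⟨m + 1 + j, by omega⟩) : Fin (n + 1) → Λ) i := by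
    funext i
    refine Fin.cases rfl (fun j => rfl) i
  rw [h1, env_tmul, List.ofFn_cons, List.prod_cons]
  congr 1
  have h2 : List.ofFn l = (List.ofFn fun i : Fin (m + 1) => l ⟨i, by omega⟩) ++
      List.ofFn fun j : Fin n => l ⟨m + 1 + j, by omega⟩ := by
    rw [← List.ofFn_fin_append]
    rw [List.ofFn_congr (show n + m + 1 = m + 1 + n by omega)]
    congr 1
    funext i
    refine Fin.addCases (fun i => ?_) (fun j => ?_) i
    · rw [Fin.append_left]; rfl
    · rw [Fin.append_right]; rfl
  rw [h2, List.prod_append]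
  simp only [mul_assoc]

variable (𝒱 : ZMod 2 → Submodule 𝕜 V) (ℒ : ZMod 2 → Submodule 𝕜 Λ)

/-- The even part of `V ⊗ Λ`. -/
def evenSpan : Submodule 𝕜 (V ⊗[𝕜] Λ) :=
  Submodule.span 𝕜 {x | ∃ d, ∃ v ∈ 𝒱 d, ∃ l ∈ ℒ d, v ⊗ₜ l = x}

theorem eq_on_evenSpan {n : ℕ} {N : Type*} [AddCommGroup N] [Module 𝕜 N]
    {F G : MultilinearMap 𝕜 (fun _ : Fin n => V ⊗[𝕜] Λ) N}
    (h : ∀ (d : Fin n → ZMod 2) (v : Fin n → V) (l : Fin n → Λ), (∀ i, v i ∈ 𝒱 (d i)) →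
      (∀ i, l i ∈ ℒ (d i)) → F (fun i => v i ⊗ₜ l i) = G (fun i => v i ⊗ₜ l i))
    {w : Fin n → V ⊗[𝕜] Λ} (hw : ∀ i, w i ∈ evenSpan 𝒱 ℒ) : F w = G w := by
  refine MultilinearMap.eq_on_span (fun w hw => ?_) hw
  choose d v hv l hl hvl using hw
  rw [← funext hvl]
  exact h d v l hv hl

/-- The homogeneous elements of `Λ` supercommute. -/
def IsSupercomm : Prop := ∀ (i j : ZMod 2) (a b : Λ), a ∈ ℒ i → b ∈ ℒ j →
  a * b = paritySign i j • (b * a)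

theorem prod_ofFn_mem [SetLike.GradedMonoid ℒ] {n : ℕ} {d : Fin n → ZMod 2} {l : Fin n → Λ}
    (hl : ∀ i, l i ∈ ℒ (d i)) : (List.ofFn l).prod ∈ ℒ (∑ i, d i) := by
  rw [← List.sum_ofFn]
  exact SetLike.list_prod_ofFn_mem_graded d l hl

/-- Both sides are compatible with composition of permutations, which reduces the claim to adjacent
transpositions, where it is supercommutativity. -/
theorem prod_ofFn_perm (hℒ : IsSupercomm ℒ) {n : ℕ} (σ : Equiv.Perm (Fin (n + 1))) :
    ∀ {d : Fin (n + 1) → ZMod 2} {l : Fin (n + 1) → Λ}, (∀ i, l i ∈ ℒ (d i)) →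
      (List.ofFn l).prod = koszulSign σ d • (List.ofFn (l ∘ σ)).prod := by
  induction σ using perm_adjacent_induction with
  | one => intro d l _; simp [koszulSign_one]
  | mul σ τ hσ hτ =>
    intro d l hl
    rw [koszulSign_mul, mul_smul, hσ hl, hτ (d := d ∘ σ) (l := l ∘ σ) (fun i => hl (σ i))]
    rfl
  | swap i =>
    intro d l hl
    rw [koszulSign_swap]
    have key : ∀ (n : ℕ) (i : Fin n) (l : Fin (n + 1) → Λ), ∃ a b : Λ,
        (List.ofFn l).prod = a * (l i.castSucc * l i.succ) * b ∧
        (List.ofFn (l ∘ Equiv.swap i.castSucc i.succ)).prod =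
          a * (l i.succ * l i.castSucc) * b := by
      intro n
      induction n with
      | zero => exact fun i => i.elim0
      | succ n ih =>
        intro i l
        refine Fin.cases ?_ (fun i => ?_) i
        · refine ⟨1, (List.ofFn fun j : Fin n => l j.succ.succ).prod, ?_, ?_⟩
          · simp [List.ofFn_succ, mul_assoc]
          · rw [List.ofFn_succ, List.ofFn_succ]
            simp only [Function.comp_apply, Fin.castSucc_zero, Equiv.swap_apply_left,
              Equiv.swap_apply_right, List.prod_cons, one_mul, mul_assoc]
            have : ∀ j : Fin n, Equiv.swap (0 : Fin (n + 2)) (Fin.succ 0) j.succ.succ =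
                j.succ.succ := fun j => by
              refine Equiv.swap_apply_of_ne_of_ne (Fin.succ_ne_zero _) ?_
              rw [Ne, Fin.succ_inj]
              exact Fin.succ_ne_zero _
            simp only [this]
        · obtain ⟨a, b, h1, h2⟩ := ih i (fun j => l j.succ)
          refine ⟨l 0 * a, b, ?_, ?_⟩
          · rw [List.ofFn_succ, List.prod_cons, h1]
            simp only [Fin.succ_castSucc, mul_assoc]
          · rw [List.ofFn_succ, List.prod_cons, Function.comp_apply,
              Equiv.swap_apply_of_ne_of_ne (by simp [Fin.ext_iff]) (Fin.succ_ne_zero _).symm]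
            have h3 : (fun j : Fin (n + 1) =>
                (l ∘ Equiv.swap i.succ.castSucc i.succ.succ) j.succ) =
                (fun j : Fin (n + 1) => l j.succ) ∘ Equiv.swap i.castSucc i.succ := by
              funext j
              simp only [Function.comp_apply, ← Fin.succ_castSucc]
              rw [(Fin.succ_injective (n + 1)).swap_apply]
            rw [h3, h2]
            simp only [Fin.succ_castSucc, mul_assoc]
    obtain ⟨a, b, h1, h2⟩ := key n i l
    rw [h1, h2, hℒ _ _ _ _ (hl _) (hl _), mul_smul_comm, smul_mul_assoc]

/-- The parameter `η` has the parity of `f`, so `f v` and its coefficient again have equal parity.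
-/
theorem env_mem_evenSpan [SetLike.GradedMonoid ℒ] {n : ℕ} {p : ZMod 2} {f : Mult 𝕜 V n}
    (hf : HasParity 𝒱 p f) {η : Λ} (hη : η ∈ ℒ p) {w : Fin (n + 1) → V ⊗[𝕜] Λ}
    (hw : ∀ i, w i ∈ evenSpan 𝒱 ℒ) : env f η w ∈ evenSpan 𝒱 ℒ := by
  rw [← Submodule.Quotient.mk_eq_zero, ← Submodule.mkQ_apply]
  change ((evenSpan 𝒱 ℒ).mkQ.compMultilinearMap (env f η)) w =
    (0 : MultilinearMap 𝕜 (fun _ : Fin (n + 1) => V ⊗[𝕜] Λ) _) w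
  refine eq_on_evenSpan 𝒱 ℒ (fun d v l hv hl => ?_) hw
  rw [LinearMap.compMultilinearMap_apply, env_tmul, Submodule.mkQ_apply,
    _root_.zero_apply, Submodule.Quotient.mk_eq_zero]
  exact Submodule.subset_span ⟨_, _, hf d v hv, _,
    SetLike.mul_mem_graded hη (prod_ofFn_mem ℒ hl), rfl⟩

variable [DirectSum.Decomposition 𝒱]

/-- On the even part the coefficients have the parities of the vectors. Reordering the coefficients
therefore produces the same sign as reordering the vectors, and the two cancel. -/
theorem env_koszulPerm (hℒ : IsSupercomm ℒ) {n : ℕ} (σ : Equiv.Perm (Fin (n + 1)))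
    (f : Mult 𝕜 V n) (η : Λ) {w : Fin (n + 1) → V ⊗[𝕜] Λ} (hw : ∀ i, w i ∈ evenSpan 𝒱 ℒ) :
    env (koszulPerm 𝒱 σ f) η w = env f η (w ∘ σ) := by
  change _ = (env f η).domDomCongr σ w
  refine eq_on_evenSpan 𝒱 ℒ (fun d v l hv hl => ?_) hw
  rw [env_tmul, koszulPerm_apply 𝒱 σ f d v hv, MultilinearMap.domDomCongr_apply,
    env_tmul f η (fun i => v (σ i)) (fun i => l (σ i)), prod_ofFn_perm ℒ hℒ σ hl,
    mul_smul_comm, tmul_smul, ← smul_tmul', smul_smul, koszulSign_mul_self, one_smul]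
  rfl

theorem env_comp_perm (hℒ : IsSupercomm ℒ) {n : ℕ} {f : Mult 𝕜 V n} (hf : f ∈ symMult 𝒱 n)
    (σ : Equiv.Perm (Fin (n + 1))) (η : Λ) {w : Fin (n + 1) → V ⊗[𝕜] Λ}
    (hw : ∀ i, w i ∈ evenSpan 𝒱 ℒ) : env f η (w ∘ σ) = env f η w := by
  rw [← env_koszulPerm 𝒱 ℒ hℒ σ f η hw, koszulPerm_eq_self 𝒱 hf]

end Envelope

/-! ### The Grassmann algebra as the algebra of coefficients. -/

section Grassmann

open CliffordAlgebra

variable (𝕜 : Type*) [Field 𝕜]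

/-- The Grassmann algebra with countably many generators. -/
noncomputable abbrev Grassmann : Type _ := ExteriorAlgebra 𝕜 (ℕ →₀ 𝕜)

/-- The parity grading of the Grassmann algebra. -/
noncomputable abbrev grassmannGrading : ZMod 2 → Submodule 𝕜 (Grassmann 𝕜) :=
  evenOdd (0 : QuadraticForm 𝕜 (ℕ →₀ 𝕜))

theorem zmod_two_eq_zero_or_one (i : ZMod 2) : i = 0 ∨ i = 1 := by
  revert i
  decide

theorem grassmann_ι_mul (v : ℕ →₀ 𝕜) {j : ZMod 2} {b : Grassmann 𝕜}
    (hb : b ∈ grassmannGrading 𝕜 j) :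
    ExteriorAlgebra.ι 𝕜 v * b = paritySign 1 j • (b * ExteriorAlgebra.ι 𝕜 v) := by
  have hanti : ∀ x y : ℕ →₀ 𝕜, ExteriorAlgebra.ι 𝕜 x * ExteriorAlgebra.ι 𝕜 y =
      -(ExteriorAlgebra.ι 𝕜 y * ExteriorAlgebra.ι 𝕜 x) := fun x y =>
    eq_neg_of_add_eq_zero_left (ExteriorAlgebra.ι_add_mul_swap x y)
  refine evenOdd_induction (0 : QuadraticForm 𝕜 (ℕ →₀ 𝕜)) j
    (motive := fun b _ => ExteriorAlgebra.ι 𝕜 v * b =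
      paritySign 1 j • (b * ExteriorAlgebra.ι 𝕜 v)) ?_ ?_ ?_ b hb
  · intro b hb
    obtain rfl | rfl := zmod_two_eq_zero_or_one j
    · rw [ZMod.val_zero, pow_zero, Submodule.mem_one] at hb
      obtain ⟨c, rfl⟩ := hb
      rw [paritySign_zero_right, one_smul, Algebra.commutes]
    · rw [ZMod.val_one, pow_one] at hb
      obtain ⟨y, rfl⟩ := hb
      rw [paritySign_one_one, neg_one_zsmul]
      exact hanti v y
  · intro x y _ _ hx hy
    rw [mul_add, add_mul, hx, hy, smul_add]
  · intro m₁ m₂ x _ hx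
    change ExteriorAlgebra.ι 𝕜 v * (ExteriorAlgebra.ι 𝕜 m₁ * ExteriorAlgebra.ι 𝕜 m₂ * x) =
      paritySign 1 j • (ExteriorAlgebra.ι 𝕜 m₁ * ExteriorAlgebra.ι 𝕜 m₂ * x *
        ExteriorAlgebra.ι 𝕜 v)
    rw [mul_assoc _ x, ← mul_smul_comm, ← hx, ← mul_assoc, ← mul_assoc, ← mul_assoc, hanti v m₁,
      neg_mul, mul_assoc (ExteriorAlgebra.ι 𝕜 m₁) _ (ExteriorAlgebra.ι 𝕜 m₂), hanti v m₂]
    simp only [mul_neg, neg_neg, mul_assoc]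

theorem isSupercomm_grassmannGrading : IsSupercomm (grassmannGrading 𝕜) := by
  intro i j a b ha hb
  refine evenOdd_induction (0 : QuadraticForm 𝕜 (ℕ →₀ 𝕜)) i
    (motive := fun a _ => a * b = paritySign i j • (b * a)) ?_ ?_ ?_ a ha
  · intro a ha
    obtain rfl | rfl := zmod_two_eq_zero_or_one i
    · rw [ZMod.val_zero, pow_zero, Submodule.mem_one] at ha
      obtain ⟨c, rfl⟩ := ha
      rw [paritySign_zero_left, one_smul, Algebra.commutes]
    · rw [ZMod.val_one, pow_one] at ha
      obtain ⟨y, rfl⟩ := ha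
      exact grassmann_ι_mul 𝕜 y hb
  · intro x y _ _ hx hy
    rw [mul_add, add_mul, hx, hy, smul_add]
  · intro m₁ m₂ x _ hx
    have h1 := grassmann_ι_mul 𝕜 m₁ hb
    have h2 := grassmann_ι_mul 𝕜 m₂ hb
    change ExteriorAlgebra.ι 𝕜 m₁ * ExteriorAlgebra.ι 𝕜 m₂ * x * b =
      paritySign i j • (b * (ExteriorAlgebra.ι 𝕜 m₁ * ExteriorAlgebra.ι 𝕜 m₂ * x))
    rw [mul_assoc, hx, mul_smul_comm, mul_assoc, ← mul_assoc _ b x, h2, smul_mul_assoc,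
      mul_smul_comm, mul_assoc b, ← mul_assoc _ b, h1, smul_mul_assoc, smul_smul (paritySign 1 j),
      paritySign_mul_self, one_smul]
    simp only [mul_assoc]

/-- Distinct generators are used for the odd factors and 1 for the even ones. Contraction with the
dual coordinate of the first odd generator removes it from the product, so vanishing would propagate
down to the empty product. No bound on `K` means infinitely many generators are needed. -/
theorem exists_grassmann_prod_ne_zero (K : ℕ) (d : Fin K → ZMod 2) :
    ∃ l : Fin K → Grassmann 𝕜, (∀ i, l i ∈ grassmannGrading 𝕜 (d i)) ∧ (List.ofFn l).prod ≠ 0 := by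
  classical
  let Q : QuadraticForm 𝕜 (ℕ →₀ 𝕜) := 0
  let e : Fin K → Grassmann 𝕜 := fun i =>
    if d i = 0 then 1 else CliffordAlgebra.ι Q (Finsupp.single (i : ℕ) 1)
  have hcontr : ∀ (j : Fin K) (L : List (Fin K)), j ∉ L →
      contractLeft (Q := Q) (Finsupp.lapply (j : ℕ)) ((L.map e).prod) = 0 := by
    intro j L
    induction L with
    | nil => intro _; simp
    | cons i L ih =>
      intro hj
      simp only [List.mem_cons, not_or] at hj
      rw [List.map_cons, List.prod_cons]
      by_cases hi : d i = 0
      · simp only [e, hi, if_true, one_mul]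
        exact ih hj.2
      · simp only [e, hi, if_false]
        rw [contractLeft_ι_mul, ih hj.2, mul_zero, sub_zero, Finsupp.lapply_apply,
          Finsupp.single_eq_of_ne (by simpa [Fin.ext_iff] using hj.1), zero_smul]
  have hne : ∀ L : List (Fin K), L.Nodup → (L.map e).prod ≠ 0 := by
    intro L
    induction L with
    | nil => intro _; simp
    | cons i L ih =>
      intro hL h
      rw [List.nodup_cons] at hL
      rw [List.map_cons, List.prod_cons] at h
      by_cases hi : d i = 0
      · simp only [e, hi, if_true, one_mul] at h
        exact ih hL.2 h
      · simp only [e, hi, if_false] at h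
        have h' := congrArg (contractLeft (Q := Q) (Finsupp.lapply (i : ℕ))) h
        rw [contractLeft_ι_mul, hcontr i L hL.1, mul_zero, sub_zero, Finsupp.lapply_apply,
          Finsupp.single_eq_same, one_smul, map_zero] at h'
        exact ih hL.2 h'
  refine ⟨e, fun i => ?_, ?_⟩
  · by_cases hi : d i = 0
    · simp only [e, hi, if_true]
      exact SetLike.GradedOne.one_mem
    · have : d i = 1 := (zmod_two_eq_zero_or_one _).resolve_left hi
      simp only [e, this]
      exact ι_mem_evenOdd_one Q _
  · have := hne (List.finRange K) (List.nodup_finRange K)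
    rwa [← List.ofFn_eq_map] at this

end Grassmann

/-! ### Multilinear maps are determined by their extension to the even part. -/

section Injectivity

open TensorProduct

variable {𝕜 V : Type*} [Field 𝕜] [AddCommGroup V] [Module 𝕜 V]

theorem tmul_right_injective_of_ne_zero {Λ : Type*} [AddCommGroup Λ] [Module 𝕜 Λ] {l : Λ}
    (hl : l ≠ 0) {v v' : V} (h : v ⊗ₜ[𝕜] l = v' ⊗ₜ[𝕜] l) : v = v' := by
  obtain ⟨φ, hφ⟩ : ∃ φ : Λ →ₗ[𝕜] 𝕜, φ l ≠ 0 := by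
    by_contra! h
    exact hl ((Module.forall_dual_apply_eq_zero_iff 𝕜 l).mp h)
  have h' := congrArg ((TensorProduct.rid 𝕜 V).toLinearMap ∘ₗ LinearMap.lTensor V φ) h
  simp only [LinearMap.comp_apply, LinearMap.lTensor_tmul, LinearEquiv.coe_coe, rid_tmul] at h'
  exact smul_right_injective V hφ h'

variable (𝒱 : ZMod 2 → Submodule 𝕜 V) [DirectSum.Decomposition 𝒱]

/-- The scalar is a product of two parameters because products of two maps are compared, each map
carrying a parameter of its own parity. -/
theorem eq_of_env_eq {n : ℕ} {f g : Mult 𝕜 V n} (q r : ZMod 2)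
    (h : ∀ ζ ∈ grassmannGrading 𝕜 q, ∀ ξ ∈ grassmannGrading 𝕜 r,
      ∀ w : Fin (n + 1) → V ⊗[𝕜] Grassmann 𝕜, (∀ i, w i ∈ evenSpan 𝒱 (grassmannGrading 𝕜)) →
        env f (ζ * ξ) w = env g (ζ * ξ) w) : f = g := by
  refine Mult.ext_homogeneous 𝒱 fun d v hv => ?_
  -- The first two factors serve as `ζ` and `ξ`, the other `n + 1` as coefficients of the arguments.
  obtain ⟨l, hl, hl0⟩ := exists_grassmann_prod_ne_zero 𝕜 (n + 3)
    (Fin.cons q (Fin.cons r d : Fin (n + 2) → ZMod 2))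
  rw [List.ofFn_succ, List.ofFn_succ, List.prod_cons, List.prod_cons, ← mul_assoc] at hl0
  have := h _ (hl 0) _ (hl 1) (fun i => v i ⊗ₜ l i.succ.succ) fun i =>
    Submodule.subset_span ⟨d i, _, hv i, _, hl i.succ.succ, rfl⟩
  rw [env_tmul, env_tmul] at this
  exact tmul_right_injective_of_ne_zero hl0 this

end Injectivity

/-! ### Polarization. -/

section Polarization

variable {𝕜 M N ι : Type*} [Field 𝕜] [CharZero 𝕜] [AddCommGroup M] [Module 𝕜 M]
  [AddCommGroup N] [Module 𝕜 N] [Fintype ι]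

open Finset in
/-- A multilinear map which is symmetric and vanishes on the diagonal of a submodule vanishes on
this submodule. -/
theorem MultilinearMap.eq_zero_of_diagonal {F : MultilinearMap 𝕜 (fun _ : ι => M) N}
    {G : Submodule 𝕜 M} (hsym : ∀ (σ : Equiv.Perm ι) (w : ι → M), (∀ i, w i ∈ G) →
      F (w ∘ σ) = F w) (hdiag : ∀ x ∈ G, F (fun _ => x) = 0) {w : ι → M} (hw : ∀ i, w i ∈ G) :
    F w = 0 := by
  classical
  -- Expand `F` on the diagonal at `∑_{i ∈ S} w_i`.
  have h1 : ∀ S : Finset ι, ∑ r : ι → ι, (if ∀ i, r i ∈ S then F (w ∘ r) else 0) = 0 := by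
    intro S
    have h := F.map_sum_finset (fun _ i => w i) (fun _ : ι => S)
    rw [hdiag _ (sum_mem fun i _ => hw i)] at h
    rw [← sum_filter]
    refine Eq.trans ?_ h.symm
    refine sum_congr ?_ fun _ _ => rfl
    ext r
    simp
  -- Inclusion–exclusion: the sum expands `∏_i (-1 + [i not in the image of r])`, which has a zero
  -- factor unless `r` misses no point.
  have h2 : ∀ r : ι → ι, ∑ S : Finset ι, (-1 : ℤ) ^ #S * (if ∀ i, r i ∈ S then 1 else 0) =
      if Function.Bijective r then (-1) ^ Fintype.card ι else 0 := by
    intro r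
    have h := prod_add (fun _ : ι => (-1 : ℤ)) (fun i => if ∃ j, r j = i then 0 else 1) univ
    rw [powerset_univ] at h
    have h3 : ∀ S : Finset ι, (∏ _i ∈ S, (-1 : ℤ)) *
        ∏ i ∈ univ \ S, (if ∃ j, r j = i then (0 : ℤ) else 1) =
        (-1 : ℤ) ^ #S * (if ∀ i, r i ∈ S then 1 else 0) := by
      intro S
      rw [prod_const]
      congr 1
      split_ifs with hS
      · refine prod_eq_one fun i hi => if_neg ?_
        rintro ⟨j, rfl⟩
        simp [hS j] at hi
      · push Not at hS
        obtain ⟨j, hj⟩ := hS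
        exact prod_eq_zero (i := r j) (by simp [hj]) (if_pos ⟨j, rfl⟩)
    rw [← sum_congr rfl fun S _ => h3 S, ← h]
    split_ifs with hr
    · rw [prod_congr rfl fun i _ => show (-1 : ℤ) + (if ∃ j, r j = i then 0 else 1) = -1 by
        rw [if_pos (hr.2 i), add_zero], prod_const, card_univ]
    · rw [← Finite.surjective_iff_bijective] at hr
      simp only [Function.Surjective, not_forall] at hr
      obtain ⟨i, hi⟩ := hr
      exact prod_eq_zero (mem_univ i) (by rw [if_neg hi]; rfl)
  have h4 : ∑ S : Finset ι, (-1 : ℤ) ^ #S •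
      ∑ r : ι → ι, (if ∀ i, r i ∈ S then F (w ∘ r) else 0) = 0 :=
    sum_eq_zero fun S _ => by rw [h1, smul_zero]
  simp only [smul_sum] at h4
  rw [sum_comm] at h4
  have h5 : ∀ r : ι → ι, ∑ S : Finset ι, (-1 : ℤ) ^ #S •
      (if ∀ i, r i ∈ S then F (w ∘ r) else 0) =
      if Function.Bijective r then (-1 : ℤ) ^ Fintype.card ι • F w else 0 := by
    intro r
    have : ∀ S : Finset ι, (-1 : ℤ) ^ #S • (if ∀ i, r i ∈ S then F (w ∘ r) else 0) =
        ((-1 : ℤ) ^ #S * (if ∀ i, r i ∈ S then 1 else 0)) • F (w ∘ r) := fun S => by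
      split_ifs <;> simp
    rw [sum_congr rfl fun S _ => this S, ← sum_smul, h2]
    split_ifs with hr
    · rw [← hsym (Equiv.ofBijective r hr) w hw]
      rfl
    · rw [zero_smul]
  -- What is left is `±c F w`, where `c` counts the bijections and is nonzero in characteristic 0.
  rw [sum_congr rfl fun r _ => h5 r, ← sum_filter, sum_const, smul_comm,
    ← Nat.cast_smul_eq_nsmul 𝕜] at h4
  have h6 : (#{r : ι → ι | Function.Bijective r} : 𝕜) ≠ 0 := by
    rw [Nat.cast_ne_zero, card_ne_zero]
    exact ⟨id, by simp⟩
  generalize #{r : ι → ι | Function.Bijective r} = c at h4 h6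
  rcases neg_one_pow_eq_or ℤ (Fintype.card ι) with h7 | h7 <;> simpa [h7, h6] using h4

end Polarization

/-! ### Shuffles as representatives of subsets. -/

section Shuffles

open Finset

variable {k N : ℕ}

/-- The set of values of a permutation on the first `k` indices. -/
def firstBlock (k : ℕ) (σ : Equiv.Perm (Fin N)) : Finset (Fin N) := {a | (σ.symm a : ℕ) < k}

theorem mem_firstBlock {σ : Equiv.Perm (Fin N)} {a : Fin N} :
    a ∈ firstBlock k σ ↔ (σ.symm a : ℕ) < k := by
  simp [firstBlock]

theorem apply_mem_firstBlock {σ : Equiv.Perm (Fin N)} {i : Fin N} :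
    σ i ∈ firstBlock k σ ↔ (i : ℕ) < k := by
  simp [firstBlock]

theorem firstBlock_mul (τ σ : Equiv.Perm (Fin N)) :
    firstBlock k (τ * σ) = (firstBlock k σ).map τ.toEmbedding := by
  ext a
  rw [mem_map_equiv, mem_firstBlock, mem_firstBlock]
  rfl

theorem card_firstBlock (hk : k ≤ N) (σ : Equiv.Perm (Fin N)) : #(firstBlock k σ) = k := by
  rw [show σ = σ * 1 from (mul_one σ).symm, firstBlock_mul, card_map]
  have : firstBlock k (1 : Equiv.Perm (Fin N)) = ({a : Fin N | (a : ℕ) < k} : Finset (Fin N)) := by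
    ext a
    rw [mem_firstBlock, mem_filter]
    exact (and_iff_right (mem_univ a)).symm
  rw [this, Fin.card_filter_val_lt]
  exact min_eq_right hk

theorem mem_shuffles {σ : Equiv.Perm (Fin N)} : σ ∈ shuffles k N ↔
    (∀ i j : Fin N, i < j → (j : ℕ) < k → σ i < σ j) ∧
      (∀ i j : Fin N, i < j → k ≤ (i : ℕ) → σ i < σ j) := by
  simp [shuffles]

theorem exists_shuffle {S : Finset (Fin N)} (hS : #S = k) :
    ∃ σ ∈ shuffles k N, firstBlock k σ = S := by
  have hSc : #Sᶜ = N - k := by rw [card_compl, hS, Fintype.card_fin]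
  have hk : k ≤ N := by simpa [hS] using card_le_univ S
  let e : Fin k ⊕ Fin (N - k) ≃ Fin N := finSumFinEquiv.trans (finCongr (by omega))
  let σ : Equiv.Perm (Fin N) := e.symm.trans (finSumEquivOfFinset hS hSc)
  have h1 : ∀ (i : Fin N) (hi : (i : ℕ) < k), σ i = S.orderEmbOfFin hS ⟨i, hi⟩ := by
    intro i hi
    have : i = e (Sum.inl ⟨i, hi⟩) := by ext; simp [e]
    conv_lhs => rw [this]
    simp [σ]
  have h2 : ∀ (i : Fin N) (hi : k ≤ (i : ℕ)),
      σ i = Sᶜ.orderEmbOfFin hSc ⟨i - k, by omega⟩ := by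
    intro i hi
    have : i = e (Sum.inr ⟨i - k, by omega⟩) := by ext; simp [e]; omega
    conv_lhs => rw [this]
    simp [σ]
  refine ⟨σ, mem_shuffles.mpr ⟨fun i j hij hj => ?_, fun i j hij hi => ?_⟩, ?_⟩
  · rw [h1 i (lt_trans hij hj), h1 j hj, OrderEmbedding.lt_iff_lt]
    exact hij
  · rw [h2 i hi, h2 j (hi.trans hij.le), OrderEmbedding.lt_iff_lt, Fin.lt_def]
    exact Nat.sub_lt_sub_right hi hij
  · ext a
    obtain ⟨i, rfl⟩ := σ.surjective a
    rw [apply_mem_firstBlock]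
    by_cases hi : (i : ℕ) < k
    · simp [h1 i hi, hi, orderEmbOfFin_mem]
    · have := orderEmbOfFin_mem Sᶜ hSc ⟨i - k, by omega⟩
      rw [← h2 i (not_lt.mp hi), mem_compl] at this
      simp [hi, this]

theorem shuffle_ext (hk : k ≤ N) {σ τ : Equiv.Perm (Fin N)} (hσ : σ ∈ shuffles k N)
    (hτ : τ ∈ shuffles k N) (h : firstBlock k σ = firstBlock k τ) : σ = τ := by
  have hc : #(firstBlock k τ)ᶜ = N - k := by rw [card_compl, card_firstBlock hk, Fintype.card_fin]
  have h1 : ∀ ρ ∈ shuffles k N, firstBlock k ρ = firstBlock k τ → ∀ (i : Fin k),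
      ρ ⟨i, by omega⟩ = (firstBlock k τ).orderEmbOfFin (card_firstBlock hk τ) i := by
    intro ρ hρ h i
    refine congrFun (orderEmbOfFin_unique (card_firstBlock hk τ)
      (f := fun i : Fin k => ρ ⟨i, by omega⟩) (fun i => ?_) fun i j hij => ?_) i
    · rw [← h, apply_mem_firstBlock]
      exact i.2
    · exact (mem_shuffles.mp hρ).1 _ _ hij j.2
  have h2 : ∀ ρ ∈ shuffles k N, firstBlock k ρ = firstBlock k τ → ∀ (i : Fin (N - k)),
      ρ ⟨k + i, by omega⟩ = (firstBlock k τ)ᶜ.orderEmbOfFin hc i := by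
    intro ρ hρ h i
    refine congrFun (orderEmbOfFin_unique hc
      (f := fun i : Fin (N - k) => ρ ⟨k + i, by omega⟩) (fun i => ?_) fun i j hij => ?_) i
    · rw [← h, mem_compl, apply_mem_firstBlock]
      simp
    · exact (mem_shuffles.mp hρ).2 _ _ 
        (Fin.lt_def.mpr (Nat.add_lt_add_left hij k)) (Nat.le_add_right k _)
  ext1 i
  by_cases hi : (i : ℕ) < k
  · exact (h1 σ hσ h ⟨i, hi⟩).trans (h1 τ hτ rfl ⟨i, hi⟩).symm
  · have := (h2 σ hσ h ⟨i - k, by omega⟩).trans (h2 τ hτ rfl ⟨i - k, by omega⟩).symm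
    have hi' : (⟨k + (i - k), by omega⟩ : Fin N) = i := by ext; simp; omega
    simpa only [hi'] using this

theorem exists_shuffle_rep (k N : ℕ) : ∃ rep : Finset (Fin N) → Equiv.Perm (Fin N),
    ∀ S, #S = k → rep S ∈ shuffles k N ∧ firstBlock k (rep S) = S := by
  have : ∀ S : Finset (Fin N), ∃ σ : Equiv.Perm (Fin N),
      #S = k → σ ∈ shuffles k N ∧ firstBlock k σ = S := fun S => by
    by_cases hS : #S = k
    · obtain ⟨σ, hσ⟩ := exists_shuffle hS
      exact ⟨σ, fun _ => hσ⟩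
    · exact ⟨1, fun h => absurd h hS⟩
  choose rep hrep using this
  exact ⟨rep, hrep⟩

/-- Permutations with the same first block form a left coset of the block subgroup, and shuffles
represent these cosets. Left multiplication by `τ` permutes the cosets. -/
theorem sum_shuffles_mul_left (hk : k ≤ N) {X : Type*} [AddCommMonoid X]
    (H : Equiv.Perm (Fin N) → X)
    (hH : ∀ σ σ', firstBlock k σ = firstBlock k σ' → H σ = H σ') (τ : Equiv.Perm (Fin N)) :
    ∑ σ ∈ shuffles k N, H (τ * σ) = ∑ σ ∈ shuffles k N, H σ := by
  obtain ⟨rep, hrep⟩ := exists_shuffle_rep k N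
  have hr : ∀ σ : Equiv.Perm (Fin N), rep (firstBlock k σ) ∈ shuffles k N ∧
      firstBlock k (rep (firstBlock k σ)) = firstBlock k σ := fun σ =>
    hrep _ (card_firstBlock hk σ)
  have hinv : ∀ (τ : Equiv.Perm (Fin N)), ∀ σ ∈ shuffles k N,
      rep (firstBlock k (τ⁻¹ * rep (firstBlock k (τ * σ)))) = σ := fun τ σ hσ => by
    refine shuffle_ext hk (hr _).1 hσ ?_
    rw [(hr _).2, firstBlock_mul, (hr _).2, ← firstBlock_mul, inv_mul_cancel_left]
  refine sum_nbij' (fun σ => rep (firstBlock k (τ * σ))) (fun σ => rep (firstBlock k (τ⁻¹ * σ)))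
    (fun σ _ => (hr _).1) (fun σ _ => (hr _).1) (hinv τ) (fun σ hσ => ?_)
    (fun σ _ => hH _ _ (hr _).2.symm)
  simpa using hinv τ⁻¹ σ hσ

theorem card_shuffles_filter (hk : k ≤ N) (P : Finset (Fin N) → Prop) [DecidablePred P] :
    #{σ ∈ shuffles k N | P (firstBlock k σ)} = #{S ∈ powersetCard k univ | P S} := by
  obtain ⟨rep, hrep⟩ := exists_shuffle_rep k N
  refine card_nbij' (firstBlock k) rep ?_ ?_ ?_ ?_
  · intro σ hσ
    simp only [coe_filter, Set.mem_ofPred_eq] at hσ ⊢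
    exact ⟨mem_powersetCard.mpr ⟨subset_univ _, card_firstBlock hk σ⟩, hσ.2⟩
  · intro S hS
    simp only [coe_filter, Set.mem_ofPred_eq, mem_powersetCard] at hS ⊢
    exact ⟨(hrep S hS.1.2).1, (hrep S hS.1.2).2.symm ▸ hS.2⟩
  · intro σ hσ
    simp only [coe_filter, Set.mem_ofPred_eq] at hσ
    have h := hrep _ (card_firstBlock hk σ)
    exact shuffle_ext hk h.1 hσ.1 h.2
  · intro S hS
    simp only [coe_filter, Set.mem_ofPred_eq, mem_powersetCard] at hS
    exact (hrep S hS.1.2).2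

theorem card_shuffles (hk : k ≤ N) : #(shuffles k N) = N.choose k := by
  have h := card_shuffles_filter hk (fun _ => True)
  rw [filter_true, filter_true, card_powersetCard, card_univ, Fintype.card_fin] at h
  exact h

theorem card_shuffles_zero_right (hk : k ≤ N + 1) :
    #{σ ∈ shuffles k (N + 1) | 0 ∉ firstBlock k σ} = N.choose k := by
  rw [card_shuffles_filter hk (fun S => 0 ∉ S)]
  have : ({S ∈ powersetCard k (univ : Finset (Fin (N + 1))) | 0 ∉ S} : Finset _) =
      powersetCard k (univ.erase 0) := by
    ext S
    simp only [mem_filter, mem_powersetCard, subset_univ, true_and, subset_erase]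
    tauto
  rw [this, card_powersetCard, card_erase_of_mem (mem_univ _), card_univ, Fintype.card_fin,
    Nat.add_sub_cancel]

theorem card_shuffles_zero_left (hk : k ≤ N) :
    #{σ ∈ shuffles (k + 1) (N + 1) | 0 ∈ firstBlock (k + 1) σ} = N.choose k := by
  have h1 := card_filter_add_card_filter_not (s := shuffles (k + 1) (N + 1))
    (fun σ => 0 ∈ firstBlock (k + 1) σ)
  rw [card_shuffles_zero_right (by omega), card_shuffles (by omega), Nat.choose_succ_succ'] at h1
  omega

/-- A shuffle is increasing on each block, so the smallest value sits at the beginning of its block.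
-/
theorem shuffle_zero_left {σ : Equiv.Perm (Fin (N + 1))} (hσ : σ ∈ shuffles (k + 1) (N + 1))
    (h : 0 ∈ firstBlock (k + 1) σ) : σ 0 = 0 := by
  rw [mem_firstBlock] at h
  by_contra h0
  have h1 : σ.symm 0 ≠ 0 := fun h' => h0 (by rw [Equiv.symm_apply_eq] at h'; exact h'.symm)
  have := (mem_shuffles.mp hσ).1 0 (σ.symm 0) (Fin.pos_iff_ne_zero.mpr h1) h
  simp at this

theorem shuffle_zero_right {σ : Equiv.Perm (Fin (N + 1))} (hσ : σ ∈ shuffles k (N + 1))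
    (h : 0 ∉ firstBlock k σ) : (σ.symm 0 : ℕ) = k := by
  rw [mem_firstBlock, not_lt] at h
  by_contra h0
  have := (mem_shuffles.mp hσ).2 ⟨k, by omega⟩ (σ.symm 0)
    (by rw [Fin.lt_def]; simp; omega) le_rfl
  simp at this

end Shuffles

/-! ### Dependence of an insertion on the first block only. -/

section Blocks

variable {𝕜 M : Type*} [Field 𝕜] [AddCommGroup M] [Module 𝕜 M]

/-- Two permutations with the same first block differ by a permutation inside each block; symmetry
of `G` absorbs one, symmetry of `F` in its last arguments the other. -/
theorem insertFirst_comp_perm_eq {E : Submodule 𝕜 M} {n m N : ℕ} (h : n + m = N) {F : Mult 𝕜 M n}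
    {G : Mult 𝕜 M m} (hF : ∀ (σ : Equiv.Perm (Fin (n + 1))) (w : Fin (n + 1) → M),
      (∀ i, w i ∈ E) → F (w ∘ σ) = F w)
    (hG : ∀ (σ : Equiv.Perm (Fin (m + 1))) (w : Fin (m + 1) → M),
      (∀ i, w i ∈ E) → G (w ∘ σ) = G w)
    (hGE : ∀ w : Fin (m + 1) → M, (∀ i, w i ∈ E) → G w ∈ E) {w : Fin (N + 1) → M}
    (hw : ∀ i, w i ∈ E) {σ τ : Equiv.Perm (Fin (N + 1))}
    (hστ : firstBlock (m + 1) σ = firstBlock (m + 1) τ) :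
    insertFirst h F G (w ∘ σ) = insertFirst h F G (w ∘ τ) := by
  let e : Fin (m + 1) ⊕ Fin n ≃ Fin (N + 1) := finSumFinEquiv.trans (finCongr (by omega))
  have he : ∀ x : Fin (N + 1), (x : ℕ) < m + 1 → e.symm x ∈ Set.range Sum.inl := fun x hx =>
    ⟨⟨x, hx⟩, by rw [Equiv.eq_symm_apply]; ext; simp [e]⟩
  let ρ : Equiv.Perm (Fin (m + 1) ⊕ Fin n) := (e.trans (τ.trans σ.symm)).trans e.symm
  have hρ : ρ ∈ (Equiv.Perm.sumCongrHom (Fin (m + 1)) (Fin n)).range := by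
    refine Equiv.Perm.mem_sumCongrHom_range_of_perm_mapsTo_inl ?_
    rintro _ ⟨a, rfl⟩
    refine he _ ?_
    rw [Equiv.trans_apply, Equiv.trans_apply, ← mem_firstBlock, hστ, apply_mem_firstBlock]
    simpa [e] using Nat.lt_succ_iff.mp a.2
  obtain ⟨⟨β₁, β₂⟩, hβ⟩ := hρ
  have hτ : ∀ x, τ (e x) = σ (e (ρ x)) := fun x => by simp [ρ]
  have h1 : ∀ a, τ (e (Sum.inl a)) = σ (e (Sum.inl (β₁ a))) := fun a => by
    rw [hτ, ← hβ]; rfl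
  have h2 : ∀ b, τ (e (Sum.inr b)) = σ (e (Sum.inr (β₂ b))) := fun b => by
    rw [hτ, ← hβ]; rfl
  change F (Fin.cons (G fun a => w (σ (e (Sum.inl a)))) fun b => w (σ (e (Sum.inr b)))) =
    F (Fin.cons (G fun a => w (τ (e (Sum.inl a)))) fun b => w (τ (e (Sum.inr b))))
  simp only [h1, h2]
  have h3 := hG β₁ (fun a => w (σ (e (Sum.inl a)))) (fun a => hw _)
  have h4 := hF (Equiv.Perm.decomposeFin.symm (0, β₂))
    (Fin.cons (G fun a => w (σ (e (Sum.inl a)))) fun b => w (σ (e (Sum.inr b))))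
    (fun i => by
      refine Fin.cases ?_ (fun j => ?_) i
      · exact hGE _ fun _ => hw _
      · exact hw _)
  rw [← h4]
  congr 1
  funext i
  refine Fin.cases ?_ (fun j => ?_) i
  · simp only [Function.comp_apply, Equiv.Perm.decomposeFin_symm_apply_zero, Fin.cons_zero]
    exact h3.symm
  · simp

end Blocks

/-! ### The pre-Lie identity for the product `⊼`. -/

section PreLie

open TensorProduct Finset

/-- The tuple `(y, x, x, …)`. -/
def headTuple {M : Type*} {n : ℕ} (y x : M) : Fin n → M := fun i => if (i : ℕ) = 0 then y else x

theorem cons_const_eq_headTuple {M : Type*} {n : ℕ} (y x : M) :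
    (Fin.cons y (fun _ => x) : Fin (n + 1) → M) = headTuple y x := by
  funext i
  refine Fin.cases ?_ (fun j => ?_) i <;> simp [headTuple]

theorem headTuple_mem {𝕜 M : Type*} [Field 𝕜] [AddCommGroup M] [Module 𝕜 M] {E : Submodule 𝕜 M}
    {n : ℕ} {y x : M} (hy : y ∈ E) (hx : x ∈ E) (i : Fin n) : headTuple y x i ∈ E := by
  rw [headTuple]
  split_ifs
  · exact hy
  · exact hx

variable {𝕜 V : Type*} [Field 𝕜] [AddCommGroup V] [Module 𝕜 V]
variable (𝒱 : ZMod 2 → Submodule 𝕜 V)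

theorem HasParity.insertFirst {n m N : ℕ} (h : n + m = N) {f : Mult 𝕜 V n} {g : Mult 𝕜 V m}
    {p q : ZMod 2} (hf : HasParity 𝒱 p f) (hg : HasParity 𝒱 q g) :
    HasParity 𝒱 (p + q) (insertFirst h f g) := by
  subst h
  intro d v hv
  rw [insertFirst_apply]
  have h1 := hg (fun i : Fin (m + 1) => d ⟨i, by omega⟩) (fun i => v ⟨i, by omega⟩)
    (fun i => hv _)
  have h2 := hf (Fin.cons (q + ∑ i : Fin (m + 1), d ⟨i, by omega⟩)
    (fun j : Fin n => d ⟨m + 1 + j, by omega⟩))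
    (Fin.cons (g fun i : Fin (m + 1) => v ⟨i, by omega⟩)
      (fun j : Fin n => v ⟨m + 1 + j, by omega⟩)) (fun i => by
      refine Fin.cases ?_ (fun j => ?_) i
      · exact h1
      · exact hv _)
  convert h2 using 2
  rw [Fin.sum_cons]
  have h3 : ∑ i, d i = ∑ i : Fin (m + 1), d ⟨i, by omega⟩ +
      ∑ j : Fin n, d ⟨m + 1 + j, by omega⟩ := by
    rw [← (finCongr (show m + 1 + n = n + m + 1 by omega)).sum_comp, Fin.sum_univ_add]
    rfl
  rw [h3]
  ring

variable [DirectSum.Decomposition 𝒱]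

theorem HasParity.nrProd {n m N : ℕ} (h : n + m = N) {f : Mult 𝕜 V n} {g : Mult 𝕜 V m}
    {p q : ZMod 2} (hf : HasParity 𝒱 p f) (hg : HasParity 𝒱 q g) :
    HasParity 𝒱 (p + q) (nrProd 𝒱 h f g) :=
  HasParity.sum 𝒱 fun σ _ => (HasParity.insertFirst 𝒱 h hf hg).koszulPerm 𝒱 σ

section Abstract

variable {Λ : Type*} [Ring Λ] [Algebra 𝕜 Λ] (ℒ : ZMod 2 → Submodule 𝕜 Λ)

theorem env_nrProd (hℒ : IsSupercomm ℒ) {n m N : ℕ} (h : n + m = N) (f : Mult 𝕜 V n)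
    (g : Mult 𝕜 V m) (η ζ : Λ) {w : Fin (N + 1) → V ⊗[𝕜] Λ} (hw : ∀ i, w i ∈ evenSpan 𝒱 ℒ) :
    env (nrProd 𝒱 h f g) (η * ζ) w =
      ∑ σ ∈ shuffles (m + 1) (N + 1), insertFirst h (env f η) (env g ζ) (w ∘ σ) := by
  rw [nrProd, env_sum, _root_.sum_apply]
  refine sum_congr rfl fun σ _ => ?_
  rw [env_koszulPerm 𝒱 ℒ hℒ σ _ _ hw, env_insertFirst]

theorem env_nrProd_diag (hℒ : IsSupercomm ℒ) {n m N : ℕ} (h : n + m = N) (f : Mult 𝕜 V n)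
    (g : Mult 𝕜 V m) (η ζ : Λ) {x : V ⊗[𝕜] Λ} (hx : x ∈ evenSpan 𝒱 ℒ) :
    env (nrProd 𝒱 h f g) (η * ζ) (fun _ => x) =
      (N + 1).choose (m + 1) • env f η (headTuple (env g ζ fun _ => x) x) := by
  have h1 : ∀ σ : Equiv.Perm (Fin (N + 1)), insertFirst h (env f η) (env g ζ)
      ((fun _ : Fin (N + 1) => x) ∘ σ) = env f η (headTuple (env g ζ fun _ => x) x) := fun σ => by
    rw [insertFirst_apply, ← cons_const_eq_headTuple]
    rfl
  rw [env_nrProd 𝒱 ℒ hℒ h f g η ζ fun _ => hx, sum_congr rfl fun σ _ => h1 σ, sum_const,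
    card_shuffles (by omega)]

/-- The shuffles split according to whether the exceptional argument `y` is fed to `g` or stays with
`f`. By the shuffle condition it is then first in its block. -/
theorem env_nrProd_headTuple (hℒ : IsSupercomm ℒ) {n m N : ℕ} (h : n + m = N) (f : Mult 𝕜 V n)
    (g : Mult 𝕜 V m) (η ζ : Λ) {y x : V ⊗[𝕜] Λ} (hy : y ∈ evenSpan 𝒱 ℒ)
    (hx : x ∈ evenSpan 𝒱 ℒ) :
    env (nrProd 𝒱 h f g) (η * ζ) (headTuple y x) =
      N.choose m • env f η (headTuple (env g ζ (headTuple y x)) x) +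
      N.choose (m + 1) • env f η (Fin.cons (env g ζ fun _ => x) (headTuple y x)) := by
  rw [env_nrProd 𝒱 ℒ hℒ h f g η ζ (headTuple_mem hy hx),
    ← sum_filter_add_sum_filter_not _ (fun σ => 0 ∈ firstBlock (m + 1) σ)]
  congr 1
  · rw [← card_shuffles_zero_left (show m ≤ N by omega), ← sum_const]
    refine sum_congr rfl fun σ hσ => ?_
    rw [mem_filter] at hσ
    have h0 := shuffle_zero_left hσ.1 hσ.2
    have h1 : ∀ i, (σ i : ℕ) = 0 ↔ (i : ℕ) = 0 := fun i => by
      rw [Fin.val_eq_zero_iff, Fin.val_eq_zero_iff]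
      exact ⟨fun h => σ.injective (h.trans h0.symm), fun h => h ▸ h0⟩
    rw [insertFirst_apply, ← cons_const_eq_headTuple (env g ζ (headTuple y x)) x]
    have ha : (fun i : Fin (m + 1) => (headTuple y x ∘ σ) ⟨i, by omega⟩) = headTuple y x := by
      funext i
      simp only [Function.comp_apply, headTuple, h1]
    have hb : (fun j : Fin n => (headTuple y x ∘ σ) ⟨m + 1 + j, by omega⟩) = fun _ => x := by
      funext j
      simp only [Function.comp_apply, headTuple, h1]
      exact if_neg (by omega)
    rw [ha, hb]
  · rw [← card_shuffles_zero_right (show m + 1 ≤ N + 1 by omega), ← sum_const]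
    refine sum_congr rfl fun σ hσ => ?_
    rw [mem_filter] at hσ
    have h0 := shuffle_zero_right hσ.1 hσ.2
    have h1 : ∀ i, (σ i : ℕ) = 0 ↔ (i : ℕ) = m + 1 := fun i => by
      rw [Fin.val_eq_zero_iff, ← h0, ← Fin.ext_iff]
      exact (Equiv.eq_symm_apply σ).symm
    rw [insertFirst_apply]
    have ha : (fun i : Fin (m + 1) => (headTuple y x ∘ σ) ⟨i, by omega⟩) = fun _ => x := by
      funext i
      simp only [Function.comp_apply, headTuple, h1]
      exact if_neg (by omega)
    have hb : (fun j : Fin n => (headTuple y x ∘ σ) ⟨m + 1 + j, by omega⟩) = headTuple y x := by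
      funext j
      simp only [Function.comp_apply, headTuple, h1, Nat.add_eq_left]
    rw [ha, hb]

variable [SetLike.GradedMonoid ℒ]

theorem env_nrProd_comp_perm (hℒ : IsSupercomm ℒ) {n m N : ℕ} (h : n + m = N) {f : Mult 𝕜 V n}
    {g : Mult 𝕜 V m} (hf : f ∈ symMult 𝒱 n) (hg : g ∈ symMult 𝒱 m) {q : ZMod 2}
    (hgq : HasParity 𝒱 q g) (η : Λ) {ζ : Λ} (hζ : ζ ∈ ℒ q) (τ : Equiv.Perm (Fin (N + 1)))
    {w : Fin (N + 1) → V ⊗[𝕜] Λ} (hw : ∀ i, w i ∈ evenSpan 𝒱 ℒ) :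
    env (nrProd 𝒱 h f g) (η * ζ) (w ∘ τ) = env (nrProd 𝒱 h f g) (η * ζ) w := by
  rw [env_nrProd 𝒱 ℒ hℒ h f g η ζ hw,
    env_nrProd 𝒱 ℒ hℒ h f g η ζ (w := w ∘ τ) fun i => hw _]
  exact sum_shuffles_mul_left (show m + 1 ≤ N + 1 by omega)
    (fun σ => insertFirst h (env f η) (env g ζ) (w ∘ σ))
    (fun σ σ' hσ => insertFirst_comp_perm_eq h
      (fun σ w hw => env_comp_perm 𝒱 ℒ hℒ hf σ η hw)
      (fun σ w hw => env_comp_perm 𝒱 ℒ hℒ hg σ ζ hw)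
      (fun w hw => env_mem_evenSpan 𝒱 ℒ hgq hζ hw) hw hσ) τ

end Abstract

/-- Only `g` needs a parity: its value is inserted into `f` and must remain in the even part. -/
theorem nrProd_mem_symMult_of_hasParity {n m N : ℕ} (h : n + m = N) {f : Mult 𝕜 V n}
    {g : Mult 𝕜 V m} (hf : f ∈ symMult 𝒱 n) (hg : g ∈ symMult 𝒱 m) {q : ZMod 2}
    (hgq : HasParity 𝒱 q g) : nrProd 𝒱 h f g ∈ symMult 𝒱 N := by
  refine mem_symMult_of_koszulPerm 𝒱 fun τ => eq_of_env_eq 𝒱 0 q fun ζ _ ξ hξ w hw => ?_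
  rw [env_koszulPerm 𝒱 _ (isSupercomm_grassmannGrading 𝕜) τ _ _ hw,
    env_nrProd_comp_perm 𝒱 _ (isSupercomm_grassmannGrading 𝕜) h hf hg hgq ζ hξ τ hw]

theorem eq_of_env_diag_eq [CharZero 𝕜] {n : ℕ} {f g : Mult 𝕜 V n} (hf : f ∈ symMult 𝒱 n)
    (hg : g ∈ symMult 𝒱 n) (q r : ZMod 2)
    (h : ∀ ζ ∈ grassmannGrading 𝕜 q, ∀ ξ ∈ grassmannGrading 𝕜 r,
      ∀ x ∈ evenSpan 𝒱 (grassmannGrading 𝕜),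
        env f (ζ * ξ) (fun _ => x) = env g (ζ * ξ) (fun _ => x)) : f = g := by
  refine eq_of_env_eq 𝒱 q r fun ζ hζ ξ hξ w hw => ?_
  have hfg := sub_mem hf hg
  rw [← sub_eq_zero, ← _root_.sub_apply, ← env_sub]
  refine MultilinearMap.eq_zero_of_diagonal (G := evenSpan 𝒱 (grassmannGrading 𝕜))
    (fun σ w hw => env_comp_perm 𝒱 _ (isSupercomm_grassmannGrading 𝕜) hfg σ _ hw)
    (fun x hx => ?_) hw
  rw [env_sub, _root_.sub_apply, h ζ hζ ξ hξ x hx, sub_self]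

/-- Both sides are the multinomial `(n+m+l+1)! / ((l+1)! m! n!)`. -/
theorem choose_assoc_left (n m l : ℕ) :
    (n + m + l + 1).choose (l + 1) * (n + m).choose m =
      (n + m + l + 1).choose (m + l + 1) * (m + l + 1).choose (l + 1) := by
  have h1 := Nat.choose_mul (n := n + m + l + 1) (k := m + l + 1) (s := l + 1) (by omega)
  rw [h1]
  congr 2 <;> omega

/-- For `n ≥ 1` both sides are `(n+m+l+1)! / ((l+1)! (m+1)! (n-1)!)`, which is symmetric in `m` and
`l`; for `n = 0` both vanish. -/
theorem choose_assoc_right (n m l : ℕ) :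
    (n + m + l + 1).choose (l + 1) * (n + m).choose (m + 1) =
      (n + m + l + 1).choose (m + 1) * (n + l).choose (l + 1) := by
  rcases n with _ | n
  · rw [zero_add, zero_add, Nat.choose_succ_self, Nat.choose_succ_self, mul_zero, mul_zero]
  · have h1 := Nat.choose_mul (n := n + 1 + m + l + 1) (k := m + 1 + (l + 1)) (s := l + 1)
      (by omega)
    have h2 := Nat.choose_mul (n := n + 1 + m + l + 1) (k := m + 1 + (l + 1)) (s := m + 1)
      (by omega)
    rw [Nat.choose_symm_add (a := m + 1) (b := l + 1), h1] at h2
    convert h2 using 3 <;> omega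

variable [CharZero 𝕜]

theorem nrProd_preLie {n m l a b c N : ℕ} (h₁ : n + m = a) (h₂ : a + l = N) (h₃ : m + l = b)
    (h₄ : n + b = N) (h₅ : n + l = c) (h₆ : c + m = N) (h₇ : l + m = b) {f : Mult 𝕜 V n}
    {g : Mult 𝕜 V m} {k : Mult 𝕜 V l} (hf : f ∈ symMult 𝒱 n) (hg : g ∈ symMult 𝒱 m)
    (hk : k ∈ symMult 𝒱 l) {q r : ZMod 2} (hgq : HasParity 𝒱 q g) (hkr : HasParity 𝒱 r k) :
    nrProd 𝒱 h₂ (nrProd 𝒱 h₁ f g) k - nrProd 𝒱 h₄ f (nrProd 𝒱 h₃ g k) =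
      paritySign q r •
        (nrProd 𝒱 h₆ (nrProd 𝒱 h₅ f k) g - nrProd 𝒱 h₄ f (nrProd 𝒱 h₇ k g)) := by
  have hS : ∀ {n m l a b N : ℕ} (h₁ : n + m = a) (h₂ : a + l = N) (h₃ : m + l = b)
      (h₄ : n + b = N) {f : Mult 𝕜 V n} {g : Mult 𝕜 V m} {k : Mult 𝕜 V l} (_ : f ∈ symMult 𝒱 n)
      (_ : g ∈ symMult 𝒱 m) (_ : k ∈ symMult 𝒱 l) {q r : ZMod 2} (_ : HasParity 𝒱 q g)
      (_ : HasParity 𝒱 r k),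
      nrProd 𝒱 h₂ (nrProd 𝒱 h₁ f g) k - nrProd 𝒱 h₄ f (nrProd 𝒱 h₃ g k) ∈ symMult 𝒱 N :=
    fun h₁ h₂ h₃ h₄ _ _ _ hf hg hk _ _ hgq hkr => sub_mem
      (nrProd_mem_symMult_of_hasParity 𝒱 h₂
        (nrProd_mem_symMult_of_hasParity 𝒱 h₁ hf hg hgq) hk hkr)
      (nrProd_mem_symMult_of_hasParity 𝒱 h₄ hf
        (nrProd_mem_symMult_of_hasParity 𝒱 h₃ hg hk hkr) (HasParity.nrProd 𝒱 h₃ hgq hkr))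
  have hℒ := isSupercomm_grassmannGrading 𝕜
  -- The associator on the diagonal: the terms with `k` nested inside `g` cancel by
  -- `choose_assoc_left`, leaving those where `f` takes the values of `g` and `k` in separate
  -- arguments.
  have key : ∀ {n m l a b N : ℕ} (h₁ : n + m = a) (h₂ : a + l = N) (h₃ : m + l = b)
      (h₄ : n + b = N) {f : Mult 𝕜 V n} {g : Mult 𝕜 V m} {k : Mult 𝕜 V l} {r : ZMod 2}
      (_ : HasParity 𝒱 r k) (ζ : Grassmann 𝕜) {ξ : Grassmann 𝕜} (_ : ξ ∈ grassmannGrading 𝕜 r)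
      {x : V ⊗[𝕜] Grassmann 𝕜} (_ : x ∈ evenSpan 𝒱 (grassmannGrading 𝕜)),
      env (nrProd 𝒱 h₂ (nrProd 𝒱 h₁ f g) k - nrProd 𝒱 h₄ f (nrProd 𝒱 h₃ g k)) (ζ * ξ)
        (fun _ => x) = ((N + 1).choose (l + 1) * a.choose (m + 1)) •
          env f (1 : Grassmann 𝕜) (Fin.cons (env g ζ fun _ => x)
            (headTuple (env k ξ fun _ => x) x)) := by
    intro n m l a b N h₁ h₂ h₃ h₄ f g k r hkr ζ ξ hξ x hx
    have hkx := env_mem_evenSpan 𝒱 (grassmannGrading 𝕜) hkr hξ (w := fun _ => x) fun _ => hx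
    have e1 := env_nrProd_diag 𝒱 _ hℒ h₂ (nrProd 𝒱 h₁ f g) k (1 * ζ) ξ hx
    have e2 := env_nrProd_headTuple 𝒱 _ hℒ h₁ f g 1 ζ hkx hx
    have e3 := env_nrProd_diag 𝒱 _ hℒ h₄ f (nrProd 𝒱 h₃ g k) 1 (ζ * ξ) hx
    have e4 := env_nrProd_diag 𝒱 _ hℒ h₃ g k ζ ξ hx
    have e5 : ∀ (c : ℕ) (y : V ⊗[𝕜] Grassmann 𝕜),
        env f (1 : Grassmann 𝕜) (headTuple (c • y) x) = c • env f 1 (headTuple y x) := by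
      intro c y
      rw [← cons_const_eq_headTuple, ← cons_const_eq_headTuple, ← Nat.cast_smul_eq_nsmul 𝕜,
        ← Nat.cast_smul_eq_nsmul 𝕜]
      exact MultilinearMap.cons_smul _ _ _ _
    rw [e2, one_mul] at e1
    rw [e4, one_mul, e5] at e3
    rw [env_sub, _root_.sub_apply, e1, e3, smul_add, smul_smul, smul_smul, smul_smul]
    subst h₁ h₂ h₃
    rw [choose_assoc_left, add_sub_cancel_left]
  refine eq_of_env_diag_eq 𝒱 (hS h₁ h₂ h₃ h₄ hf hg hk hgq hkr)
    (zsmul_mem (hS h₅ h₆ h₇ h₄ hf hk hg hkr hgq) _) q r fun ζ hζ ξ hξ x hx => ?_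
  rw [key h₁ h₂ h₃ h₄ hkr ζ hξ hx, hℒ q r ζ ξ hζ hξ, env_zsmul_right, env_zsmul, smul_smul,
    paritySign_mul_self, one_smul, key h₅ h₆ h₇ h₄ hgq ξ hζ hx]
  have hgx := env_mem_evenSpan 𝒱 (grassmannGrading 𝕜) hgq hζ (w := fun _ => x) fun _ => hx
  have hkx := env_mem_evenSpan 𝒱 (grassmannGrading 𝕜) hkr hξ (w := fun _ => x) fun _ => hx
  subst h₁ h₂ h₅
  have hc := choose_assoc_right n m l
  -- If `f` has a single argument it cannot take both values, and both coefficients are 0.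
  rcases n with _ | n
  · rw [show (0 + m).choose (m + 1) = 0 by simp, show (0 + l).choose (l + 1) = 0 by simp,
      mul_zero, mul_zero, zero_smul, zero_smul]
  · rw [hc]
    congr 1
    rw [← cons_const_eq_headTuple, ← cons_const_eq_headTuple]
    -- The values of `g` and `k` are exchanged by the symmetry of `f` in its first two arguments.
    rw [← env_comp_perm 𝒱 _ hℒ hf (Equiv.swap 0 1) 1]
    · congr 1
      funext i
      refine Fin.cases ?_ (fun j => Fin.cases ?_ (fun j => ?_) j) i
      · simp
      · simp
      · rw [Function.comp_apply, Equiv.swap_apply_of_ne_of_ne (Fin.succ_ne_zero _) (by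
          simp [Fin.ext_iff])]
        simp
    · intro i
      refine Fin.cases ?_ (fun j => Fin.cases ?_ (fun j => ?_) j) i
      · simpa using hgx
      · simpa using hkx
      · simpa using hx

end PreLie

/-! ### The Nijenhuis–Richardson bracket and its Jacobi identity. -/

section Bracket

open Finset

variable {𝕜 V : Type*} [Field 𝕜] [AddCommGroup V] [Module 𝕜 V]
variable (𝒱 : ZMod 2 → Submodule 𝕜 V) [DirectSum.Decomposition 𝒱]

theorem nrProd_zero_left {n m N : ℕ} (h : n + m = N) (g : Mult 𝕜 V m) :
    nrProd 𝒱 h (0 : Mult 𝕜 V n) g = 0 := by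
  simpa using nrProd_smul_left 𝒱 h 0 (0 : Mult 𝕜 V n) g

theorem nrProd_zero_right {n m N : ℕ} (h : n + m = N) (f : Mult 𝕜 V n) :
    nrProd 𝒱 h f (0 : Mult 𝕜 V m) = 0 := by
  simpa using nrProd_smul_right 𝒱 h 0 f (0 : Mult 𝕜 V m)

theorem nrProd_zsmul_left {n m N : ℕ} (h : n + m = N) (c : ℤ) (f : Mult 𝕜 V n) (g : Mult 𝕜 V m) :
    nrProd 𝒱 h (c • f) g = c • nrProd 𝒱 h f g :=
  map_zsmul (AddMonoidHom.mk' (fun f => nrProd 𝒱 h f g) (fun f f' => nrProd_add_left 𝒱 h f f' g))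
    c f

theorem nrProd_zsmul_right {n m N : ℕ} (h : n + m = N) (c : ℤ) (f : Mult 𝕜 V n)
    (g : Mult 𝕜 V m) : nrProd 𝒱 h f (c • g) = c • nrProd 𝒱 h f g :=
  map_zsmul (AddMonoidHom.mk' (nrProd 𝒱 h f) (nrProd_add_right 𝒱 h f)) c g

theorem nrProd_sub_left {n m N : ℕ} (h : n + m = N) (f f' : Mult 𝕜 V n) (g : Mult 𝕜 V m) :
    nrProd 𝒱 h (f - f') g = nrProd 𝒱 h f g - nrProd 𝒱 h f' g :=
  map_sub (AddMonoidHom.mk' (fun f => nrProd 𝒱 h f g) (fun f f' => nrProd_add_left 𝒱 h f f' g))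
    f f'

theorem nrProd_sub_right {n m N : ℕ} (h : n + m = N) (f : Mult 𝕜 V n) (g g' : Mult 𝕜 V m) :
    nrProd 𝒱 h f (g - g') = nrProd 𝒱 h f g - nrProd 𝒱 h f g' :=
  map_sub (AddMonoidHom.mk' (nrProd 𝒱 h f) (nrProd_add_right 𝒱 h f)) g g'

theorem nrBracket_eq_of_hasParity {n m N : ℕ} (h : n + m = N) (h' : m + n = N) {f : Mult 𝕜 V n}
    {g : Mult 𝕜 V m} {p q : ZMod 2} (hf : HasParity 𝒱 p f) (hg : HasParity 𝒱 q g) :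
    nrBracket 𝒱 h f g = nrProd 𝒱 h f g - paritySign p q • nrProd 𝒱 h' g f := by
  rw [nrBracket, sum_eq_single p, sum_eq_single q]
  · rw [hf.parityPart_eq, hg.parityPart_eq, if_pos rfl, if_pos rfl]
  · intro b _ hb
    rw [hg.parityPart_eq, if_neg hb, nrProd_zero_left, nrProd_zero_right, smul_zero, sub_zero]
  · simp
  · intro b _ hb
    refine sum_eq_zero fun c _ => ?_
    rw [hf.parityPart_eq, if_neg hb, nrProd_zero_left, nrProd_zero_right, smul_zero, sub_zero]
  · simp

theorem nrBracket_add_left {n m N : ℕ} (h : n + m = N) (f f' : Mult 𝕜 V n) (g : Mult 𝕜 V m) :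
    nrBracket 𝒱 h (f + f') g = nrBracket 𝒱 h f g + nrBracket 𝒱 h f' g := by
  simp only [nrBracket, ← sum_add_distrib]
  refine sum_congr rfl fun p _ => sum_congr rfl fun q _ => ?_
  rw [parityPart_add, nrProd_add_right, nrProd_add_left, smul_add]
  abel

theorem nrBracket_smul_left {n m N : ℕ} (h : n + m = N) (c : 𝕜) (f : Mult 𝕜 V n)
    (g : Mult 𝕜 V m) : nrBracket 𝒱 h (c • f) g = c • nrBracket 𝒱 h f g := by
  simp only [nrBracket, smul_sum]
  refine sum_congr rfl fun p _ => sum_congr rfl fun q _ => ?_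
  rw [parityPart_smul, nrProd_smul_right, nrProd_smul_left, smul_sub, smul_comm c]

theorem nrBracket_zero_right {n m N : ℕ} (h : n + m = N) (f : Mult 𝕜 V n) :
    nrBracket 𝒱 h f (0 : Mult 𝕜 V m) = 0 := by
  simpa using nrBracket_smul_right 𝒱 h 0 f (0 : Mult 𝕜 V m)

theorem nrBracket_sum_right {ι : Type*} (s : Finset ι) {n m N : ℕ} (h : n + m = N)
    (f : Mult 𝕜 V n) (g : ι → Mult 𝕜 V m) :
    nrBracket 𝒱 h f (∑ i ∈ s, g i) = ∑ i ∈ s, nrBracket 𝒱 h f (g i) :=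
  map_sum (AddMonoidHom.mk' (nrBracket 𝒱 h f) (nrBracket_add_right 𝒱 h f)) g s

theorem nrBracket_sum_left {ι : Type*} (s : Finset ι) {n m N : ℕ} (h : n + m = N)
    (f : ι → Mult 𝕜 V n) (g : Mult 𝕜 V m) :
    nrBracket 𝒱 h (∑ i ∈ s, f i) g = ∑ i ∈ s, nrBracket 𝒱 h (f i) g :=
  map_sum (AddMonoidHom.mk' (fun f => nrBracket 𝒱 h f g)
    (fun f f' => nrBracket_add_left 𝒱 h f f' g)) f s

theorem HasParity.nrBracket {n m N : ℕ} (h : n + m = N) {f : Mult 𝕜 V n} {g : Mult 𝕜 V m}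
    {p q : ZMod 2} (hf : HasParity 𝒱 p f) (hg : HasParity 𝒱 q g) :
    HasParity 𝒱 (p + q) (nrBracket 𝒱 h f g) := by
  have h' : m + n = N := by omega
  rw [nrBracket_eq_of_hasParity 𝒱 h h' hf hg]
  intro d v hv
  refine sub_mem (HasParity.nrProd 𝒱 h hf hg d v hv) (zsmul_mem ?_ _)
  rw [add_comm p q]
  exact HasParity.nrProd 𝒱 h' hg hf d v hv

theorem nrBracket_mem_symMult {n m N : ℕ} (h : n + m = N) {f : Mult 𝕜 V n} {g : Mult 𝕜 V m}
    (hf : f ∈ symMult 𝒱 n) (hg : g ∈ symMult 𝒱 m) : nrBracket 𝒱 h f g ∈ symMult 𝒱 N := by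
  refine sum_mem fun p _ => sum_mem fun q _ => ?_
  have hf' := parityPart_mem_symMult 𝒱 p hf
  have hg' := parityPart_mem_symMult 𝒱 q hg
  exact sub_mem
    (nrProd_mem_symMult_of_hasParity 𝒱 h hf' hg' (hasParity_parityPart 𝒱 q g))
    (zsmul_mem (nrProd_mem_symMult_of_hasParity 𝒱 _ hg' hf' (hasParity_parityPart 𝒱 p f)) _)

variable [CharZero 𝕜]

/-- The commutator of a pre-Lie product satisfies the Jacobi identity. An even first entry suffices,
since it will be `μ_n`. -/
theorem nrBracket_jacobi_of_even {n m l a b c N : ℕ} (h₁ : m + l = a) (h₂ : n + a = N)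
    (h₃ : n + m = b) (h₄ : b + l = N) (h₅ : n + l = c) (h₆ : m + c = N) {f : Mult 𝕜 V n}
    {g : Mult 𝕜 V m} {k : Mult 𝕜 V l} (hf : f ∈ symMult 𝒱 n) (hg : g ∈ symMult 𝒱 m)
    (hk : k ∈ symMult 𝒱 l) (hf0 : HasParity 𝒱 0 f) :
    nrBracket 𝒱 h₂ f (nrBracket 𝒱 h₁ g k) =
      nrBracket 𝒱 h₄ (nrBracket 𝒱 h₃ f g) k + nrBracket 𝒱 h₆ g (nrBracket 𝒱 h₅ f k) := by
  have hom : ∀ {g : Mult 𝕜 V m} {k : Mult 𝕜 V l} {q r : ZMod 2} (_ : g ∈ symMult 𝒱 m)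
      (_ : k ∈ symMult 𝒱 l) (_ : HasParity 𝒱 q g) (_ : HasParity 𝒱 r k),
      nrBracket 𝒱 h₂ f (nrBracket 𝒱 h₁ g k) =
        nrBracket 𝒱 h₄ (nrBracket 𝒱 h₃ f g) k + nrBracket 𝒱 h₆ g (nrBracket 𝒱 h₅ f k) := by
    intro g k q r hg hk hgq hkr
    have hgk := HasParity.nrBracket 𝒱 h₁ hgq hkr
    have hfg := HasParity.nrBracket 𝒱 h₃ hf0 hgq
    have hfk := HasParity.nrBracket 𝒱 h₅ hf0 hkr
    rw [zero_add] at hfg hfk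
    have e₁ : l + m = a := by omega
    have e₂ : a + n = N := by omega
    have e₃ : m + n = b := by omega
    have e₄ : l + b = N := by omega
    have e₅ : l + n = c := by omega
    have e₆ : c + m = N := by omega
    have p1 := nrProd_preLie 𝒱 h₃ h₄ h₁ h₂ h₅ e₆ e₁ hf hg hk hgq hkr
    have p2 := nrProd_preLie 𝒱 e₃ h₄ h₅ h₆ h₁ e₂ e₅ hg hf hk hf0 hkr
    have p3 := nrProd_preLie 𝒱 e₅ e₆ h₃ e₄ e₁ e₂ e₃ hk hf hg hf0 hgq
    rw [nrBracket_eq_of_hasParity 𝒱 h₂ e₂ hf0 hgk, nrBracket_eq_of_hasParity 𝒱 h₁ e₁ hgq hkr,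
      nrBracket_eq_of_hasParity 𝒱 h₄ e₄ hfg hkr, nrBracket_eq_of_hasParity 𝒱 h₃ e₃ hf0 hgq,
      nrBracket_eq_of_hasParity 𝒱 h₆ e₆ hgq hfk, nrBracket_eq_of_hasParity 𝒱 h₅ e₅ hf0 hkr]
    simp only [nrProd_sub_left, nrProd_sub_right, nrProd_zsmul_left, nrProd_zsmul_right,
      paritySign_zero_left, one_smul] at p1 p2 p3 ⊢
    -- The pre-Lie identities used have `f`, `g` and `k` in turn as the outer map.
    linear_combination (norm := module) (-1 : ℤ) • p1 + p2 - paritySign q r • p3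
  rw [← sum_parityPart 𝒱 g, ← sum_parityPart 𝒱 k]
  simp only [nrBracket_sum_left, nrBracket_sum_right]
  rw [← sum_add_distrib]
  refine sum_congr rfl fun q _ => ?_
  rw [← sum_add_distrib]
  refine sum_congr rfl fun r _ => ?_
  exact hom (parityPart_mem_symMult 𝒱 r hg) (parityPart_mem_symMult 𝒱 q hk)
    (hasParity_parityPart 𝒱 r g) (hasParity_parityPart 𝒱 q k)

end Bracket

/-! ### The symmetrized products and their brackets. -/

section Mu

open Finset TensorProduct

variable {𝕜 A : Type*} [Field 𝕜] [NonUnitalRing A] [Module 𝕜 A] [IsScalarTower 𝕜 A A]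
  [SMulCommClass 𝕜 A A]

theorem mulMap_const_congr (x : A) {a b : ℕ} (h : a = b) :
    mulMap 𝕜 A a (fun _ => x) = mulMap 𝕜 A b (fun _ => x) := by
  subst h
  rfl

/-- The law of exponents; in the absence of a unit, `mulMap 𝕜 A a (fun _ => x)` stands for
`x^(a+1)`. -/
theorem mulMap_const_mul (x : A) (a b : ℕ) :
    mulMap 𝕜 A a (fun _ => x) * mulMap 𝕜 A b (fun _ => x) =
      mulMap 𝕜 A (a + b + 1) (fun _ => x) := by
  induction a with
  | zero =>
    refine Eq.trans ?_ (mulMap_const_congr x (by omega : b + 1 = 0 + b + 1))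
    rw [mulMap_zero_apply, mulMap_succ_apply]
    rfl
  | succ a ih =>
    refine Eq.trans ?_ (mulMap_const_congr x (by omega : a + b + 1 + 1 = a + 1 + b + 1))
    rw [mulMap_succ_apply, mulMap_succ_apply, mul_assoc]
    exact congrArg (x * ·) ih

theorem mulMap_powers (x : A) (n : ℕ) (e : Fin (n + 1) → ℕ) :
    mulMap 𝕜 A n (fun i => mulMap 𝕜 A (e i) (fun _ => x)) =
      mulMap 𝕜 A (n + ∑ i, e i) (fun _ => x) := by
  induction n with
  | zero =>
    rw [mulMap_zero_apply]
    exact mulMap_const_congr x (by simp)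
  | succ n ih =>
    rw [mulMap_succ_apply]
    have h : Fin.tail (fun i => mulMap 𝕜 A (e i) (fun _ => x)) =
      fun i : Fin (n + 1) => mulMap 𝕜 A (e i.succ) (fun _ => x) := rfl
    rw [h, ih, mulMap_const_mul]
    refine mulMap_const_congr x ?_
    rw [Fin.sum_univ_succ e]
    ring

theorem mulMap_tmul {Λ : Type*} [Ring Λ] [Algebra 𝕜 Λ] (n : ℕ) (v : Fin (n + 1) → A)
    (l : Fin (n + 1) → Λ) :
    mulMap 𝕜 (A ⊗[𝕜] Λ) n (fun i => v i ⊗ₜ l i) = mulMap 𝕜 A n v ⊗ₜ (List.ofFn l).prod := by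
  induction n with
  | zero => simp [mulMap_zero_apply]
  | succ n ih =>
    rw [mulMap_succ_apply, mulMap_succ_apply, List.ofFn_succ, List.prod_cons]
    have h : Fin.tail (fun i => v i ⊗ₜ[𝕜] l i) =
      fun i : Fin (n + 1) => v i.succ ⊗ₜ[𝕜] l i.succ := rfl
    rw [h, ih (fun i => v i.succ) (fun i => l i.succ), Algebra.TensorProduct.tmul_mul_tmul]
    rfl

theorem env_mulMap {Λ : Type*} [Ring Λ] [Algebra 𝕜 Λ] (n : ℕ) :
    env (mulMap 𝕜 A n) (1 : Λ) = mulMap 𝕜 (A ⊗[𝕜] Λ) n :=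
  Mult.ext_tmul fun v l => by rw [env_tmul, mulMap_tmul, one_mul]

variable (𝒜 : ZMod 2 → Submodule 𝕜 A)

theorem mulMap_mem_symMult (h : ∀ (i j : ZMod 2) (a b : A), a ∈ 𝒜 i → b ∈ 𝒜 j →
    a * b = paritySign i j • (b * a)) (n : ℕ) : mulMap 𝕜 A n ∈ symMult 𝒜 n := by
  intro d v hv i
  induction n with
  | zero => exact i.elim0
  | succ n ih =>
    rw [mulMap_succ_apply, mulMap_succ_apply]
    refine Fin.cases ?_ (fun i => ?_) i
    · cases n with
      | zero =>
        rw [mulMap_zero_apply, mulMap_zero_apply]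
        simpa [Fin.tail] using h _ _ _ _ (hv 0) (hv 1)
      | succ n =>
        rw [mulMap_succ_apply, mulMap_succ_apply, ← mul_assoc, ← mul_assoc]
        have h1 := h _ _ _ _ (hv 0) (hv 1)
        have h2 : Fin.tail (Fin.tail (v ∘ Equiv.swap (Fin.castSucc 0) (Fin.succ 0))) =
            Fin.tail (Fin.tail v) := by
          funext j
          simp only [Fin.tail, Function.comp_apply]
          rw [Fin.castSucc_zero, Equiv.swap_apply_of_ne_of_ne (Fin.succ_ne_zero _)
            fun h => Fin.succ_ne_zero j (Fin.succ_injective _ h)]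
        rw [h2, ← smul_mul_assoc]
        congr 1
    · have h1 := ih (fun j => d j.succ) (Fin.tail v) (fun j => hv _) i
      have h2 : Fin.tail (v ∘ Equiv.swap i.succ.castSucc i.succ.succ) =
          Fin.tail v ∘ Equiv.swap i.castSucc i.succ := by
        funext j
        simp only [Fin.tail, Function.comp_apply, ← Fin.succ_castSucc]
        rw [(Fin.succ_injective (n + 1)).swap_apply]
      rw [h2, Function.comp_apply, Equiv.swap_apply_of_ne_of_ne (by simp [Fin.ext_iff])
        (Fin.succ_ne_zero _).symm, h1, mul_smul_comm]
      simp only [Fin.succ_castSucc]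

theorem hasParity_mulMap [SetLike.GradedMul 𝒜] (n : ℕ) : HasParity 𝒜 0 (mulMap 𝕜 A n) := by
  intro d v hv
  induction n with
  | zero => simpa [mulMap_zero_apply] using hv 0
  | succ n ih =>
    rw [mulMap_succ_apply, Fin.sum_univ_succ, zero_add]
    have := ih (fun j => d j.succ) (Fin.tail v) fun j => hv _
    rw [zero_add] at this
    exact SetLike.mul_mem_graded (hv 0) this

variable [DirectSum.Decomposition 𝒜]

theorem mu_mem_symMult (n : ℕ) : mu 𝒜 n ∈ symMult 𝒜 n := by
  refine Submodule.smul_mem _ _ (mem_symMult_of_koszulPerm 𝒜 fun τ => ?_)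
  rw [koszulPerm_sum]
  exact Fintype.sum_equiv (Equiv.mulLeft τ) _ _ fun σ => (koszulPerm_mul 𝒜 τ σ _).symm

theorem hasParity_mu [SetLike.GradedMul 𝒜] (n : ℕ) : HasParity 𝒜 0 (mu 𝒜 n) :=
  HasParity.smul 𝒜 (HasParity.sum 𝒜 fun σ _ => (hasParity_mulMap 𝒜 n).koszulPerm 𝒜 σ) _

theorem env_eq_scale {V Λ : Type*} [AddCommGroup V] [Module 𝕜 V] [Ring Λ] [Algebra 𝕜 Λ] {n : ℕ}
    (f : Mult 𝕜 V n) (η : Λ) (w : Fin (n + 1) → V ⊗[𝕜] Λ) :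
    env f η w = LinearMap.lTensor V (LinearMap.mulLeft 𝕜 η) (env f 1 w) := by
  rw [env, env, scaleMult_apply, scaleMult_apply, LinearMap.mulLeft_one, LinearMap.lTensor_id]
  rfl

theorem mu_zero : mu 𝒜 0 = ofLinear LinearMap.id := by
  have : Subsingleton (Equiv.Perm (Fin (0 + 1))) :=
    inferInstanceAs (Subsingleton (Equiv.Perm (Fin 1)))
  rw [mu, Fintype.sum_subsingleton _ 1, Nat.factorial_one, Nat.cast_one, inv_one, one_smul,
    koszulPerm_eq_self 𝒜 (fun _ _ _ i => i.elim0)]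
  rfl

variable [CharZero 𝕜]

theorem mu_eq_mulMap (h : ∀ (i j : ZMod 2) (a b : A), a ∈ 𝒜 i → b ∈ 𝒜 j →
    a * b = paritySign i j • (b * a)) (n : ℕ) : mu 𝒜 n = mulMap 𝕜 A n := by
  rw [mu, sum_congr rfl fun σ _ => koszulPerm_eq_self 𝒜 (mulMap_mem_symMult 𝒜 h n) σ, sum_const,
    card_univ, Fintype.card_perm, Fintype.card_fin, ← Nat.cast_smul_eq_nsmul 𝕜, smul_smul,
    inv_mul_cancel₀ (factorial_cast_ne_zero _), one_smul]

/-- Powers of one element commute, so all `(n+1)!` orderings give the same product. -/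
theorem env_mu_powers {Λ : Type*} [Ring Λ] [Algebra 𝕜 Λ] (ℒ : ZMod 2 → Submodule 𝕜 Λ)
    (hℒ : IsSupercomm ℒ) (n : ℕ) (x : A ⊗[𝕜] Λ) (e : Fin (n + 1) → ℕ)
    (he : ∀ i, mulMap 𝕜 (A ⊗[𝕜] Λ) (e i) (fun _ => x) ∈ evenSpan 𝒜 ℒ) :
    env (mu 𝒜 n) (1 : Λ) (fun i => mulMap 𝕜 (A ⊗[𝕜] Λ) (e i) (fun _ => x)) =
      mulMap 𝕜 (A ⊗[𝕜] Λ) (n + ∑ i, e i) (fun _ => x) := by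
  rw [mu, env_smul, env_sum, _root_.smul_apply, _root_.sum_apply,
    sum_congr rfl fun σ _ => env_koszulPerm 𝒜 ℒ hℒ σ (mulMap 𝕜 A n) 1 he]
  have h1 : ∀ σ : Equiv.Perm (Fin (n + 1)), env (mulMap 𝕜 A n) (1 : Λ)
      ((fun i => mulMap 𝕜 (A ⊗[𝕜] Λ) (e i) (fun _ => x)) ∘ σ) =
      mulMap 𝕜 (A ⊗[𝕜] Λ) (n + ∑ i, e i) (fun _ => x) := fun σ => by
    rw [env_mulMap, ← Equiv.sum_comp σ e]
    exact mulMap_powers x n (e ∘ σ)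
  rw [sum_congr rfl fun σ _ => h1 σ, sum_const, card_univ, Fintype.card_perm, Fintype.card_fin,
    ← Nat.cast_smul_eq_nsmul 𝕜, smul_smul, inv_mul_cancel₀ (factorial_cast_ne_zero _), one_smul]

/-- On the diagonal every shuffle contributes `μ_n(x^(m+1), x, …, x) = x^(n+m+1)`; the coefficient
counts the shuffles. -/
theorem nrProd_mu [SetLike.GradedMul 𝒜] {n m N : ℕ} (h : n + m = N) :
    nrProd 𝒜 h (mu 𝒜 n) (mu 𝒜 m) = ((N + 1).choose (m + 1) : 𝕜) • mu 𝒜 N := by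
  have hℒ := isSupercomm_grassmannGrading 𝕜
  refine eq_of_env_diag_eq 𝒜 (nrProd_mem_symMult_of_hasParity 𝒜 h (mu_mem_symMult 𝒜 n)
    (mu_mem_symMult 𝒜 m) (hasParity_mu 𝒜 m)) (Submodule.smul_mem _ _ (mu_mem_symMult 𝒜 N)) 0 0
    fun ζ _ ξ _ x hx => ?_
  have hpow : ∀ k, env (mu 𝒜 k) (1 : Grassmann 𝕜) (fun _ => x) =
      mulMap 𝕜 (A ⊗[𝕜] Grassmann 𝕜) k (fun _ => x) := fun k => by
    have := env_mu_powers 𝒜 _ hℒ k x (fun _ => 0) (fun _ => hx)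
    rw [sum_const_zero, add_zero] at this
    exact this
  have hmem : mulMap 𝕜 (A ⊗[𝕜] Grassmann 𝕜) m (fun _ => x) ∈
      evenSpan 𝒜 (grassmannGrading 𝕜) := by
    rw [← hpow]
    exact env_mem_evenSpan 𝒜 _ (hasParity_mu 𝒜 m) SetLike.GradedOne.one_mem fun _ => hx
  have h1 := env_nrProd_diag 𝒜 _ hℒ h (mu 𝒜 n) (mu 𝒜 m) 1 1 hx
  have h2 : (headTuple (mulMap 𝕜 (A ⊗[𝕜] Grassmann 𝕜) m fun _ => x) x :
      Fin (n + 1) → A ⊗[𝕜] Grassmann 𝕜) = fun i : Fin (n + 1) =>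
      mulMap 𝕜 (A ⊗[𝕜] Grassmann 𝕜) (if (i : ℕ) = 0 then m else 0) (fun _ => x) := by
    funext i
    rw [headTuple]
    by_cases hi : (i : ℕ) = 0
    · rw [if_pos hi]
      exact mulMap_const_congr x (if_pos hi).symm
    · rw [if_neg hi]
      exact Eq.trans (b := mulMap 𝕜 (A ⊗[𝕜] Grassmann 𝕜) 0 fun _ => x) rfl
        (mulMap_const_congr x (if_neg hi).symm)
  have h3 : ∀ i : Fin (n + 1), mulMap 𝕜 (A ⊗[𝕜] Grassmann 𝕜) (if (i : ℕ) = 0 then m else 0)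
      (fun _ => x) ∈ evenSpan 𝒜 (grassmannGrading 𝕜) := fun i => by
    by_cases hi : (i : ℕ) = 0
    · rw [mulMap_const_congr (𝕜 := 𝕜) (A := A ⊗[𝕜] Grassmann 𝕜) x (if_pos hi)]
      exact hmem
    · rw [mulMap_const_congr (𝕜 := 𝕜) (A := A ⊗[𝕜] Grassmann 𝕜) x (if_neg hi)]
      exact hx
  have h4 : n + ∑ i : Fin (n + 1), (if (i : ℕ) = 0 then m else 0) = N := by
    rw [Fin.sum_univ_succ]
    simpa using h
  rw [hpow, h2, env_mu_powers 𝒜 _ hℒ n x _ h3, mulMap_const_congr x h4, one_mul] at h1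
  -- The parameter `ζ * ξ` acts only by left multiplication on the values, so the case of parameter
  -- 1 suffices.
  rw [env_eq_scale, h1, env_eq_scale ((_ : 𝕜) • _), env_smul, _root_.smul_apply, hpow,
    Nat.cast_smul_eq_nsmul]

/-- The difference of the two binomials is `(N+1)! / ((n+1)! (m+1)!)` times `(n+1) - (m+1)`. -/
theorem nrBracket_mu [SetLike.GradedMul 𝒜] {n m N : ℕ} (h : n + m = N) :
    nrBracket 𝒜 h (mu 𝒜 n) (mu 𝒜 m) =
      (((n : 𝕜) - (m : 𝕜)) * ((Nat.factorial (N + 1) : 𝕜) /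
        ((Nat.factorial (n + 1) : 𝕜) * (Nat.factorial (m + 1) : 𝕜)))) • mu 𝒜 N := by
  rw [nrBracket_eq_of_hasParity 𝒜 h (by omega) (hasParity_mu 𝒜 n) (hasParity_mu 𝒜 m),
    paritySign_zero_left, one_smul, nrProd_mu, nrProd_mu, ← sub_smul]
  congr 1
  subst h
  rw [Nat.cast_choose 𝕜 (by omega), Nat.cast_choose 𝕜 (by omega),
    show n + m + 1 - (m + 1) = n by omega, show n + m + 1 - (n + 1) = m by omega,
    Nat.factorial_succ n, Nat.factorial_succ m]
  have h1 : (Nat.factorial n : 𝕜) ≠ 0 := factorial_cast_ne_zero n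
  have h2 : (Nat.factorial m : 𝕜) ≠ 0 := factorial_cast_ne_zero m
  have h3 : (n : 𝕜) + 1 ≠ 0 := by exact_mod_cast Nat.succ_ne_zero n
  have h4 : (m : 𝕜) + 1 ≠ 0 := by exact_mod_cast Nat.succ_ne_zero m
  push_cast
  field_simp
  ring

end Mu

/-! ### Formal sums of multilinear maps, their filtration and their bracket. -/

section Sequences

open Finset

variable {𝕜 V : Type*} [Field 𝕜] [AddCommGroup V] [Module 𝕜 V]

variable (𝕜 V) in
/-- The sequences whose members of index less than `K` vanish. -/
def seqFil (K : ℕ) : Submodule 𝕜 (MultSeq 𝕜 V) where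
  carrier := {x | ∀ n < K, x n = 0}
  add_mem' ha hb n hn := by rw [Pi.add_apply, ha n hn, hb n hn, add_zero]
  zero_mem' _ _ := rfl
  smul_mem' c x hx n hn := by rw [Pi.smul_apply, hx n hn, smul_zero]

theorem isSepFiltration_seqFil : IsSepFiltration (seqFil 𝕜 V) where
  anti _ _ h _ hx n hn := hx n (hn.trans_le h)
  zero := eq_top_iff.mpr fun _ _ n hn => absurd hn (Nat.not_lt_zero n)
  sep _ hx := funext fun n => hx (n + 1) n (Nat.lt_succ_self n)

/-- The exponential of an operator which raises the index. -/
def seqExp (D : MultSeq 𝕜 V →ₗ[𝕜] MultSeq 𝕜 V) : MultSeq 𝕜 V →ₗ[𝕜] MultSeq 𝕜 V :=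
  LinearMap.pi fun N =>
    ∑ k ∈ range (N + 1), ((Nat.factorial k : 𝕜)⁻¹) • (LinearMap.proj N ∘ₗ (D ^ k))

theorem seqExp_apply (D : MultSeq 𝕜 V →ₗ[𝕜] MultSeq 𝕜 V) (x : MultSeq 𝕜 V) (N : ℕ) :
    seqExp D x N = ∑ k ∈ range (N + 1), ((Nat.factorial k : 𝕜)⁻¹) • (D ^ k) x N := by
  simp only [seqExp, LinearMap.pi_apply, LinearMap.sum_apply, LinearMap.smul_apply,
    LinearMap.comp_apply, LinearMap.proj_apply]

theorem isFilteredExp_seqExp {D : MultSeq 𝕜 V →ₗ[𝕜] MultSeq 𝕜 V} (hD : Raises (seqFil 𝕜 V) D) :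
    IsFilteredExp (seqFil 𝕜 V) D (seqExp D) := by
  intro K x N hN
  rw [Pi.sub_apply, Finset.sum_apply, sub_eq_zero, seqExp_apply]
  refine sum_subset (range_subset_range.mpr hN) fun k _ hk => ?_
  rw [hD.pow_mem isSepFiltration_seqFil k x N (by simp at hk; omega), smul_zero]

/-- A linear map compatible with the filtrations is determined by sequences with one nonzero term;
identities for formal sums thus reduce to single degrees. -/
theorem eq_zero_of_single {M : Type*} [AddCommGroup M] [Module 𝕜 M] {F : ℕ → Submodule 𝕜 M}
    (hF : IsSepFiltration F) (T : MultSeq 𝕜 V →ₗ[𝕜] M) (hT : ∀ K, ∀ x ∈ seqFil 𝕜 V K, T x ∈ F K)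
    {x : MultSeq 𝕜 V} (h : ∀ n, T (Pi.single n (x n)) = 0) : T x = 0 := by
  refine hF.sep _ fun K => ?_
  have h1 : x - ∑ n ∈ range K, Pi.single n (x n) ∈ seqFil 𝕜 V K := by
    intro n hn
    rw [Pi.sub_apply, Finset.sum_apply, sum_eq_single n]
    · rw [Pi.single_eq_same, sub_self]
    · intro k _ hk
      exact Pi.single_eq_of_ne hk.symm _
    · intro hn'
      exact absurd (mem_range.mpr hn) hn'
  have h2 := hT K _ h1
  rwa [map_sub, map_sum, sum_eq_zero fun n _ => h n, sub_zero] at h2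

variable (𝒱 : ZMod 2 → Submodule 𝕜 V)

theorem mem_symSeq {x : MultSeq 𝕜 V} : x ∈ symSeq 𝒱 ↔ ∀ n, x n ∈ symMult 𝒱 n := by
  simp [symSeq]

theorem single_mem_symSeq {n : ℕ} {f : Mult 𝕜 V n} (hf : f ∈ symMult 𝒱 n) :
    (Pi.single n f : MultSeq 𝕜 V) ∈ symSeq 𝒱 := by
  rw [mem_symSeq]
  intro m
  rcases eq_or_ne m n with rfl | h
  · rwa [Pi.single_eq_same]
  · rw [Pi.single_eq_of_ne h]
    exact zero_mem _

theorem HasParity.single {n : ℕ} {f : Mult 𝕜 V n} {p : ZMod 2} (hf : HasParity 𝒱 p f) :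
    HasParitySeq 𝒱 p (Pi.single n f : MultSeq 𝕜 V) := by
  intro m
  rcases eq_or_ne m n with rfl | h
  · rwa [Pi.single_eq_same]
  · rw [Pi.single_eq_of_ne h]
    exact hasParity_zero 𝒱 p

theorem seqExp_mem_symSeq {D : MultSeq 𝕜 V →ₗ[𝕜] MultSeq 𝕜 V}
    (hD : ∀ x ∈ symSeq 𝒱, D x ∈ symSeq 𝒱) {x : MultSeq 𝕜 V} (hx : x ∈ symSeq 𝒱) :
    seqExp D x ∈ symSeq 𝒱 := by
  have h1 : ∀ k, (D ^ k) x ∈ symSeq 𝒱 := fun k => by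
    induction k with
    | zero => simpa using hx
    | succ k ih => rw [pow_succ', Module.End.mul_apply]; exact hD _ ih
  rw [mem_symSeq]
  intro N
  rw [seqExp_apply]
  exact sum_mem fun k _ => Submodule.smul_mem _ _ ((mem_symSeq 𝒱).mp (h1 k) N)

theorem HasParitySeq.seqExp {D : MultSeq 𝕜 V →ₗ[𝕜] MultSeq 𝕜 V} {p : ZMod 2}
    (hD : ∀ x, HasParitySeq 𝒱 p x → HasParitySeq 𝒱 p (D x)) {x : MultSeq 𝕜 V}
    (hp : HasParitySeq 𝒱 p x) : HasParitySeq 𝒱 p (seqExp D x) := by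
  have h1 : ∀ k, HasParitySeq 𝒱 p ((D ^ k) x) := fun k => by
    induction k with
    | zero => simpa using hp
    | succ k ih => rw [pow_succ', Module.End.mul_apply]; exact hD _ ih
  intro N
  rw [seqExp_apply]
  exact HasParity.sum 𝒱 fun k _ => HasParity.smul 𝒱 (h1 k N) _

/-- The exponential of an operator which raises the index and preserves the sequences of
supersymmetric maps is invertible on these sequences. -/
def seqExpEquiv [CharZero 𝕜] {D : MultSeq 𝕜 V →ₗ[𝕜] MultSeq 𝕜 V} (hD : Raises (seqFil 𝕜 V) D)
    (hS : ∀ x ∈ symSeq 𝒱, D x ∈ symSeq 𝒱) : symSeq 𝒱 ≃ₗ[𝕜] symSeq 𝒱 :=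
  have hD' : Raises (seqFil 𝕜 V) (-D) := fun K x hx => neg_mem (hD K x hx)
  LinearEquiv.ofLinearMap ((seqExp D).restrict fun _ => seqExp_mem_symSeq 𝒱 hS)
    ((seqExp (-D)).restrict fun _ => seqExp_mem_symSeq 𝒱 fun x hx => neg_mem (hS x hx))
    (LinearMap.ext fun x => Subtype.ext <|
      (isFilteredExp_seqExp hD).neg_comp isSepFiltration_seqFil hD (isFilteredExp_seqExp hD') _)
    (LinearMap.ext fun x => Subtype.ext <|
      (isFilteredExp_seqExp hD').neg_comp isSepFiltration_seqFil hD'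
        (E' := seqExp D) (by rw [neg_neg]; exact isFilteredExp_seqExp hD) _)

variable [DirectSum.Decomposition 𝒱]

/-- The Nijenhuis–Richardson bracket of formal sums as a bilinear map. -/
def seqBracketLin : MultSeq 𝕜 V →ₗ[𝕜] MultSeq 𝕜 V →ₗ[𝕜] MultSeq 𝕜 V :=
  LinearMap.mk₂ 𝕜 (seqBracket 𝒱)
    (fun x x' y => by
      funext N
      simp only [seqBracket, Pi.add_apply, nrBracket_add_left, sum_add_distrib])
    (fun c x y => by
      funext N
      simp only [seqBracket, Pi.smul_apply, nrBracket_smul_left, smul_sum])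
    (fun x => (seqAd 𝒱 x).map_add) (fun c x => (seqAd 𝒱 x).map_smul c)

theorem seqBracketLin_apply (x y : MultSeq 𝕜 V) :
    seqBracketLin 𝒱 x y = seqBracket 𝒱 x y := rfl

theorem seqBracket_mem_seqFil {K L : ℕ} {x y : MultSeq 𝕜 V} (hx : x ∈ seqFil 𝕜 V K)
    (hy : y ∈ seqFil 𝕜 V L) : seqBracket 𝒱 x y ∈ seqFil 𝕜 V (K + L) := by
  intro N hN
  refine sum_eq_zero fun i _ => ?_
  rcases lt_or_ge (i : ℕ) K with h | h
  · rw [hx _ h, nrBracket_zero_left]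
  · rw [hy _ (by omega), nrBracket_zero_right]

theorem nrBracket_single_right {n m N l : ℕ} (h : n + l = N) (h' : n + m = N) (f : Mult 𝕜 V n)
    (g : Mult 𝕜 V m) :
    nrBracket 𝒱 h f ((Pi.single m g : MultSeq 𝕜 V) l) = nrBracket 𝒱 h' f g := by
  obtain rfl : l = m := by omega
  rw [Pi.single_eq_same]

theorem nrBracket_single_left {n k N l : ℕ} (hk : k = n) (h : k + l = N) (h' : n + l = N)
    (f : Mult 𝕜 V n) (y : MultSeq 𝕜 V) :
    nrBracket 𝒱 h ((Pi.single n f : MultSeq 𝕜 V) k) (y l) = nrBracket 𝒱 h' f (y l) := by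
  subst hk
  rw [Pi.single_eq_same]

theorem nrBracket_apply_congr {n l m N : ℕ} (hl : l = m) (h : n + l = N) (h' : n + m = N)
    (f : Mult 𝕜 V n) (y : MultSeq 𝕜 V) :
    nrBracket 𝒱 h f (y l) = nrBracket 𝒱 h' f (y m) := by
  subst hl
  rfl

theorem seqBracket_single_apply {n m N : ℕ} (h : n + m = N) (f : Mult 𝕜 V n) (y : MultSeq 𝕜 V) :
    seqBracket 𝒱 (Pi.single n f) y N = nrBracket 𝒱 h f (y m) := by
  rw [seqBracket, sum_eq_single (⟨n, by omega⟩ : Fin (N + 1))]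
  · rw [nrBracket_single_left 𝒱 rfl _ (by simp only; omega)]
    exact nrBracket_apply_congr 𝒱 (by simp only; omega) _ _ f y
  · intro i _ hi
    rw [Pi.single_eq_of_ne (fun h => hi (Fin.ext h)), nrBracket_zero_left]
  · simp

theorem seqBracket_single_apply_of_lt {n N : ℕ} (h : N < n) (f : Mult 𝕜 V n)
    (y : MultSeq 𝕜 V) : seqBracket 𝒱 (Pi.single n f) y N = 0 := by
  refine sum_eq_zero fun i _ => ?_
  rw [Pi.single_eq_of_ne (by omega), nrBracket_zero_left]

theorem seqBracket_single_single {n m N : ℕ} (h : n + m = N) (f : Mult 𝕜 V n) (g : Mult 𝕜 V m) :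
    seqBracket 𝒱 (Pi.single n f) (Pi.single m g) = Pi.single N (nrBracket 𝒱 h f g) := by
  funext M
  rcases lt_or_ge M n with hM | hM
  · rw [seqBracket_single_apply_of_lt 𝒱 hM, Pi.single_eq_of_ne (by omega)]
  · rw [seqBracket_single_apply 𝒱 (Nat.add_sub_of_le hM)]
    rcases eq_or_ne M N with rfl | hN
    · rw [Pi.single_eq_same, nrBracket_single_right]
    · rw [Pi.single_eq_of_ne hN, Pi.single_eq_of_ne (by omega), nrBracket_zero_right]

theorem seqBracket_mem_symSeq {x y : MultSeq 𝕜 V} (hx : x ∈ symSeq 𝒱) (hy : y ∈ symSeq 𝒱) :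
    seqBracket 𝒱 x y ∈ symSeq 𝒱 := by
  rw [mem_symSeq] at *
  exact fun N => sum_mem fun i _ => nrBracket_mem_symMult 𝒱 _ (hx _) (hy _)

theorem HasParitySeq.seqBracket {x y : MultSeq 𝕜 V} {p q : ZMod 2} (hx : HasParitySeq 𝒱 p x)
    (hy : HasParitySeq 𝒱 q y) : HasParitySeq 𝒱 (p + q) (seqBracket 𝒱 x y) :=
  fun _ => HasParity.sum 𝒱 fun _ _ => HasParity.nrBracket 𝒱 _ (hx _) (hy _)

variable [CharZero 𝕜]

/-- The Jacobi identity in single degrees, extended to infinite sums first in `y`, then in `x`. -/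
theorem seqBracket_single_derivation {n : ℕ} {f : Mult 𝕜 V n} (hf : f ∈ symMult 𝒱 n)
    (hf0 : HasParity 𝒱 0 f) {x y : MultSeq 𝕜 V} (hx : x ∈ symSeq 𝒱) (hy : y ∈ symSeq 𝒱) :
    seqBracket 𝒱 (Pi.single n f) (seqBracket 𝒱 x y) =
      seqBracket 𝒱 (seqBracket 𝒱 (Pi.single n f) x) y +
        seqBracket 𝒱 x (seqBracket 𝒱 (Pi.single n f) y) := by
  rw [mem_symSeq] at hx hy
  have htop : ∀ x, x ∈ seqFil 𝕜 V 0 := fun x => by rw [isSepFiltration_seqFil.zero]; trivial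
  have hl : ∀ {K : ℕ} {x : MultSeq 𝕜 V} (y : MultSeq 𝕜 V), x ∈ seqFil 𝕜 V K →
      seqBracket 𝒱 x y ∈ seqFil 𝕜 V K := fun y hx => seqBracket_mem_seqFil 𝒱 hx (htop y)
  have hr : ∀ {K : ℕ} {y : MultSeq 𝕜 V} (x : MultSeq 𝕜 V), y ∈ seqFil 𝕜 V K →
      seqBracket 𝒱 x y ∈ seqFil 𝕜 V K :=
    fun {_ _} x hy => by simpa using seqBracket_mem_seqFil 𝒱 (htop x) hy
  have h1 : ∀ i j, seqBracket 𝒱 (Pi.single n f)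
      (seqBracket 𝒱 (Pi.single i (x i)) (Pi.single j (y j))) =
      seqBracket 𝒱 (seqBracket 𝒱 (Pi.single n f) (Pi.single i (x i))) (Pi.single j (y j)) +
        seqBracket 𝒱 (Pi.single i (x i)) (seqBracket 𝒱 (Pi.single n f) (Pi.single j (y j))) := by
    intro i j
    rw [seqBracket_single_single 𝒱 (rfl : i + j = i + j),
      seqBracket_single_single 𝒱 (rfl : n + (i + j) = n + (i + j)),
      seqBracket_single_single 𝒱 (rfl : n + i = n + i),
      seqBracket_single_single 𝒱 (add_assoc n i j : n + i + j = n + (i + j)),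
      seqBracket_single_single 𝒱 (rfl : n + j = n + j),
      seqBracket_single_single 𝒱 (add_left_comm i n j : i + (n + j) = n + (i + j)),
      ← Pi.single_add, ← nrBracket_jacobi_of_even 𝒱 rfl rfl rfl _ rfl _ hf (hx i) (hy j) hf0]
  have h2 : ∀ i, seqBracket 𝒱 (Pi.single n f) (seqBracket 𝒱 (Pi.single i (x i)) y) =
      seqBracket 𝒱 (seqBracket 𝒱 (Pi.single n f) (Pi.single i (x i))) y +
        seqBracket 𝒱 (Pi.single i (x i)) (seqBracket 𝒱 (Pi.single n f) y) := by
    intro i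
    rw [← sub_eq_zero]
    exact eq_zero_of_single isSepFiltration_seqFil
      (seqAd 𝒱 (Pi.single n f) ∘ₗ seqAd 𝒱 (Pi.single i (x i)) -
        (seqAd 𝒱 (seqBracket 𝒱 (Pi.single n f) (Pi.single i (x i))) +
          seqAd 𝒱 (Pi.single i (x i)) ∘ₗ seqAd 𝒱 (Pi.single n f)))
      (fun K y hy => sub_mem (hr _ (hr _ hy)) (add_mem (hr _ hy) (hr _ (hr _ hy))))
      fun j => sub_eq_zero.mpr (h1 i j)
  rw [← sub_eq_zero]
  exact eq_zero_of_single isSepFiltration_seqFil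
    (seqAd 𝒱 (Pi.single n f) ∘ₗ (seqBracketLin 𝒱).flip y -
      ((seqBracketLin 𝒱).flip y ∘ₗ seqAd 𝒱 (Pi.single n f) +
        (seqBracketLin 𝒱).flip (seqBracket 𝒱 (Pi.single n f) y)))
    (fun K x hx => sub_mem (hr _ (hl _ hx)) (add_mem (hl _ (hr _ hx)) (hl _ hx)))
    fun i => sub_eq_zero.mpr (h2 i)

end Sequences

/-! ### Brackets with the identity and between linear operators. -/

section Degree

open Finset

variable {𝕜 V : Type*} [Field 𝕜] [AddCommGroup V] [Module 𝕜 V]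
variable (𝒱 : ZMod 2 → Submodule 𝕜 V)

theorem ofLinear_mem_symMult (f : V →ₗ[𝕜] V) : ofLinear f ∈ symMult 𝒱 0 :=
  fun _ _ _ i => i.elim0

theorem hasParity_id : HasParity 𝒱 0 (ofLinear LinearMap.id) := by
  intro d v hv
  rw [zero_add, Fin.sum_univ_one]
  exact hv 0

variable [DirectSum.Decomposition 𝒱]

/-- If the insertion is already supersymmetric, every shuffle contributes it once. -/
theorem nrProd_eq_choose_smul {n m N : ℕ} (h : n + m = N) {f : Mult 𝕜 V n} {g : Mult 𝕜 V m}
    (hfg : insertFirst h f g ∈ symMult 𝒱 N) :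
    nrProd 𝒱 h f g = (N + 1).choose (m + 1) • insertFirst h f g := by
  rw [nrProd, sum_congr rfl fun σ _ => koszulPerm_eq_self 𝒱 hfg σ, sum_const,
    card_shuffles (by omega)]

theorem nrProd_id_left {n : ℕ} (h : 0 + n = n) {f : Mult 𝕜 V n} (hf : f ∈ symMult 𝒱 n) :
    nrProd 𝒱 h (ofLinear LinearMap.id) f = f := by
  have h1 : insertFirst h (ofLinear LinearMap.id) f = f := rfl
  rw [nrProd_eq_choose_smul 𝒱 h (by rwa [h1]), h1, Nat.choose_self, one_smul]

theorem nrProd_id_right {n : ℕ} (h : n + 0 = n) {f : Mult 𝕜 V n} (hf : f ∈ symMult 𝒱 n) :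
    nrProd 𝒱 h f (ofLinear LinearMap.id) = (n + 1) • f := by
  have h1 : insertFirst h f (ofLinear LinearMap.id) = f := by
    ext v
    rw [insertFirst_apply]
    congr 1
    funext i
    refine Fin.cases rfl (fun j => ?_) i
    rw [Fin.cons_succ]
    congr 1
    ext
    simp [add_comm]
  rw [nrProd_eq_choose_smul 𝒱 h (by rwa [h1]), h1, zero_add, Nat.choose_one_right]

/-- `Id ⊼ f = f`, while `f ⊼ Id = (n + 1) f` counts the arguments of `f`. Thus `Id` acts as minus
the degree. -/
theorem nrBracket_id_left {n : ℕ} (h : 0 + n = n) {f : Mult 𝕜 V n} (hf : f ∈ symMult 𝒱 n) :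
    nrBracket 𝒱 h (ofLinear LinearMap.id) f = -((n : 𝕜) • f) := by
  have h1 : ∀ p, nrBracket 𝒱 h (ofLinear LinearMap.id) (parityPart 𝒱 p f) =
      -((n : 𝕜) • parityPart 𝒱 p f) := fun p => by
    rw [nrBracket_eq_of_hasParity 𝒱 h rfl (hasParity_id 𝒱) (hasParity_parityPart 𝒱 p f),
      nrProd_id_left 𝒱 h (parityPart_mem_symMult 𝒱 p hf),
      nrProd_id_right 𝒱 rfl (parityPart_mem_symMult 𝒱 p hf), paritySign_zero_left, one_smul,
      add_smul, one_smul, Nat.cast_smul_eq_nsmul]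
    abel
  rw [← sum_parityPart 𝒱 f, nrBracket_sum_right, sum_congr rfl fun p _ => h1 p, smul_sum,
    sum_neg_distrib]

theorem parityPart_ofLinear (p : ZMod 2) (f : V →ₗ[𝕜] V) :
    parityPart 𝒱 p (ofLinear f) = ofLinear (linearParityPart 𝒱 p f) := by
  ext v
  rw [parityPart, linearParityPart, _root_.sum_apply]
  change _ = (∑ d : ZMod 2, parityProj 𝒱 (p + d) ∘ₗ f ∘ₗ parityProj 𝒱 d) (v 0)
  rw [LinearMap.sum_apply]
  refine Fintype.sum_equiv (Equiv.funUnique (Fin 1) (ZMod 2)) _ _ fun d => ?_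
  simp [ofLinear]

theorem nrBracket_ofLinear (h : 0 + 0 = 0) (f g : V →ₗ[𝕜] V) :
    nrBracket 𝒱 h (ofLinear f) (ofLinear g) = ofLinear (superCommutator 𝒱 f g) := by
  have h1 : ∀ (h : 0 + 0 = 0) (f g : V →ₗ[𝕜] V),
      nrProd 𝒱 h (ofLinear f) (ofLinear g) = ofLinear (f ∘ₗ g) := fun h f g => by
    rw [nrProd_eq_choose_smul 𝒱 h (fun _ _ _ i => i.elim0)]
    simp only [zero_add, Nat.choose_self, one_smul]
    rfl
  have h2 : ∀ f : V →ₗ[𝕜] V, ofLinear f =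
    MultilinearMap.ofSubsingletonₗ 𝕜 𝕜 V V (0 : Fin 1) f := fun _ => rfl
  rw [nrBracket, superCommutator]
  simp only [parityPart_ofLinear, h1]
  simp only [h2, map_sum, map_sub, map_zsmul]

end Degree

/-! ### The Koszul exponential as an automorphism of `D(A)`. -/

section Exponential

open Finset

variable {𝕜 A : Type*} [Field 𝕜] [NonUnitalRing A] [Module 𝕜 A] [IsScalarTower 𝕜 A A]
  [SMulCommClass 𝕜 A A]
variable (𝒜 : ZMod 2 → Submodule 𝕜 A) [DirectSum.Decomposition 𝒜]

theorem rho_apply {n m N : ℕ} (h : n + m = N) (x : MultSeq 𝕜 A) :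
    rho 𝒜 n x N = nrBracket 𝒜 h (mu 𝒜 n) (x m) :=
  seqBracket_single_apply 𝒜 h _ x

theorem koszulGenerator_apply (x : MultSeq 𝕜 A) (N : ℕ) :
    koszulGenerator 𝒜 x N = -∑ n ∈ Icc 1 N, (koszulNumber n : 𝕜) • rho 𝒜 n x N := by
  simp only [koszulGenerator, LinearMap.pi_apply, LinearMap.neg_apply, LinearMap.sum_apply,
      LinearMap.smul_apply, LinearMap.comp_apply, LinearMap.proj_apply]

theorem raises_koszulGenerator : Raises (seqFil 𝕜 A) (koszulGenerator 𝒜) := by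
  intro K x hx N hN
  rw [koszulGenerator_apply, neg_eq_zero]
  refine sum_eq_zero fun n hn => ?_
  rw [rho_apply_congr 𝒜 (mem_Icc.mp hn).1 fun M hM => hx M (by omega), smul_zero]

theorem isFilteredExp_koszulExp :
    IsFilteredExp (seqFil 𝕜 A) (koszulGenerator 𝒜) (koszulExp 𝒜) :=
  isFilteredExp_seqExp (raises_koszulGenerator 𝒜)

theorem rho_mem_symSeq (n : ℕ) {x : MultSeq 𝕜 A} (hx : x ∈ symSeq 𝒜) :
    rho 𝒜 n x ∈ symSeq 𝒜 :=
  seqBracket_mem_symSeq 𝒜 (single_mem_symSeq 𝒜 (mu_mem_symMult 𝒜 n)) hx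

theorem koszulGenerator_mem_symSeq {x : MultSeq 𝕜 A} (hx : x ∈ symSeq 𝒜) :
    koszulGenerator 𝒜 x ∈ symSeq 𝒜 := by
  rw [mem_symSeq]
  intro N
  rw [koszulGenerator_apply]
  exact neg_mem (sum_mem fun n _ => Submodule.smul_mem _ _
    ((mem_symSeq 𝒜).mp (rho_mem_symSeq 𝒜 n hx) N))

theorem koszulExp_mem_symSeq {x : MultSeq 𝕜 A} (hx : x ∈ symSeq 𝒜) :
    koszulExp 𝒜 x ∈ symSeq 𝒜 :=
  seqExp_mem_symSeq 𝒜 (fun _ => koszulGenerator_mem_symSeq 𝒜) hx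

theorem koszulGenerator_sub_mem (M : ℕ) (x : MultSeq 𝕜 A) :
    koszulGenerator 𝒜 x - (-∑ n ∈ Icc 1 M, (koszulNumber n : 𝕜) • rho 𝒜 n) x ∈
      seqFil 𝕜 A (M + 1) := by
  intro N hN
  rw [Pi.sub_apply, koszulGenerator_apply, LinearMap.neg_apply, LinearMap.sum_apply, Pi.neg_apply,
    Finset.sum_apply, sub_eq_zero]
  refine congrArg Neg.neg (sum_subset (Icc_subset_Icc_right (by omega)) fun n _ hn => ?_)
  have h : N < n := by simp at *; omega
  exact (congrArg _ (rho_apply_of_lt 𝒜 h x)).trans (smul_zero _)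

variable [SetLike.GradedMul 𝒜]

theorem HasParitySeq.rho (n : ℕ) {p : ZMod 2} {x : MultSeq 𝕜 A} (hx : HasParitySeq 𝒜 p x) :
    HasParitySeq 𝒜 p (rho 𝒜 n x) := by
  have := HasParitySeq.seqBracket 𝒜 ((hasParity_mu 𝒜 n).single 𝒜) hx
  rwa [zero_add] at this

theorem HasParitySeq.koszulGenerator {p : ZMod 2} {x : MultSeq 𝕜 A} (hx : HasParitySeq 𝒜 p x) :
    HasParitySeq 𝒜 p (koszulGenerator 𝒜 x) := by
  intro N
  rw [koszulGenerator_apply, ← neg_one_smul 𝕜]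
  exact HasParity.smul 𝒜 (HasParity.sum 𝒜 fun n _ =>
    HasParity.smul 𝒜 (HasParitySeq.rho 𝒜 n hx N) _) _

theorem HasParitySeq.koszulExp {p : ZMod 2} {x : MultSeq 𝕜 A} (hx : HasParitySeq 𝒜 p x) :
    HasParitySeq 𝒜 p (koszulExp 𝒜 x) :=
  HasParitySeq.seqExp 𝒜 (fun _ => HasParitySeq.koszulGenerator 𝒜) hx

variable [CharZero 𝕜]

theorem rho_seqBracket (n : ℕ) {x y : MultSeq 𝕜 A} (hx : x ∈ symSeq 𝒜) (hy : y ∈ symSeq 𝒜) :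
    rho 𝒜 n (seqBracket 𝒜 x y) =
      seqBracket 𝒜 (rho 𝒜 n x) y + seqBracket 𝒜 x (rho 𝒜 n y) :=
  seqBracket_single_derivation 𝒜 (mu_mem_symMult 𝒜 n) (hasParity_mu 𝒜 n) hx hy

/-- Finite partial sums of the generator are derivations, and they approximate it to arbitrary
filtration degree by `koszulGenerator_sub_mem`. -/
theorem koszulGenerator_seqBracket {x y : MultSeq 𝕜 A} (hx : x ∈ symSeq 𝒜)
    (hy : y ∈ symSeq 𝒜) :
    koszulGenerator 𝒜 (seqBracket 𝒜 x y) =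
      seqBracket 𝒜 (koszulGenerator 𝒜 x) y + seqBracket 𝒜 x (koszulGenerator 𝒜 y) := by
  refine isSepFiltration_seqFil.eq_of_sub_mem fun M => ?_
  have htop : ∀ x, x ∈ seqFil 𝕜 A 0 := fun x => by rw [isSepFiltration_seqFil.zero]; trivial
  set D : MultSeq 𝕜 A →ₗ[𝕜] MultSeq 𝕜 A := -∑ n ∈ Icc 1 M, (koszulNumber n : 𝕜) • rho 𝒜 n with hD
  have hder : D (seqBracket 𝒜 x y) = seqBracket 𝒜 (D x) y + seqBracket 𝒜 x (D y) := by
    have h1 : ∀ n, rho 𝒜 n (seqBracketLin 𝒜 x y) =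
      seqBracketLin 𝒜 (rho 𝒜 n x) y + seqBracketLin 𝒜 x (rho 𝒜 n y) :=
      fun n => rho_seqBracket 𝒜 n hx hy
    simp only [← seqBracketLin_apply, hD, LinearMap.neg_apply, LinearMap.sum_apply,
      LinearMap.smul_apply, map_neg, map_sum, map_smul, h1, smul_add, sum_add_distrib, neg_add]
  have h1 := koszulGenerator_sub_mem 𝒜 M (seqBracket 𝒜 x y)
  have h2 := seqBracket_mem_seqFil 𝒜 (koszulGenerator_sub_mem 𝒜 M x) (htop y)
  have h3 := seqBracket_mem_seqFil 𝒜 (htop x) (koszulGenerator_sub_mem 𝒜 M y)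
  rw [zero_add] at h3
  rw [← hD] at h1 h2 h3
  have h4 := sub_mem h1 (add_mem h2 h3)
  refine isSepFiltration_seqFil.anti (Nat.le_succ M) ?_
  convert h4 using 1
  simp only [← seqBracketLin_apply, map_sub, LinearMap.sub_apply] at hder ⊢
  rw [hder]
  abel

theorem koszulExp_seqBracket {x y : MultSeq 𝕜 A} (hx : x ∈ symSeq 𝒜) (hy : y ∈ symSeq 𝒜) :
    koszulExp 𝒜 (seqBracket 𝒜 x y) = seqBracket 𝒜 (koszulExp 𝒜 x) (koszulExp 𝒜 y) :=
  have hF := isSepFiltration_seqFil (𝕜 := 𝕜) (V := A)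
  have hD := raises_koszulGenerator 𝒜
  have hE := isFilteredExp_koszulExp 𝒜
  IsFilteredExp.map_bilin hF hF hF hD hD hE hE hE (seqBracketLin 𝒜)
    (fun _ _ _ hx _ hy => seqBracket_mem_seqFil 𝒜 hx hy) fun j =>
    leibniz_pow (seqBracketLin 𝒜) (symSeq 𝒜) (symSeq 𝒜)
      (fun _ => koszulGenerator_mem_symSeq 𝒜) (fun _ => koszulGenerator_mem_symSeq 𝒜)
      (fun _ hx _ hy => koszulGenerator_seqBracket 𝒜 hx hy) j hx hy

end Exponential

/-! ### Transport from vector fields, and the higher antibrackets. -/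

section Antibracket

open Finset PowerSeries

section

variable {𝕜 : Type*} [Field 𝕜] [CharZero 𝕜]

theorem coeff_fieldAd_koszulSeries {p : 𝕜⟦X⟧} (hp : coeff 0 p = 0) (N : ℕ) :
    coeff (N + 1) (fieldAd (koszulSeries 𝕜) p) =
      ∑ q ∈ antidiagonal N, (koszulNumber q.1 : 𝕜) / (Nat.factorial (q.1 + 1) : 𝕜) *
        ((q.2 : 𝕜) - (q.1 : 𝕜)) * coeff (q.2 + 1) p := by
  have h0 : coeff 0 (koszulSeries 𝕜) = 0 := by simp [coeff_koszulSeries, koszulNumber]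
  rw [fieldAd_apply, map_sub, coeff_mul, coeff_mul, Nat.sum_antidiagonal_succ,
    Nat.sum_antidiagonal_succ', hp, h0, mul_zero, zero_mul, zero_add, zero_add,
    ← sum_sub_distrib]
  refine sum_congr rfl fun q _ => ?_
  rw [coeff_derivative_koszulSeries, coeff_koszulSeries, coeff_derivative, Nat.add_sub_cancel,
    Nat.factorial_succ]
  have h1 : (Nat.factorial q.1 : 𝕜) ≠ 0 := factorial_cast_ne_zero q.1
  have h2 : (q.1 : 𝕜) + 1 ≠ 0 := by exact_mod_cast Nat.succ_ne_zero q.1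
  push_cast
  field_simp
  ring

end

variable {𝕜 A : Type*} [Field 𝕜] [NonUnitalRing A] [Module 𝕜 A] [IsScalarTower 𝕜 A A]
  [SMulCommClass 𝕜 A A]
variable (𝒜 : ZMod 2 → Submodule 𝕜 A) [DirectSum.Decomposition 𝒜]

/-- The linear map `t^(n+1) ↦ -(n+1)! μ_n`. It intertwines the action of vector fields on the line
with the operators `ρ_n`. -/
noncomputable def seriesToSeq : 𝕜⟦X⟧ →ₗ[𝕜] MultSeq 𝕜 A where
  toFun p N := -((Nat.factorial (N + 1) : 𝕜) * coeff (N + 1) p) • mu 𝒜 N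
  map_add' p q := by
    funext N
    rw [map_add, mul_add, neg_add, add_smul]
    rfl
  map_smul' c p := by
    funext N
    rw [map_smul, smul_eq_mul, mul_left_comm, ← mul_neg, mul_smul]
    rfl

theorem seriesToSeq_apply (p : 𝕜⟦X⟧) (N : ℕ) :
    seriesToSeq 𝒜 p N = -((Nat.factorial (N + 1) : 𝕜) * coeff (N + 1) p) • mu 𝒜 N := rfl

theorem koszulGenerator_apply_antidiagonal (x : MultSeq 𝕜 A) (N : ℕ) :
    koszulGenerator 𝒜 x N = -∑ q ∈ antidiagonal N, (koszulNumber q.1 : 𝕜) • rho 𝒜 q.1 x N := by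
  rw [koszulGenerator_apply, Nat.sum_antidiagonal_eq_sum_range_succ
    (fun a _ => (koszulNumber a : 𝕜) • rho 𝒜 a x N)]
  refine congrArg Neg.neg (sum_subset (fun n hn => by simp at *; omega) fun n h1 h2 => ?_)
  obtain rfl : n = 0 := by simp at *; omega
  simp [koszulNumber]

theorem antibracket_mem_symSeq (f : A →ₗ[𝕜] A) : antibracket 𝒜 f ∈ symSeq 𝒜 :=
  koszulExp_mem_symSeq 𝒜 (single_mem_symSeq 𝒜 (ofLinear_mem_symMult 𝒜 f))

theorem antibracket_zero (f : A →ₗ[𝕜] A) : antibracket 𝒜 f 0 = ofLinear f := by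
  rw [antibracket]
  refine (seqExp_apply _ _ 0).trans ?_
  simp

variable [SetLike.GradedMul 𝒜] [CharZero 𝕜]

/-- The relation `[t^(a+1) ∂, t^(b+1) ∂] = (b - a) t^(a+b+1) ∂` matches `nrBracket_mu` under
`t^(n+1) ∂ ↦ -(n+1)! μ_n`. The constant term of `p` must vanish because `∂` has no counterpart among
the `μ_n`. -/
theorem seriesToSeq_fieldAd {p : 𝕜⟦X⟧} (hp : coeff 0 p = 0) :
    seriesToSeq 𝒜 (fieldAd (koszulSeries 𝕜) p) = koszulGenerator 𝒜 (seriesToSeq 𝒜 p) := by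
  funext N
  rw [seriesToSeq_apply, coeff_fieldAd_koszulSeries hp, koszulGenerator_apply_antidiagonal,
    neg_smul, mul_sum, sum_smul]
  refine congrArg Neg.neg (sum_congr rfl fun q hq => ?_)
  have hq' := HasAntidiagonal.mem_antidiagonal.mp hq
  rw [rho_apply 𝒜 hq', seriesToSeq_apply, nrBracket_smul_right, nrBracket_mu, smul_smul, smul_smul]
  congr 1
  have h1 : (Nat.factorial (q.1 + 1) : 𝕜) ≠ 0 := factorial_cast_ne_zero _
  have h2 : (Nat.factorial (q.2 + 1) : 𝕜) ≠ 0 := factorial_cast_ne_zero _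
  field_simp
  ring

theorem antibracket_id (n : ℕ) :
    antibracket 𝒜 LinearMap.id n = ((-1 : 𝕜) ^ n) • mu 𝒜 n := by
  have hk := raises_fieldAd (koszulSeries_mem (𝕜 := 𝕜))
  have hX : (X : 𝕜⟦X⟧) ∈ orderFil 𝕜 1 := fun n hn => by
    rw [Nat.lt_one_iff.mp hn, coeff_zero_X]
  have hpow : ∀ k, seriesToSeq 𝒜 ((fieldAd (koszulSeries 𝕜) ^ k) X) =
      (koszulGenerator 𝒜 ^ k) (seriesToSeq 𝒜 X) := fun k => by
    induction k with
    | zero => rfl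
    | succ k ih =>
      rw [pow_succ', pow_succ', Module.End.mul_apply, Module.End.mul_apply,
        seriesToSeq_fieldAd 𝒜 (hk.pow k 1 X hX 0 (by omega)), ih]
  have h1 := IsFilteredExp.map_eq isSepFiltration_seqFil (isFilteredExp_seriesExp hk)
    (isFilteredExp_koszulExp 𝒜) (seriesToSeq 𝒜)
    (fun K p hp N hN => by
      rw [seriesToSeq_apply, hp (N + 1) (by omega), mul_zero, neg_zero, zero_smul]) hpow
  -- The field `t ∂` corresponds to `-μ_0 = -Id`; this sign cancels at the end.
  have h2 : seriesToSeq 𝒜 X = -(Pi.single 0 (ofLinear LinearMap.id) : MultSeq 𝕜 A) := by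
    funext N
    rw [seriesToSeq_apply, coeff_X, Pi.neg_apply]
    rcases N with _ | N
    · simp [mu_zero]
    · simp
  rw [h2, map_neg, seriesExp_fieldAd_koszulSeries_X] at h1
  have h3 := congrFun h1 n
  rw [seriesToSeq_apply, Pi.neg_apply, neg_smul, neg_inj, coeff_mk, if_neg (Nat.succ_ne_zero n)]
    at h3
  rw [antibracket, ← h3, mul_div_cancel₀ _ (factorial_cast_ne_zero _)]
  congr 1
  ring

theorem antibracket_superCommutator (f g : A →ₗ[𝕜] A) :
    antibracket 𝒜 (superCommutator 𝒜 f g) =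
      seqBracket 𝒜 (antibracket 𝒜 f) (antibracket 𝒜 g) := by
  have h := koszulExp_seqBracket 𝒜 (single_mem_symSeq 𝒜 (ofLinear_mem_symMult 𝒜 f))
    (single_mem_symSeq 𝒜 (ofLinear_mem_symMult 𝒜 g))
  rwa [seqBracket_single_single 𝒜 (rfl : 0 + 0 = 0), nrBracket_ofLinear] at h

/-- `Id` has bracket 0 with a linear operator, and the exponential respects brackets. -/
theorem seqBracket_antibracket_id (f : A →ₗ[𝕜] A) :
    seqBracket 𝒜 (antibracket 𝒜 LinearMap.id) (antibracket 𝒜 f) = 0 := by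
  have hf := ofLinear_mem_symMult 𝒜 f
  rw [antibracket, antibracket, ← koszulExp_seqBracket 𝒜
    (single_mem_symSeq 𝒜 (ofLinear_mem_symMult 𝒜 _)) (single_mem_symSeq 𝒜 hf),
    seqBracket_single_single 𝒜 (rfl : 0 + 0 = 0), nrBracket_id_left 𝒜 _ hf]
  simp

/-- In `[Φ_Id, Φ_f] = 0` the term with `μ_0 = Id` is `-n` times the top antibracket; solving for it
gives the recursion. -/
theorem antibracket_recursion (f : A →ₗ[𝕜] A) {n : ℕ} (hn : 1 ≤ n)
    (hh : ∀ h : Fin n, (h : ℕ) + 1 + (n - (h + 1)) = n) :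
    antibracket 𝒜 f n =
      (n : 𝕜)⁻¹ • ∑ h : Fin n, ((-1 : 𝕜) ^ ((h : ℕ) + 1)) •
        nrBracket 𝒜 (hh h) (mu 𝒜 (h + 1)) (antibracket 𝒜 f (n - (h + 1))) := by
  have h1 : seqBracket 𝒜 (antibracket 𝒜 LinearMap.id) (antibracket 𝒜 f) n = 0 := by
    rw [seqBracket_antibracket_id]
    rfl
  rw [seqBracket, Fin.sum_univ_succ] at h1
  simp only [antibracket_id, nrBracket_smul_left] at h1
  have h2 : nrBracket 𝒜 (Nat.zero_add n) (mu 𝒜 0) (antibracket 𝒜 f n) =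
      -((n : 𝕜) • antibracket 𝒜 f n) := by
    rw [mu_zero]
    exact nrBracket_id_left 𝒜 _ ((mem_symSeq 𝒜).mp (antibracket_mem_symSeq 𝒜 f) n)
  have h3 : (-((n : 𝕜) • antibracket 𝒜 f n)) + ∑ h : Fin n, ((-1 : 𝕜) ^ ((h : ℕ) + 1)) •
        nrBracket 𝒜 (hh h) (mu 𝒜 (h + 1)) (antibracket 𝒜 f (n - (h + 1))) = 0 := by
    rw [← h2]
    refine Eq.trans ?_ h1
    refine congrArg₂ (· + ·) ?_ rfl
    exact ((congrArg (· • nrBracket 𝒜 (Nat.zero_add n) (mu 𝒜 0) (antibracket 𝒜 f n))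
      (pow_zero (-1 : 𝕜))).trans (one_smul 𝕜 _)).symm
  have hn' : (n : 𝕜) ≠ 0 := Nat.cast_ne_zero.mpr (by omega)
  rw [← neg_add_eq_zero.mp h3, smul_smul, inv_mul_cancel₀ hn', one_smul]

end Antibracket

end SuperNR

theorem mainTheorem6 {𝕜 A : Type*} [Field 𝕜] [CharZero 𝕜] [NonUnitalRing A] [Module 𝕜 A]
    [IsScalarTower 𝕜 A A] [SMulCommClass 𝕜 A A]
    (𝒜 : ZMod 2 → Submodule 𝕜 A) [DirectSum.Decomposition 𝒜] [SetLike.GradedMul 𝒜] :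
    -- `μ_n` is an even element of `D_n(A)`
    (∀ n, SuperNR.mu 𝒜 n ∈ SuperNR.symMult 𝒜 n ∧ SuperNR.HasParity 𝒜 0 (SuperNR.mu 𝒜 n)) ∧
    -- if `A` is supercommutative, then `μ_n` is the multiplication
    ((∀ (i j : ZMod 2) (a b : A), a ∈ 𝒜 i → b ∈ 𝒜 j → a * b = SuperNR.paritySign i j • (b * a)) →
      ∀ n, SuperNR.mu 𝒜 n = SuperNR.mulMap 𝕜 A n) ∧
    -- the bracket relations
    (∀ n m : ℕ, SuperNR.nrBracket 𝒜 (rfl : n + m = n + m) (SuperNR.mu 𝒜 n) (SuperNR.mu 𝒜 m) =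
      (((n : 𝕜) - (m : 𝕜)) * ((Nat.factorial (n + m + 1) : 𝕜) /
        ((Nat.factorial (n + 1) : 𝕜) * (Nat.factorial (m + 1) : 𝕜)))) • SuperNR.mu 𝒜 (n + m)) ∧
    -- `D(A)` is closed under the bracket
    (∀ x ∈ SuperNR.symSeq 𝒜, ∀ y ∈ SuperNR.symSeq 𝒜,
      SuperNR.seqBracket 𝒜 x y ∈ SuperNR.symSeq 𝒜) ∧
    -- `ρ_n` is an even derivation of `D(A)`
    (∀ n, (∀ x ∈ SuperNR.symSeq 𝒜, SuperNR.rho 𝒜 n x ∈ SuperNR.symSeq 𝒜) ∧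
      (∀ p, ∀ x ∈ SuperNR.symSeq 𝒜, SuperNR.HasParitySeq 𝒜 p x →
        SuperNR.HasParitySeq 𝒜 p (SuperNR.rho 𝒜 n x)) ∧
      (∀ x ∈ SuperNR.symSeq 𝒜, ∀ y ∈ SuperNR.symSeq 𝒜,
        SuperNR.rho 𝒜 n (SuperNR.seqBracket 𝒜 x y) =
          SuperNR.seqBracket 𝒜 (SuperNR.rho 𝒜 n x) y +
            SuperNR.seqBracket 𝒜 x (SuperNR.rho 𝒜 n y))) ∧
    -- the exponential is an isomorphism of Lie superalgebras `D(A) → D(A)`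
    (∃ E : SuperNR.symSeq 𝒜 ≃ₗ[𝕜] SuperNR.symSeq 𝒜,
      (∀ x, (E x : SuperNR.MultSeq 𝕜 A) = SuperNR.koszulExp 𝒜 x) ∧
      (∀ (p : ZMod 2) (x : SuperNR.symSeq 𝒜), SuperNR.HasParitySeq 𝒜 p (x : SuperNR.MultSeq 𝕜 A) →
        SuperNR.HasParitySeq 𝒜 p (E x : SuperNR.MultSeq 𝕜 A)) ∧
      (∀ x y z : SuperNR.symSeq 𝒜,
        (z : SuperNR.MultSeq 𝕜 A) = SuperNR.seqBracket 𝒜 x y →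
          (E z : SuperNR.MultSeq 𝕜 A) = SuperNR.seqBracket 𝒜 (E x) (E y))) ∧
    -- the higher antibrackets are elements of `D(A)`
    (∀ f : A →ₗ[𝕜] A, SuperNR.antibracket 𝒜 f ∈ SuperNR.symSeq 𝒜) ∧
    -- the higher antibrackets of the identity
    (∀ n, SuperNR.antibracket 𝒜 LinearMap.id n = ((-1 : 𝕜) ^ n) • SuperNR.mu 𝒜 n) ∧
    -- the generalized Jacobi identities
    (∀ (f g : A →ₗ[𝕜] A) (n : ℕ),
      SuperNR.antibracket 𝒜 (SuperNR.superCommutator 𝒜 f g) n =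
        ∑ i : Fin (n + 1), SuperNR.nrBracket 𝒜 (show (i : ℕ) + (n - i) = n by omega)
          (SuperNR.antibracket 𝒜 f i) (SuperNR.antibracket 𝒜 g (n - i))) ∧
    -- the recursive formula
    (∀ f : A →ₗ[𝕜] A, SuperNR.antibracket 𝒜 f 0 = SuperNR.ofLinear f ∧
      ∀ n : ℕ, 1 ≤ n → SuperNR.antibracket 𝒜 f n =
        (n : 𝕜)⁻¹ • ∑ h : Fin n, ((-1 : 𝕜) ^ ((h : ℕ) + 1)) •
          SuperNR.nrBracket 𝒜 (show ((h : ℕ) + 1) + (n - (h + 1)) = n by omega)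
            (SuperNR.mu 𝒜 (h + 1)) (SuperNR.antibracket 𝒜 f (n - (h + 1)))) := by
  refine ⟨fun n => ⟨SuperNR.mu_mem_symMult 𝒜 n, SuperNR.hasParity_mu 𝒜 n⟩,
    SuperNR.mu_eq_mulMap 𝒜, fun n m => SuperNR.nrBracket_mu 𝒜 rfl,
    fun x hx y hy => SuperNR.seqBracket_mem_symSeq 𝒜 hx hy,
    fun n => ⟨fun x hx => SuperNR.rho_mem_symSeq 𝒜 n hx,
      fun p x _ hp => SuperNR.HasParitySeq.rho 𝒜 n hp,
      fun x hx y hy => SuperNR.rho_seqBracket 𝒜 n hx hy⟩,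
    ⟨SuperNR.seqExpEquiv 𝒜 (SuperNR.raises_koszulGenerator 𝒜)
      fun x => SuperNR.koszulGenerator_mem_symSeq 𝒜, fun x => rfl,
      fun p x hp => SuperNR.HasParitySeq.koszulExp 𝒜 hp, fun x y z hz => ?_⟩,
    SuperNR.antibracket_mem_symSeq 𝒜, SuperNR.antibracket_id 𝒜,
    fun f g n => congrFun (SuperNR.antibracket_superCommutator 𝒜 f g) n,
    fun f => ⟨SuperNR.antibracket_zero 𝒜 f, fun n hn => SuperNR.antibracket_recursion 𝒜 f hn _⟩⟩
  change SuperNR.koszulExp 𝒜 z = SuperNR.seqBracket 𝒜 (SuperNR.koszulExp 𝒜 x)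
    (SuperNR.koszulExp 𝒜 y)
  rw [hz, SuperNR.koszulExp_seqBracket 𝒜 x.2 y.2]
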